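/- Let $\Omega_0\subset\mathbb R^2$ be a bounded open set with smooth boundary, $l>0$, and $\Omega=(0,l)\times\Omega_0$, where $x_1\in(0,l)$ is the coordinate along the channel and $(x_2,x_3)\in\Omega_0$. Put $\Gamma_{in}=\{0\}\times\Omega_0$, $\Gamma_{out}=\{l\}\times\Omega_0$, $\Gamma_0=[0,l]\times\partial\Omega_0$, let $n$ be the outward unit normal, and let $p>3$. Then there are $\delta>0$ and $C<\infty$, depending only on $\Omega$ and $p$, such that the following holds for every vector field $U=(U^1,U^2,U^3)\in W^2_p(\Omega)$ with $\|U\|_{W^2_p(\Omega)}\le\delta$ and $U\cdot n=0$ on $\Gamma_0$, every $h\in L_2(\Omega)$ and every $w_{in}\in L_2(\Gamma_{in})$. (Boundary values of $U$ are those of its representative continuous on $\overline\Omega$.) The steady transport problem $$\partial_{x_1}w+U\cdot\nabla w=h\ \text{ in }\Omega,\qquad w=w_{in}\ \text{ on }\Gamma_{in}$$ has a unique weak solution $w$ in $L_\infty(L_2):=L_\infty((0,l);L_2(\Omega_0))$, and it satisfies $$\|w\|_{L_\infty(L_2)}\le C\big(\|w_{in}\|_{L_2(\Gamma_{in})}+\|h\|_{L_2(\Omega)}\big).$$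 Here $w\in L_\infty(L_2)$ is called a weak solution if, with $\tilde u=(1+U^1,U^2,U^3)$, $$-\int_\Omega w\,\tilde u\cdot\nabla\varphi\,dx-\int_\Omega w\,\varphi\,\operatorname{div}\tilde u\,dx=\int_\Omega h\,\varphi\,dx+\int_{\Gamma_{in}}w_{in}\,\varphi\,(1+U^1)\,dS$$ for all $\varphi\in C^1(\overline\Omega)$ with $\varphi=0$ on $\Gamma_{out}$. -/

import Mathlib

open MeasureTheory Set
open scoped ENNReal NNReal ContDiff

noncomputable section

namespace SteadyTransport

/-- The cross-sectional plane, with coordinates `(x₂, x₃)`. -/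
abbrev Plane := EuclideanSpace ℝ (Fin 2)

/-- Three-dimensional space; a point is written `(x₁, (x₂, x₃))`, where `x₁` is the coordinate
along the channel. The measure `volume` on it is the three-dimensional Lebesgue measure. -/
abbrev Space := ℝ × Plane

/-- The coordinate directions of `Space`. -/
def dir : Fin 3 → Space :=
  ![(1, 0), (0, EuclideanSpace.single 0 1), (0, EuclideanSpace.single 1 1)]

/-- Classical partial derivative in the `i`-th coordinate direction. -/
def partialD (i : Fin 3) (φ : Space → ℝ) (x : Space) : ℝ := fderiv ℝ φ x (dir i)

/-! ### Smooth cross-sections, cylinders and the normal on the wall -/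

/-- `ρ` is a smooth local defining function of the open set `Ω₀` near `y`: on the neighbourhood `V`
of `y`, the set `Ω₀` is `{ρ < 0}`, and the gradient of `ρ` does not vanish at `y`. -/
structure IsLocalDefining (Ω₀ : Set Plane) (y : Plane) (V : Set Plane) (ρ : Plane → ℝ) : Prop where
  isOpen : IsOpen V
  mem : y ∈ V
  smooth : ContDiffOn ℝ ∞ ρ V
  lt_iff : ∀ z ∈ V, z ∈ Ω₀ ↔ ρ z < 0
  gradient_ne : gradient ρ y ≠ 0

/-- A bounded open set of the plane with smooth boundary, lying locally on one side of it. -/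
structure IsSmoothBounded (Ω₀ : Set Plane) : Prop where
  isOpen : IsOpen Ω₀
  bounded : Bornology.IsBounded Ω₀
  smooth_boundary : ∀ y ∈ frontier Ω₀, ∃ V ρ, IsLocalDefining Ω₀ y V ρ

/-- `ν` is the outward unit normal to `Ω₀` at the boundary point `y`. -/
def IsOuterUnitNormal (Ω₀ : Set Plane) (y ν : Plane) : Prop :=
  ∃ V ρ, IsLocalDefining Ω₀ y V ρ ∧ ν = ‖gradient ρ y‖⁻¹ • gradient ρ y

/-- The (open) channel `(0, l) × Ω₀`. Its inflow part is `{0} × Ω₀`, its outflow part is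
`{l} × Ω₀`, its wall is `[0, l] × ∂Ω₀`. -/
def channel (Ω₀ : Set Plane) (l : ℝ) : Set Space := Ioo 0 l ×ˢ Ω₀

/-- The outward unit normal on the wall is `(0, ν)`, with `ν` the normal to the cross-section. -/
def wallNormal (ν : Plane) : Fin 3 → ℝ := ![0, ν 0, ν 1]

/-! ### Weak derivatives and the Sobolev space of order two -/

/-- `g` is the weak `i`-th partial derivative of `f` in `Ω`. -/
structure HasWeakPartial (Ω : Set Space) (i : Fin 3) (f g : Space → ℝ) : Prop where
  locInt : LocallyIntegrableOn f Ω
  locInt' : LocallyIntegrableOn g Ω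
  integral_eq : ∀ φ : Space → ℝ, ContDiff ℝ ∞ φ → HasCompactSupport φ → tsupport φ ⊆ Ω →
    ∫ x in Ω, f x * partialD i φ x = - ∫ x in Ω, g x * φ x

open Classical in
/-- The weak `i`-th partial derivative of `f` in `Ω` (determined almost everywhere in `Ω`);
zero when there is none. -/
def weakPartial (Ω : Set Space) (i : Fin 3) (f : Space → ℝ) : Space → ℝ :=
  if h : ∃ g, HasWeakPartial Ω i f g then h.choose else 0

/-- Membership of a scalar function in `W²_p(Ω)`. -/
structure MemW2 (Ω : Set Space) (p : ℝ≥0∞) (f : Space → ℝ) : Prop where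
  memLp : MemLp f p (volume.restrict Ω)
  hasWeak₁ : ∀ i, ∃ g, HasWeakPartial Ω i f g
  memLp₁ : ∀ i, MemLp (weakPartial Ω i f) p (volume.restrict Ω)
  hasWeak₂ : ∀ i j, ∃ g, HasWeakPartial Ω j (weakPartial Ω i f) g
  memLp₂ : ∀ i j, MemLp (weakPartial Ω j (weakPartial Ω i f)) p (volume.restrict Ω)

/-- The norm of `W²_p(Ω)`: the sum of the `L_p` norms of the weak derivatives up to order two. -/
def normW2 (Ω : Set Space) (p : ℝ≥0∞) (f : Space → ℝ) : ℝ≥0∞ :=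
  eLpNorm f p (volume.restrict Ω)
    + ∑ i, eLpNorm (weakPartial Ω i f) p (volume.restrict Ω)
    + ∑ i, ∑ j, eLpNorm (weakPartial Ω j (weakPartial Ω i f)) p (volume.restrict Ω)

/-- The weak divergence of a vector field. -/
def weakDiv (Ω : Set Space) (U : Fin 3 → Space → ℝ) (x : Space) : ℝ :=
  ∑ k, weakPartial Ω k (U k) x

open Classical in
/-- The representative of (the almost-everywhere class on `Ω` of) `f` that is continuous up to the
boundary; for open `Ω` its values on `closure Ω` are determined by the class. Its values on the
boundary are the boundary values (trace) of `f`. Every element of `W²_p`, `p > 3`, of a channel has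
one, and the value is only used for such functions. -/
def contRep (Ω : Set Space) (f : Space → ℝ) : Space → ℝ :=
  if h : ∃ g : Space → ℝ, ContinuousOn g (closure Ω) ∧ g =ᵐ[volume.restrict Ω] f
  then h.choose else 0

/-- `U · n = 0` on the wall `[0, l] × ∂Ω₀`. -/
def TangentOnWall (Ω₀ : Set Plane) (l : ℝ) (U : Fin 3 → Space → ℝ) : Prop :=
  ∀ t ∈ Icc 0 l, ∀ y ∈ frontier Ω₀, ∀ ν, IsOuterUnitNormal Ω₀ y ν →
    ∑ k, contRep (channel Ω₀ l) (U k) (t, y) * wallNormal ν k = 0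

/-! ### The space `L_∞((0, l), L_2(Ω₀))` -/

/-- The norm of `L_∞((0, l), L_2(Ω₀))`. -/
def normLinfL2 (Ω₀ : Set Plane) (l : ℝ) (w : Space → ℝ) : ℝ≥0∞ :=
  essSup (fun t : ℝ => eLpNorm (fun y : Plane => w (t, y)) 2 (volume.restrict Ω₀))
    (volume.restrict (Ioo 0 l))

/-- Membership in `L_∞((0, l), L_2(Ω₀))`. -/
def MemLinfL2 (Ω₀ : Set Plane) (l : ℝ) (w : Space → ℝ) : Prop :=
  AEStronglyMeasurable w (volume.restrict (channel Ω₀ l)) ∧ normLinfL2 Ω₀ l w < ⊤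

/-! ### Weak solutions of the steady transport problem -/

/-- The total transporting field `[1 + U¹, U², U³]`. Its divergence is that of `U`. -/
def tildeU (U : Fin 3 → Space → ℝ) : Fin 3 → Space → ℝ :=
  ![fun x => 1 + U 0 x, U 1, U 2]

/-- Weak solution of `∂₁w + U · ∇w = h` in the channel, `w = w_in` on the inflow part, where `U` is
tangent to the wall: the equation is tested with functions of class `C¹` up to the boundary that
vanish on the outflow part. The weight `1 + U¹` in the inflow integral is minus the normal component
of the transporting field. -/
def IsWeakSolution (Ω₀ : Set Plane) (l : ℝ) (U : Fin 3 → Space → ℝ) (h : Space → ℝ)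
    (w_in : Plane → ℝ) (w : Space → ℝ) : Prop :=
  ∀ φ : Space → ℝ, ContDiff ℝ 1 φ → (∀ y ∈ Ω₀, φ (l, y) = 0) →
    - (∫ x in channel Ω₀ l, w x * ∑ k, tildeU U k x * partialD k φ x)
      - (∫ x in channel Ω₀ l, w x * φ x * weakDiv (channel Ω₀ l) U x)
    = (∫ x in channel Ω₀ l, φ x * h x)
      + ∫ y in Ω₀, w_in y * φ (0, y) * (1 + contRep (channel Ω₀ l) (U 0) (0, y))

end SteadyTransport

end

noncomputable section

namespace SteadyTransport

open Filter Topology Metric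

open scoped Convolution

/-! Since p > 3, Morrey's inequality applied to `U` and to its weak gradient makes both uniformly
small. Hence b = (1 + U¹, U², U³) has a Lipschitz representative with first component at least 1/2,
and its divergence c is bounded by a c₀ with c₀ l ≤ 1/32 (`exists_isTransportField`). The rest
concerns such a field only, and x₁ plays the part of time.

With Gφ = b·∇φ + cφ = div(φb), the weak formulation reads -∫ w Gφ = data(φ), so both existence and
uniqueness are questions about G on test functions that vanish on the outflow part. As b is tangent
to the wall, the divergence theorem between two cross-sections has no lateral term
(`IsTransportField.slice_identity`). For φ² it yields the energy estimate sup_t ‖φ(t)‖ ≤ 8 ∫ ‖Gφ(t)‖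
dt, with L² norms over the cross-section (`IsTransportField.sliceNorm_le`).

Existence: by this estimate the data are a functional of Gφ controlled by its norm in L¹(L²).
Hahn–Banach extends the functional under the same control, Riesz represents it by a function of
L²(Ω), and the L¹(L²) control is, by duality, the L_∞(L²) bound
(`IsTransportField.exists_weak_solution`).

Uniqueness: let v be the difference of two solutions, so that v annihilates the range of G. Since c
is merely bounded, Gφ = g need not have a regular solution φ. But b·∇φ = g has a Lipschitz one,
given by integration along characteristics, and mollification turns it into a test function. The
remaining term cφ is small by the energy estimate, whence |∫ v g| ≤ ½ ‖v‖ ‖g‖ for all g in a dense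
set, and v = 0 (`IsTransportField.ae_eq_zero`). -/

instance isAddHaarMeasure_volume_space : (volume : Measure Space).IsAddHaarMeasure :=
  inferInstanceAs (((volume : Measure ℝ).prod (volume : Measure Plane)).IsAddHaarMeasure)

/-! ### Mollification of Lipschitz and of weakly differentiable functions -/

/-- A standard bump function supported in the ball of radius `1 / (n + 1)`. -/
def bump (n : ℕ) : ContDiffBump (0 : Space) where
  rIn := 1 / (2 * (n + 1))
  rOut := 1 / (n + 1)
  rIn_pos := by positivity
  rIn_lt_rOut := by
    apply one_div_lt_one_div_of_lt <;> [positivity; nlinarith [Nat.cast_nonneg (α := ℝ) n]]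

/-- The mollifying kernel, of integral one. -/
def kernel (n : ℕ) : Space → ℝ := (bump n).normed volume

/-- The mollification of a function at scale `1 / (n + 1)`. -/
def mollify (n : ℕ) (f : Space → ℝ) (x : Space) : ℝ := ∫ z, kernel n z * f (x - z)

lemma tendsto_bump_rOut : Tendsto (fun n => (bump n).rOut) atTop (𝓝 0) :=
  tendsto_one_div_add_atTop_nhds_zero_nat

lemma mollify_eq_convolution (n : ℕ) (f : Space → ℝ) :
    mollify n f = (kernel n ⋆[ContinuousLinearMap.lsmul ℝ ℝ, volume] f) := by
  ext x; simp [mollify, convolution]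

lemma kernel_nonneg (n : ℕ) (z : Space) : 0 ≤ kernel n z := (bump n).nonneg_normed z

lemma integral_kernel (n : ℕ) : ∫ z, kernel n z = 1 := (bump n).integral_normed

lemma contDiff_kernel (n : ℕ) : ContDiff ℝ ∞ (kernel n) := (bump n).contDiff_normed

lemma continuous_kernel (n : ℕ) : Continuous (kernel n) := (contDiff_kernel n).continuous

lemma hasCompactSupport_kernel (n : ℕ) : HasCompactSupport (kernel n) :=
  (bump n).hasCompactSupport_normed

lemma integrable_kernel (n : ℕ) : Integrable (kernel n) := (bump n).integrable_normed

lemma tsupport_kernel (n : ℕ) : tsupport (kernel n) = closedBall 0 (1 / (n + 1)) :=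
  (bump n).tsupport_normed_eq

lemma kernel_eq_zero {n : ℕ} {z : Space} (hz : 1 / ((n : ℝ) + 1) < ‖z‖) : kernel n z = 0 := by
  apply image_eq_zero_of_notMem_tsupport
  rw [tsupport_kernel]; simpa using hz

lemma contDiff_mollify (n : ℕ) {f : Space → ℝ} (hf : LocallyIntegrable f) :
    ContDiff ℝ ∞ (mollify n f) := by
  rw [mollify_eq_convolution]
  exact (hasCompactSupport_kernel n).contDiff_convolution_left _ (contDiff_kernel n) hf

lemma ae_tendsto_mollify {f : Space → ℝ} (hf : LocallyIntegrable f) :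
    ∀ᵐ x, Tendsto (fun n => mollify n f x) atTop (𝓝 (f x)) := by
  simp_rw [mollify_eq_convolution]
  refine ContDiffBump.ae_convolution_tendsto_right_of_locallyIntegrable (φ := bump) (K := 2)
    tendsto_bump_rOut (Eventually.of_forall fun n => ?_) hf
  simp only [bump]
  field_simp
  norm_num

lemma integrable_kernel_mul (n : ℕ) {f : Space → ℝ} (hf : LocallyIntegrable f) (x : Space) :
    Integrable fun z => kernel n z * f (x - z) := by
  have := (hasCompactSupport_kernel n).convolutionExists_left
    (ContinuousLinearMap.lsmul ℝ ℝ) (continuous_kernel n) hf x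
  simpa [ConvolutionExistsAt] using this

lemma abs_mollify_le (n : ℕ) {f : Space → ℝ} {M : ℝ} (x : Space)
    (hM : ∀ᵐ z, ‖z‖ ≤ 1 / ((n : ℝ) + 1) → |f (x - z)| ≤ M) :
    |mollify n f x| ≤ M := by
  calc |mollify n f x| ≤ ∫ z, kernel n z * M := by
        rw [mollify, ← Real.norm_eq_abs]
        apply norm_integral_le_of_norm_le ((integrable_kernel n).mul_const M)
        filter_upwards [hM] with z hz
        rw [norm_mul, Real.norm_of_nonneg (kernel_nonneg n z), Real.norm_eq_abs]
        by_cases h : ‖z‖ ≤ 1 / ((n : ℝ) + 1)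
        · exact mul_le_mul_of_nonneg_left (hz h) (kernel_nonneg n z)
        · rw [kernel_eq_zero (not_le.1 h)]; simp
    _ = M := by rw [integral_mul_const, integral_kernel, one_mul]

lemma mollify_eq_zero (n : ℕ) {f : Space → ℝ} (x : Space)
    (h : ∀ y, dist y x ≤ 1 / ((n : ℝ) + 1) → f y = 0) : mollify n f x = 0 := by
  apply abs_nonpos_iff.1
  apply abs_mollify_le
  refine Eventually.of_forall fun z hz => ?_
  rw [h]; · simp
  simpa [dist_eq_norm] using hz

lemma norm_dir (k : Fin 3) : ‖dir k‖ = 1 := by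
  fin_cases k <;> simp [dir, Prod.norm_def]

lemma ae_differentiableAt_sub {f : Space → ℝ} {L : ℝ≥0} (hf : LipschitzWith L f) (x : Space) :
    ∀ᵐ z, DifferentiableAt ℝ f (x - z) :=
  ((Measure.measurePreserving_sub_left volume x).quasiMeasurePreserving).ae hf.ae_differentiableAt

/-- The derivative falls on `f`, which is differentiable almost everywhere by Rademacher's theorem,
and not on the kernel. Thus the derivatives of the mollifications keep the bound `L` and converge
almost everywhere. -/
lemma partialD_mollify_of_lipschitz (n : ℕ) {f : Space → ℝ} {L : ℝ≥0} (hf : LipschitzWith L f)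
    (k : Fin 3) (x : Space) : partialD k (mollify n f) x = mollify n (partialD k f) x := by
  have key := hasFDerivAt_integral_of_dominated_loc_of_lip (𝕜 := ℝ) (μ := (volume : Measure Space))
    (F := fun x z => kernel n z * f (x - z)) (x₀ := x) (s := univ)
    (F' := fun z => kernel n z • fderiv ℝ f (x - z))
    (bound := fun z => kernel n z * L) univ_mem
    (Eventually.of_forall fun y => (integrable_kernel_mul n hf.continuous.locallyIntegrable y).1)
    (integrable_kernel_mul n hf.continuous.locallyIntegrable x)
    (by
      apply AEStronglyMeasurable.smul (continuous_kernel n).aestronglyMeasurable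
      exact ((measurable_fderiv ℝ f).comp (measurable_const.sub measurable_id)).aestronglyMeasurable)
    (Eventually.of_forall fun z => by
      apply LipschitzWith.lipschitzOnWith
      apply LipschitzWith.of_dist_le_mul
      intro a b
      have h0 := kernel_nonneg n z
      have := hf.dist_le_mul (a - z) (b - z)
      rw [dist_sub_right] at this
      have h3 : |kernel n z * (L : ℝ)| = kernel n z * L := abs_of_nonneg (mul_nonneg h0 L.2)
      rw [Real.coe_nnabs, h3, Real.dist_eq, ← mul_sub, abs_mul, abs_of_nonneg h0, mul_assoc]
      exact mul_le_mul_of_nonneg_left this h0)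
    ((integrable_kernel n).mul_const _)
    (by
      filter_upwards [ae_differentiableAt_sub hf x] with z hz
      have h1 : HasFDerivAt (fun a : Space => a - z) (ContinuousLinearMap.id ℝ Space) x :=
        (hasFDerivAt_id x).sub_const z
      have := (hz.hasFDerivAt.comp x h1).const_mul (kernel n z)
      simpa using this)
  have h2 : fderiv ℝ (mollify n f) x = ∫ z, kernel n z • fderiv ℝ f (x - z) := key.2.fderiv
  rw [partialD, h2, ContinuousLinearMap.integral_apply key.1]
  rfl

lemma abs_partialD_le {f : Space → ℝ} {L : ℝ≥0} (hf : LipschitzWith L f) (k : Fin 3) (x : Space) :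
    |partialD k f x| ≤ L := by
  calc |partialD k f x| ≤ ‖fderiv ℝ f x‖ * ‖dir k‖ := (fderiv ℝ f x).le_opNorm _
    _ ≤ L * 1 := by
      rw [norm_dir]; gcongr; exact norm_fderiv_le_of_lipschitz ℝ hf
    _ = L := mul_one _

lemma measurable_partialD (k : Fin 3) (f : Space → ℝ) : Measurable (partialD k f) :=
  measurable_fderiv_apply_const ℝ f (dir k)

lemma locallyIntegrable_of_bound {f : Space → ℝ} (hf : AEStronglyMeasurable f) {M : ℝ}
    (hM : ∀ x, |f x| ≤ M) : LocallyIntegrable f :=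
  (locallyIntegrable_const M).mono hf (Eventually.of_forall fun x => by
    simpa using (hM x).trans (le_abs_self M))

/-- Smooth approximation of Lipschitz functions, with derivatives converging almost everywhere. -/
lemma ae_tendsto_partialD_mollify {f : Space → ℝ} {L : ℝ≥0} (hf : LipschitzWith L f) (k : Fin 3) :
    ∀ᵐ x, Tendsto (fun n => partialD k (mollify n f) x) atTop (𝓝 (partialD k f x)) := by
  simp_rw [partialD_mollify_of_lipschitz _ hf]
  exact ae_tendsto_mollify (locallyIntegrable_of_bound
    (measurable_partialD k f).aestronglyMeasurable (abs_partialD_le hf k))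

lemma abs_partialD_mollify_le (n : ℕ) {f : Space → ℝ} {L : ℝ≥0} (hf : LipschitzWith L f)
    (k : Fin 3) (x : Space) : |partialD k (mollify n f) x| ≤ L := by
  rw [partialD_mollify_of_lipschitz _ hf]
  exact abs_mollify_le n x (Eventually.of_forall fun z _ => abs_partialD_le hf k _)

lemma abs_mollify_sub_le (n : ℕ) {f : Space → ℝ} {L : ℝ≥0} (hf : LipschitzWith L f) (x : Space) :
    |mollify n f x - f x| ≤ L * (1 / ((n : ℝ) + 1)) := by
  have h1 : mollify n f x - f x = mollify n (fun y => f y - f x) x := by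
    simp only [mollify, mul_sub]
    rw [integral_sub (integrable_kernel_mul n hf.continuous.locallyIntegrable x)
      ((integrable_kernel n).mul_const _), integral_mul_const, integral_kernel, one_mul]
  rw [h1]
  refine abs_mollify_le n x (Eventually.of_forall fun z hz => ?_)
  have := hf.dist_le_mul (x - z) x
  rw [Real.dist_eq, dist_eq_norm, sub_sub_cancel_left, norm_neg] at this
  exact this.trans (by gcongr)

lemma tendsto_mollify_of_lipschitz {f : Space → ℝ} {L : ℝ≥0} (hf : LipschitzWith L f) (x : Space) :
    Tendsto (fun n => mollify n f x) atTop (𝓝 (f x)) := by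
  rw [tendsto_iff_dist_tendsto_zero]
  refine squeeze_zero (fun _ => dist_nonneg) (fun n => abs_mollify_sub_le n hf x) ?_
  simpa using (tendsto_one_div_add_atTop_nhds_zero_nat (𝕜 := ℝ)).const_mul (L : ℝ)

/-- The extension by zero may jump across the boundary, so x must be far enough inside. There the
reflected and translated kernel is a legitimate test function for the weak derivative. -/
lemma partialD_mollify_of_hasWeakPartial (n : ℕ) {Ω : Set Space} (hΩ : IsOpen Ω) {i : Fin 3}
    {f g : Space → ℝ} (h : HasWeakPartial Ω i f g) (hf : IntegrableOn f Ω)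
    {x : Space} (hx : closedBall x (1 / ((n : ℝ) + 1)) ⊆ Ω) :
    partialD i (mollify n (Ω.indicator f)) x = mollify n (Ω.indicator g) x := by
  have hΩm := hΩ.measurableSet
  have hf' : LocallyIntegrable (Ω.indicator f) :=
    ((integrable_indicator_iff hΩm).2 hf).locallyIntegrable
  have hd := (hasCompactSupport_kernel n).hasFDerivAt_convolution_left
    (ContinuousLinearMap.lsmul ℝ ℝ) ((contDiff_kernel n).of_le (by exact_mod_cast le_top)) hf' x
  have hint := ((hasCompactSupport_kernel n).fderiv (𝕜 := ℝ)).convolutionExists_left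
    ((ContinuousLinearMap.lsmul ℝ ℝ).precompL Space)
    ((contDiff_kernel n).continuous_fderiv (by simp)) hf' x
  rw [partialD, mollify_eq_convolution, hd.fderiv, convolution,
    ContinuousLinearMap.integral_apply hint]
  set φ : Space → ℝ := fun y => kernel n (x - y) with hφ
  have hφs : ContDiff ℝ ∞ φ := (contDiff_kernel n).comp (contDiff_const.sub contDiff_id)
  have hφd : ∀ y, partialD i φ y = - fderiv ℝ (kernel n) (x - y) (dir i) := by
    intro y
    have h1 : HasFDerivAt (fun y : Space => x - y) (-ContinuousLinearMap.id ℝ Space) y :=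
      (hasFDerivAt_id y).const_sub x
    have h2 := (((contDiff_kernel n).differentiable (by simp)) (x - y)).hasFDerivAt.comp y h1
    rw [partialD]
    have h3 : fderiv ℝ φ y = _ := h2.fderiv
    rw [h3]; simp
  have hφt : tsupport φ ⊆ closedBall x (1 / ((n : ℝ) + 1)) := by
    apply closure_minimal _ isClosed_closedBall
    intro y hy
    by_contra hc
    apply hy
    apply kernel_eq_zero
    rw [mem_closedBall, not_le, dist_comm, dist_eq_norm] at hc
    exact hc
  have hφc : HasCompactSupport φ :=
    HasCompactSupport.of_support_subset_isCompact (isCompact_closedBall x _)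
      ((subset_tsupport φ).trans hφt)
  have key := h.integral_eq φ hφs hφc (hφt.trans hx)
  calc ∫ z, (((ContinuousLinearMap.lsmul ℝ ℝ).precompL Space) (fderiv ℝ (kernel n) z)
          (Ω.indicator f (x - z))) (dir i)
      = ∫ z, (fun y => - (Ω.indicator f y * partialD i φ y)) (x - z) := by
        congr 1; ext z
        simp [hφd, ContinuousLinearMap.precompL_apply, mul_comm]
    _ = - ∫ y, Ω.indicator f y * partialD i φ y := by
        rw [integral_sub_left_eq_self (fun y => - (Ω.indicator f y * partialD i φ y)) volume x,
          integral_neg]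
    _ = - ∫ y in Ω, f y * partialD i φ y := by
        rw [← integral_indicator hΩm]; simp_rw [← indicator_mul_left]
    _ = ∫ y in Ω, g y * φ y := by rw [key, neg_neg]
    _ = ∫ y, Ω.indicator g y * φ y := by
        rw [← integral_indicator hΩm]; simp_rw [← indicator_mul_left]
    _ = ∫ z, (fun y => Ω.indicator g y * φ y) (x - z) :=
        (integral_sub_left_eq_self (fun y => Ω.indicator g y * φ y) volume x).symm
    _ = mollify n (Ω.indicator g) x := by
        simp [mollify, hφ, mul_comm]

/-! ### The uniform cone property of the channel -/

/-- The uniform interior cone property: near every point of `Ω` there is a common cone direction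
`e`, and the truncated cone over the ball `closedBall e κ` fits into `Ω` at all nearby points. -/
def UniformCone {E : Type*} [NormedAddCommGroup E] [NormedSpace ℝ E] (Ω : Set E) (r κ : ℝ) : Prop :=
  ∀ x ∈ Ω, ∃ e : E, ‖e‖ ≤ 1 ∧ ∀ x' ∈ Ω, dist x' x < r →
    ∀ τ ∈ Icc (0 : ℝ) 1, ∀ v ∈ closedBall e κ, x' + τ • v ∈ Ω

lemma exists_local_cone_of_mem {E : Type*} [NormedAddCommGroup E] [NormedSpace ℝ E] {Ω : Set E}
    (hΩ : IsOpen Ω) {z : E} (hz : z ∈ Ω) :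
    ∃ r > 0, ∃ κ > 0, ∃ e : E, ‖e‖ ≤ 1 ∧ ∀ x' ∈ Ω, dist x' z < r →
      ∀ τ ∈ Icc (0 : ℝ) 1, ∀ v ∈ closedBall e κ, x' + τ • v ∈ Ω := by
  obtain ⟨ρ, hρ, hb⟩ := Metric.isOpen_iff.1 hΩ z hz
  refine ⟨ρ / 2, by positivity, ρ / 4, by positivity, 0, by simp, fun x' _ hd τ hτ v hv => hb ?_⟩
  have hv' : ‖v‖ ≤ ρ / 4 := by simpa using hv
  have h1 : ‖τ • v‖ ≤ ρ / 4 := by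
    rw [norm_smul, Real.norm_of_nonneg hτ.1]
    nlinarith [hτ.1, hτ.2, norm_nonneg v]
  have h2 : dist (x' + τ • v) z ≤ dist x' z + ‖τ • v‖ := by
    rw [dist_eq_norm, dist_eq_norm, add_sub_right_comm]; exact norm_add_le _ _
  rw [mem_ball]; linarith

/-- The axis is opposite to the gradient of ρ at z. Strict differentiability makes ρ decrease along
the cone from every nearby vertex, and it is already negative at a vertex in Ω₀. -/
lemma exists_local_cone_of_isLocalDefining {Ω₀ : Set Plane} {z : Plane} {V : Set Plane}
    {ρ : Plane → ℝ} (h : IsLocalDefining Ω₀ z V ρ) :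
    ∃ r > 0, ∃ κ > 0, ∃ e : Plane, ‖e‖ ≤ 1 ∧ ∀ x' ∈ Ω₀, dist x' z < r →
      ∀ τ ∈ Icc (0 : ℝ) 1, ∀ v ∈ closedBall e κ, x' + τ • v ∈ Ω₀ := by
  set G := gradient ρ z with hG
  have hγ : 0 < ‖G‖ := norm_pos_iff.2 h.gradient_ne
  have hcd : ContDiffAt ℝ ∞ ρ z := (h.smooth.contDiffAt (h.isOpen.mem_nhds h.mem))
  have hs := hcd.hasStrictFDerivAt (by simp)
  -- With relative error ‖G‖/4 the linear part decreases by at least (3/4) s ‖G‖ per unit of τ,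
  -- while the remainder is at most (5/16) s ‖G‖.
  have hev := hs.isLittleO.def (show 0 < ‖G‖ / 4 by positivity)
  have hV : ∀ᶠ p : Plane × Plane in 𝓝 (z, z), p.1 ∈ V ∧ p.2 ∈ V :=
    prod_mem_nhds (h.isOpen.mem_nhds h.mem) (h.isOpen.mem_nhds h.mem)
  obtain ⟨η, hη, hb⟩ := Metric.eventually_nhds_iff.1 (hev.and hV)
  set s := min 1 (η / 4) with hs'
  have hs0 : 0 < s := by positivity
  have hs1 : s ≤ 1 := min_le_left _ _
  have hs2 : s ≤ η / 4 := min_le_right _ _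
  refine ⟨η / 2, by positivity, s / 4, by positivity, -(s / ‖G‖) • G, ?_, ?_⟩
  · rw [norm_smul, norm_neg, Real.norm_of_nonneg (by positivity), div_mul_cancel₀ _ hγ.ne']
    exact hs1
  intro x' hx' hd τ hτ v hv
  have hen : ‖-(s / ‖G‖) • G‖ = s := by
    rw [norm_smul, norm_neg, Real.norm_of_nonneg (by positivity), div_mul_cancel₀ _ hγ.ne']
  rw [mem_closedBall, dist_eq_norm] at hv
  have hvn : ‖v‖ ≤ 5 / 4 * s := by
    have := norm_le_norm_add_norm_sub' v (-(s / ‖G‖) • G)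
    linarith
  have hτv : ‖τ • v‖ = τ * ‖v‖ := by rw [norm_smul, Real.norm_of_nonneg hτ.1]
  have hτv' : τ * ‖v‖ ≤ ‖v‖ := mul_le_of_le_one_left (norm_nonneg _) hτ.2
  have hd2 : dist (x' + τ • v) z < η := by
    have : dist (x' + τ • v) z ≤ dist x' z + ‖τ • v‖ := by
      rw [dist_eq_norm, dist_eq_norm, add_sub_right_comm]; exact norm_add_le _ _
    linarith
  have hpp : dist (x' + τ • v, x') (z, z) < η := by
    rw [Prod.dist_eq]; exact max_lt hd2 (by dsimp only; linarith)
  obtain ⟨h1, h2, h3⟩ := hb hpp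
  dsimp only at h1 h2 h3
  rw [h.lt_iff _ h2]
  have hx0 := (h.lt_iff _ h3).1 hx'
  rw [add_sub_cancel_left, map_smul, hτv, smul_eq_mul] at h1
  have hfd : fderiv ℝ ρ z v = inner ℝ G v := by
    have := (hcd.differentiableAt (by simp)).hasGradientAt.hasFDerivAt.fderiv
    rw [this]; simp [hG]
  have hGe : inner ℝ G (-(s / ‖G‖) • G) = - (s * ‖G‖) := by
    rw [inner_smul_right, real_inner_self_eq_norm_sq]; field_simp
  have hGv : inner ℝ G v ≤ - (3 / 4 * s * ‖G‖) := by
    have h5 : inner ℝ G v = inner ℝ G (-(s / ‖G‖) • G) + inner ℝ G (v - -(s / ‖G‖) • G) := by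
      rw [← inner_add_right]; congr 1; abel
    have h6 := real_inner_le_norm G (v - -(s / ‖G‖) • G)
    have h7 : ‖G‖ * ‖v - -(s / ‖G‖) • G‖ ≤ ‖G‖ * (s / 4) := by gcongr
    rw [h5, hGe]; linarith
  have h8 := (abs_le.1 h1).2
  rw [hfd] at h8
  have h9 : ‖G‖ / 4 * (τ * ‖v‖) ≤ ‖G‖ / 4 * (τ * (5 / 4 * s)) := by gcongr; exact hτ.1
  have h10 : τ * inner ℝ G v ≤ τ * (- (3 / 4 * s * ‖G‖)) := mul_le_mul_of_nonneg_left hGv hτ.1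
  have h11 : 0 ≤ τ * s * ‖G‖ := mul_nonneg (mul_nonneg hτ.1 hs0.le) hγ.le
  linarith

lemma UniformCone.mono {E : Type*} [NormedAddCommGroup E] [NormedSpace ℝ E] {Ω : Set E}
    {r r' κ κ' : ℝ} (h : UniformCone Ω r κ) (hr : r' ≤ r) (hκ : κ' ≤ κ) :
    UniformCone Ω r' κ' := by
  intro x hx
  obtain ⟨e, he, H⟩ := h x hx
  exact ⟨e, he, fun x' hx' hd τ hτ v hv =>
    H x' hx' (hd.trans_le hr) τ hτ v (closedBall_subset_closedBall hκ hv)⟩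

/-- Compactness of the closure: the property passes to finite unions by taking minima of the
constants, and a cone valid within r of z serves every centre in the ball of radius r/2. -/
lemma IsSmoothBounded.uniformCone {Ω₀ : Set Plane} (h : IsSmoothBounded Ω₀) :
    ∃ r > 0, ∃ κ > 0, UniformCone Ω₀ r κ := by
  have hc : IsCompact (closure Ω₀) := h.bounded.isCompact_closure
  have key : ∃ r > 0, ∃ κ > 0, ∀ x ∈ closure Ω₀, ∃ e : Plane, ‖e‖ ≤ 1 ∧
      ∀ x' ∈ Ω₀, dist x' x < r → ∀ τ ∈ Icc (0 : ℝ) 1, ∀ v ∈ closedBall e κ, x' + τ • v ∈ Ω₀ := by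
    refine hc.induction_on (p := fun s => ∃ r > 0, ∃ κ > 0, ∀ x ∈ s, ∃ e : Plane, ‖e‖ ≤ 1 ∧
      ∀ x' ∈ Ω₀, dist x' x < r → ∀ τ ∈ Icc (0 : ℝ) 1, ∀ v ∈ closedBall e κ, x' + τ • v ∈ Ω₀)
      ⟨1, one_pos, 1, one_pos, by simp⟩ ?_ ?_ ?_
    · rintro s t hst ⟨r, hr, κ, hκ, H⟩
      exact ⟨r, hr, κ, hκ, fun x hx => H x (hst hx)⟩
    · rintro s t ⟨r, hr, κ, hκ, H⟩ ⟨r', hr', κ', hκ', H'⟩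
      refine ⟨min r r', lt_min hr hr', min κ κ', lt_min hκ hκ', ?_⟩
      rintro x (hx | hx)
      · obtain ⟨e, he, K⟩ := H x hx
        exact ⟨e, he, fun x' hx' hd τ hτ v hv => K x' hx' (hd.trans_le (min_le_left _ _)) τ hτ v
          (closedBall_subset_closedBall (min_le_left _ _) hv)⟩
      · obtain ⟨e, he, K⟩ := H' x hx
        exact ⟨e, he, fun x' hx' hd τ hτ v hv => K x' hx' (hd.trans_le (min_le_right _ _)) τ hτ v
          (closedBall_subset_closedBall (min_le_right _ _) hv)⟩
    · intro z hz
      have : ∃ r > 0, ∃ κ > 0, ∃ e : Plane, ‖e‖ ≤ 1 ∧ ∀ x' ∈ Ω₀, dist x' z < r →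
          ∀ τ ∈ Icc (0 : ℝ) 1, ∀ v ∈ closedBall e κ, x' + τ • v ∈ Ω₀ := by
        by_cases hzi : z ∈ Ω₀
        · exact exists_local_cone_of_mem h.isOpen hzi
        · have hf : z ∈ frontier Ω₀ := ⟨hz, by rwa [h.isOpen.interior_eq]⟩
          obtain ⟨V, ρ, hV⟩ := h.smooth_boundary z hf
          exact exists_local_cone_of_isLocalDefining hV
      obtain ⟨r, hr, κ, hκ, e, he, H⟩ := this
      refine ⟨ball z (r / 2), mem_nhdsWithin_of_mem_nhds (ball_mem_nhds z (by positivity)),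
        r / 2, by positivity, κ, hκ, fun x hx => ⟨e, he,
          fun x' hx' hd τ hτ v hv => H x' hx' ?_ τ hτ v hv⟩⟩
      have := dist_triangle x' x z
      rw [mem_ball] at hx
      linarith
  obtain ⟨r, hr, κ, hκ, H⟩ := key
  exact ⟨r, hr, κ, hκ, fun x hx => H x (subset_closure hx)⟩

/-- The axis points away from the nearer end of the interval. -/
lemma uniformCone_Ioo {l : ℝ} (hl : 0 < l) : ∃ r > 0, ∃ κ > 0, UniformCone (Ioo 0 l) r κ := by
  set m := min l 1 with hm
  have hm0 : 0 < m := lt_min hl one_pos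
  have hml : m ≤ l := min_le_left _ _
  have hm1 : m ≤ 1 := min_le_right _ _
  refine ⟨m / 16, by positivity, m / 8, by positivity, fun x hx => ?_⟩
  by_cases hxl : x ≤ l / 2
  · refine ⟨m / 4, by rw [Real.norm_of_nonneg (by positivity)]; linarith, ?_⟩
    intro x' hx' hd τ hτ v hv
    rw [Real.dist_eq, abs_lt] at hd
    rw [mem_closedBall, Real.dist_eq, abs_le] at hv
    have h0 : 0 ≤ v := by linarith
    have h1 : 0 ≤ τ * v := mul_nonneg hτ.1 h0
    have h2 : τ * v ≤ v := mul_le_of_le_one_left h0 hτ.2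
    rw [smul_eq_mul]
    exact ⟨by linarith [hx'.1], by linarith⟩
  · refine ⟨-(m / 4), by rw [norm_neg, Real.norm_of_nonneg (by positivity)]; linarith, ?_⟩
    intro x' hx' hd τ hτ v hv
    rw [Real.dist_eq, abs_lt] at hd
    rw [mem_closedBall, Real.dist_eq, abs_le] at hv
    have h0 : v ≤ 0 := by linarith
    have h1 : τ * v ≤ 0 := mul_nonpos_of_nonneg_of_nonpos hτ.1 h0
    have h2 : v ≤ τ * v := by nlinarith [hτ.2]
    rw [smul_eq_mul]
    exact ⟨by linarith, by linarith [hx'.2]⟩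

lemma UniformCone.prod {E F : Type*} [NormedAddCommGroup E] [NormedSpace ℝ E]
    [NormedAddCommGroup F] [NormedSpace ℝ F] {A : Set E} {B : Set F} {r κ : ℝ}
    (hA : UniformCone A r κ) (hB : UniformCone B r κ) : UniformCone (A ×ˢ B) r κ := by
  rintro ⟨a, b⟩ ⟨ha, hb⟩
  obtain ⟨e, he, HA⟩ := hA a ha
  obtain ⟨f, hf, HB⟩ := hB b hb
  refine ⟨(e, f), max_le he hf, ?_⟩
  rintro ⟨a', b'⟩ ⟨ha', hb'⟩ hd τ hτ ⟨v, w⟩ hv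
  rw [Prod.dist_eq, max_lt_iff] at hd
  rw [mem_closedBall, Prod.dist_eq, max_le_iff] at hv
  exact ⟨HA a' ha' hd.1 τ hτ v hv.1, HB b' hb' hd.2 τ hτ w hv.2⟩

lemma exists_uniformCone_channel {Ω₀ : Set Plane} (h : IsSmoothBounded Ω₀) {l : ℝ} (hl : 0 < l) :
    ∃ r > 0, ∃ κ > 0, κ ≤ 1 ∧ UniformCone (channel Ω₀ l) r κ := by
  obtain ⟨r, hr, κ, hκ, H⟩ := h.uniformCone
  obtain ⟨r', hr', κ', hκ', H'⟩ := uniformCone_Ioo hl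
  refine ⟨min r' r, lt_min hr' hr, min (min κ' κ) 1, lt_min (lt_min hκ' hκ) one_pos,
    min_le_right _ _, ?_⟩
  exact (H'.mono (min_le_left _ _) ((min_le_left _ _).trans (min_le_left _ _))).prod
    (H.mono (min_le_right _ _) ((min_le_left _ _).trans (min_le_right _ _)))

lemma isOpen_channel {Ω₀ : Set Plane} (h : IsSmoothBounded Ω₀) (l : ℝ) : IsOpen (channel Ω₀ l) :=
  isOpen_Ioo.prod h.isOpen

lemma isBounded_channel {Ω₀ : Set Plane} (h : IsSmoothBounded Ω₀) (l : ℝ) :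
    Bornology.IsBounded (channel Ω₀ l) :=
  (isBounded_Ioo 0 l).prod h.bounded

/-! ### Directional derivatives in coordinates; truncated cones -/

lemma eq_sum_dir (v : Space) : v = v.1 • dir 0 + v.2 0 • dir 1 + v.2 1 • dir 2 := by
  ext i
  · simp [dir]
  · fin_cases i <;> simp [dir]

lemma fderiv_apply_eq (f : Space → ℝ) (x v : Space) :
    fderiv ℝ f x v = v.1 * partialD 0 f x + v.2 0 * partialD 1 f x + v.2 1 * partialD 2 f x := by
  conv_lhs => rw [eq_sum_dir v]
  simp [partialD]

lemma abs_coord_le (v : Plane) (i : Fin 2) : |v i| ≤ ‖v‖ := PiLp.norm_apply_le v i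

lemma abs_fderiv_apply_le (f : Space → ℝ) (x v : Space) :
    |fderiv ℝ f x v| ≤ ‖v‖ * ∑ i, |partialD i f x| := by
  have h0 : |v.1| ≤ ‖v‖ := norm_fst_le v
  have h1 : |v.2 0| ≤ ‖v‖ := (abs_coord_le v.2 0).trans (norm_snd_le v)
  have h2 : |v.2 1| ≤ ‖v‖ := (abs_coord_le v.2 1).trans (norm_snd_le v)
  rw [fderiv_apply_eq, Fin.sum_univ_three, mul_add, mul_add]
  refine (abs_add_three _ _ _).trans ?_
  rw [abs_mul, abs_mul, abs_mul]
  gcongr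

lemma norm_fderiv_le_of_partialD {f : Space → ℝ} {x : Space} {M : ℝ}
    (h : ∀ i, |partialD i f x| ≤ M) : ‖fderiv ℝ f x‖ ≤ 3 * M := by
  have hM : 0 ≤ M := (abs_nonneg _).trans (h 0)
  refine ContinuousLinearMap.opNorm_le_bound _ (by positivity) fun v => ?_
  rw [Real.norm_eq_abs, mul_comm]
  refine (abs_fderiv_apply_le f x v).trans ?_
  gcongr
  calc ∑ i, |partialD i f x| ≤ ∑ _i : Fin 3, M := Finset.sum_le_sum fun i _ => h i
    _ = 3 * M := by simp

/-- The truncated cone with vertex `x` over the ball `closedBall e κ`. -/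
def coneSet (x e : Space) (κ : ℝ) : Set Space :=
  (fun q : ℝ × Space => x + q.1 • q.2) '' (Icc (0 : ℝ) 1 ×ˢ closedBall e κ)

lemma mem_coneSet {x e v : Space} {κ τ : ℝ} (hτ : τ ∈ Icc (0 : ℝ) 1) (hv : v ∈ closedBall e κ) :
    x + τ • v ∈ coneSet x e κ := ⟨(τ, v), ⟨hτ, hv⟩, rfl⟩

lemma isCompact_coneSet (x e : Space) (κ : ℝ) : IsCompact (coneSet x e κ) :=
  (isCompact_Icc.prod (isCompact_closedBall e κ)).image (by fun_prop)

/-- For large n this allows `partialD_mollify_of_hasWeakPartial` to be used at all points of a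
compact cone at once. -/
lemma eventually_closedBall_subset {K Ω : Set Space} (hK : IsCompact K) (hΩ : IsOpen Ω)
    (h : K ⊆ Ω) : ∀ᶠ n : ℕ in atTop, ∀ y ∈ K, closedBall y (1 / ((n : ℝ) + 1)) ⊆ Ω := by
  obtain ⟨δ, hδ, hs⟩ := hK.exists_cthickening_subset_open hΩ h
  filter_upwards [(tendsto_one_div_add_atTop_nhds_zero_nat (𝕜 := ℝ)).eventually_lt_const hδ]
    with n hn y hy
  exact (closedBall_subset_closedBall hn.le).trans
    ((closedBall_subset_cthickening hy δ).trans hs)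

/-! ### Morrey's inequality on cones -/

lemma finrank_space : Module.finrank ℝ Space = 3 := by
  simp [Space, Module.finrank_prod]

lemma lintegral_comp_add_smul {h : Space → ℝ≥0∞} (hh : Measurable h) (x : Space) {τ : ℝ}
    (hτ : 0 < τ) : ∫⁻ v, h (x + τ • v) = ENNReal.ofReal ((τ ^ 3)⁻¹) * ∫⁻ v, h v := by
  have h1 := Measure.map_addHaar_smul (volume : Measure Space) hτ.ne'
  rw [finrank_space, abs_of_pos (by positivity)] at h1
  calc ∫⁻ v, h (x + τ • v) = ∫⁻ v, h (x + v) ∂(Measure.map (τ • ·) volume) :=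
        (lintegral_map (hh.comp (measurable_const_add x)) (measurable_const_smul τ)).symm
    _ = ENNReal.ofReal ((τ ^ 3)⁻¹) * ∫⁻ v, h (x + v) := by rw [h1, lintegral_smul_measure]; rfl
    _ = _ := by rw [lintegral_add_left_eq_self]

/-- Hölder's inequality on `D`, then the dilation v ↦ x + τv of Jacobian τ³. The price is the factor
τ^(-3/p), which is integrable at 0 exactly when p > 3. -/
lemma setLIntegral_comp_add_smul_le {h : Space → ℝ≥0∞} (hh : Measurable h) (D : Set Space)
    {p : ℝ} (hp : 1 < p) (x : Space) {τ : ℝ} (hτ : 0 < τ) :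
    ∫⁻ v in D, h (x + τ • v) ≤ ENNReal.ofReal (τ ^ (-3 / p)) *
      (volume D ^ (1 - 1 / p) * (∫⁻ v, h v ^ p) ^ (1 / p)) := by
  have hpq := Real.HolderConjugate.conjExponent hp
  have hm : Measurable fun v => h (x + τ • v) := hh.comp (by fun_prop)
  have h1 := ENNReal.lintegral_mul_le_Lp_mul_Lq (volume.restrict D) hpq
    (f := fun v => h (x + τ • v)) (g := fun _ => 1) hm.aemeasurable aemeasurable_const
  simp only [Pi.mul_apply, mul_one, ENNReal.one_rpow, lintegral_const, Measure.restrict_apply_univ,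
    one_mul] at h1
  have h2 : ∫⁻ v in D, h (x + τ • v) ^ p ≤ ENNReal.ofReal ((τ ^ 3)⁻¹) * ∫⁻ v, h v ^ p := by
    rw [← lintegral_comp_add_smul (hh.pow_const p) x hτ]
    exact setLIntegral_le_lintegral D _
  have hq : 1 / p.conjExponent = 1 - 1 / p := by
    have := hpq.inv_add_inv_eq_one
    rw [one_div, one_div]; linarith
  rw [hq] at h1
  have h3 : ENNReal.ofReal ((τ ^ 3)⁻¹) ^ (1 / p) = ENNReal.ofReal (τ ^ (-3 / p)) := by
    rw [ENNReal.ofReal_rpow_of_pos (by positivity)]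
    congr 1
    rw [← Real.rpow_natCast, ← Real.rpow_neg hτ.le, ← Real.rpow_mul hτ.le]
    congr 1; push_cast; ring
  refine h1.trans ?_
  calc _ ≤ (ENNReal.ofReal ((τ ^ 3)⁻¹) * ∫⁻ v, h v ^ p) ^ (1 / p) * volume D ^ (1 - 1 / p) := by
        gcongr
    _ = _ := by
        rw [ENNReal.mul_rpow_of_nonneg _ _ (by positivity), h3]; ring

/-- The mollification kernel with values in `[0, ∞]`. -/
def ekernel (n : ℕ) (z : Space) : ℝ≥0∞ := ENNReal.ofReal (kernel n z)

lemma measurable_ekernel (n : ℕ) : Measurable (ekernel n) :=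
  (continuous_kernel n).measurable.ennreal_ofReal

lemma lintegral_ekernel (n : ℕ) : ∫⁻ z, ekernel n z = 1 := by
  simp only [ekernel]
  rw [← ofReal_integral_eq_lintegral_ofReal (integrable_kernel n)
    (Eventually.of_forall (kernel_nonneg n)), integral_kernel, ENNReal.ofReal_one]

lemma enorm_mollify_le (n : ℕ) {u : Space → ℝ} {h : Space → ℝ≥0∞} (hu : (‖u ·‖ₑ) =ᵐ[volume] h)
    (y : Space) : ‖mollify n u y‖ₑ ≤ ∫⁻ z, ekernel n z * h (y - z) := by
  refine (enorm_integral_le_lintegral_enorm _).trans_eq ?_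
  apply lintegral_congr_ae
  have := (Measure.measurePreserving_sub_left (volume : Measure Space)
    y).quasiMeasurePreserving.ae_eq_comp hu
  filter_upwards [this] with z hz
  simp only [Function.comp] at hz
  rw [enorm_mul, hz, Real.enorm_eq_ofReal (kernel_nonneg n z), ekernel]

/-- The bound does not depend on n: by Tonelli the left side is an average, with the kernel of mass
one as weight, of the integrals with vertex x - z. -/
lemma setLIntegral_mollify_le {h : Space → ℝ≥0∞} (hh : Measurable h) (D : Set Space)
    {p : ℝ} (hp : 1 < p) (n : ℕ) (x : Space) {τ : ℝ} (hτ : 0 < τ) :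
    ∫⁻ v in D, ∫⁻ z, ekernel n z * h (x + τ • v - z) ≤ ENNReal.ofReal (τ ^ (-3 / p)) *
      (volume D ^ (1 - 1 / p) * (∫⁻ v, h v ^ p) ^ (1 / p)) := by
  rw [lintegral_lintegral_swap]
  · calc ∫⁻ z, ∫⁻ v in D, ekernel n z * h (x + τ • v - z)
        ≤ ∫⁻ z, ekernel n z * (ENNReal.ofReal (τ ^ (-3 / p)) *
            (volume D ^ (1 - 1 / p) * (∫⁻ v, h v ^ p) ^ (1 / p))) := by
          refine lintegral_mono fun z => ?_
          have hz : Measurable fun v => h (x + τ • v - z) := hh.comp (by fun_prop)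
          rw [lintegral_const_mul _ hz]
          gcongr
          simp_rw [add_sub_right_comm]
          exact setLIntegral_comp_add_smul_le hh D hp (x - z) hτ
      _ = _ := by
          rw [lintegral_mul_const _ (measurable_ekernel n), lintegral_ekernel, one_mul]
  · apply Measurable.aemeasurable
    exact ((measurable_ekernel n).comp measurable_snd).mul (hh.comp (by fun_prop))

lemma enorm_le_add_lintegral {f : Space → ℝ} (hf : ContDiff ℝ 1 f) (x v : Space) (hv : ‖v‖ ≤ 2) :
    ‖f x‖ₑ ≤ ‖f (x + v)‖ₑ + 2 * ∫⁻ τ in Ioc (0 : ℝ) 1, ∑ i, ‖partialD i f (x + τ • v)‖ₑ := by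
  have hd : ∀ τ : ℝ, HasDerivAt (fun τ : ℝ => f (x + τ • v)) (fderiv ℝ f (x + τ • v) v) τ := by
    intro τ
    have h1 : HasDerivAt (fun τ : ℝ => x + τ • v) v τ := by
      simpa using ((hasDerivAt_id τ).smul_const v).const_add x
    exact ((hf.differentiable (by simp)) _).hasFDerivAt.comp_hasDerivAt τ h1
  have hc : Continuous fun τ : ℝ => fderiv ℝ f (x + τ • v) v := by
    have := hf.continuous_fderiv (by simp)
    fun_prop
  have h1 := intervalIntegral.integral_eq_sub_of_hasDerivAt (a := 0) (b := 1)
    (fun τ _ => hd τ) (hc.intervalIntegrable _ _)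
  simp only [one_smul, zero_smul, add_zero] at h1
  have h2 : f x = f (x + v) - ∫ τ in (0 : ℝ)..1, fderiv ℝ f (x + τ • v) v := by rw [h1]; ring
  have h3 : ‖∫ τ in (0 : ℝ)..1, fderiv ℝ f (x + τ • v) v‖ₑ ≤
      2 * ∫⁻ τ in Ioc (0 : ℝ) 1, ∑ i, ‖partialD i f (x + τ • v)‖ₑ := by
    rw [intervalIntegral.integral_of_le zero_le_one,
      ← lintegral_const_mul' _ _ (by simp)]
    refine (enorm_integral_le_lintegral_enorm _).trans (lintegral_mono fun τ => ?_)
    have h4 := abs_fderiv_apply_le f (x + τ • v) v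
    rw [Real.enorm_eq_ofReal_abs]
    calc ENNReal.ofReal |fderiv ℝ f (x + τ • v) v|
        ≤ ENNReal.ofReal (2 * ∑ i, |partialD i f (x + τ • v)|) := by
          apply ENNReal.ofReal_le_ofReal (h4.trans ?_); gcongr
      _ = _ := by
          rw [ENNReal.ofReal_mul (by norm_num),
            ENNReal.ofReal_sum_of_nonneg (fun i _ => abs_nonneg _)]
          simp [Real.enorm_eq_ofReal_abs]
  calc ‖f x‖ₑ = ‖f (x + v) - ∫ τ in (0 : ℝ)..1, fderiv ℝ f (x + τ • v) v‖ₑ := by rw [← h2]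
    _ ≤ _ := enorm_sub_le.trans (by gcongr)

/-- The fundamental theorem of calculus along the rays x + τv, integrated over the ball of
directions v. The factor 2 is the bound ‖v‖ ≤ ‖e‖ + κ ≤ 2. -/
lemma enorm_mul_volume_le {f : Space → ℝ} (hf : ContDiff ℝ 1 f) (x e : Space) {κ : ℝ}
    (he : ‖e‖ ≤ 1) (hκ : κ ≤ 1) :
    ‖f x‖ₑ * volume (closedBall e κ) ≤ (∫⁻ v in closedBall e κ, ‖f (x + (1 : ℝ) • v)‖ₑ) +
      2 * ∫⁻ τ in Ioc (0 : ℝ) 1, ∑ i, ∫⁻ v in closedBall e κ, ‖partialD i f (x + τ • v)‖ₑ := by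
  have hm : ∀ i, Continuous (partialD i f) := fun i =>
    (hf.continuous_fderiv (by simp)).clm_apply continuous_const
  calc ‖f x‖ₑ * volume (closedBall e κ) = ∫⁻ _ in closedBall e κ, ‖f x‖ₑ := by
        rw [setLIntegral_const]
    _ ≤ ∫⁻ v in closedBall e κ, (‖f (x + (1 : ℝ) • v)‖ₑ +
          2 * ∫⁻ τ in Ioc (0 : ℝ) 1, ∑ i, ‖partialD i f (x + τ • v)‖ₑ) := by
        refine setLIntegral_mono' isClosed_closedBall.measurableSet fun v hv => ?_
        rw [one_smul]
        apply enorm_le_add_lintegral hf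
        rw [mem_closedBall, dist_eq_norm] at hv
        have := norm_le_norm_add_norm_sub' v e
        linarith
    _ = _ := by
        have hfm : Measurable fun v => ‖f (x + (1 : ℝ) • v)‖ₑ :=
          (hf.continuous.measurable.comp (by fun_prop)).enorm
        rw [lintegral_add_left hfm,
          lintegral_const_mul' _ _ (by simp), lintegral_lintegral_swap]
        · congr 2
          refine lintegral_congr fun τ => ?_
          rw [lintegral_finsetSum]
          intro i _
          exact ((hm i).measurable.comp (by fun_prop)).enorm
        · apply Measurable.aemeasurable
          refine Finset.measurable_sum _ fun i _ => ?_
          exact ((hm i).measurable.comp (by fun_prop)).enorm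

lemma lintegral_rpow_lt_top {p : ℝ} (hp : 3 < p) :
    ∫⁻ τ in Ioc (0 : ℝ) 1, ENNReal.ofReal (τ ^ (-3 / p)) < ⊤ := by
  have hi : IntervalIntegrable (fun τ : ℝ => τ ^ (-3 / p)) volume 0 1 := by
    apply intervalIntegral.intervalIntegrable_rpow'
    rw [lt_div_iff₀ (by linarith)]; linarith
  exact ((intervalIntegrable_iff_integrableOn_Ioc_of_le zero_le_one).1 hi).lintegral_lt_top

lemma lintegral_rpow_enorm_indicator {Ω : Set Space} (hΩ : MeasurableSet Ω) {p : ℝ} (hp : 0 < p)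
    (f : Space → ℝ) : (∫⁻ v, ‖Ω.indicator f v‖ₑ ^ p) ^ (1 / p) =
      eLpNorm f (ENNReal.ofReal p) (volume.restrict Ω) := by
  rw [← eLpNorm_indicator_eq_eLpNorm_restrict hΩ, eLpNorm_eq_lintegral_rpow_enorm_toReal
    (by simpa using hp) (by simp), ENNReal.toReal_ofReal hp.le]

lemma integrableOn_of_memLp {Ω : Set Space} (hΩ : Bornology.IsBounded Ω) {p : ℝ} (hp : 1 ≤ p)
    {f : Space → ℝ} (hf : MemLp f (ENNReal.ofReal p) (volume.restrict Ω)) : IntegrableOn f Ω := by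
  have : IsFiniteMeasure (volume.restrict Ω) := ⟨by simpa using hΩ.measure_lt_top⟩
  exact hf.integrable (by simpa using hp)

/-- Morrey's inequality: a function whose weak gradient is `p`-integrable, `p > 3`, on a bounded
open set with the uniform cone property is essentially bounded. -/
theorem exists_ae_enorm_le {Ω : Set Space} (hΩ : IsOpen Ω) (hb : Bornology.IsBounded Ω)
    {r κ : ℝ} (hr : 0 < r) (hκ : 0 < κ) (hκ1 : κ ≤ 1) (hU : UniformCone Ω r κ)
    {p : ℝ} (hp : 3 < p) :
    ∃ K : ℝ≥0, ∀ (f : Space → ℝ) (g : Fin 3 → Space → ℝ),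
      MemLp f (ENNReal.ofReal p) (volume.restrict Ω) →
      (∀ i, MemLp (g i) (ENNReal.ofReal p) (volume.restrict Ω)) →
      (∀ i, HasWeakPartial Ω i f (g i)) →
      ∀ᵐ x ∂(volume.restrict Ω), ‖f x‖ₑ ≤ K * (eLpNorm f (ENNReal.ofReal p) (volume.restrict Ω) +
        ∑ i, eLpNorm (g i) (ENNReal.ofReal p) (volume.restrict Ω)) := by
  set m := volume (closedBall (0 : Space) κ) with hm
  have hm0 : m ≠ 0 := (measure_closedBall_pos _ _ hκ).ne'
  have hmt : m ≠ ⊤ := measure_closedBall_lt_top.ne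
  set I := ∫⁻ τ in Ioc (0 : ℝ) 1, ENNReal.ofReal (τ ^ (-3 / p)) with hI
  have hIt : I ≠ ⊤ := (lintegral_rpow_lt_top hp).ne
  have hp1 : 1 < p := by linarith
  -- The inverse m⁻¹ averages over the ball of directions and m ^ (1 - 1/p) comes from Hölder; the
  -- summand 1 accounts for the values of f at τ = 1, the summand 2I for its gradient.
  set c := m⁻¹ * m ^ (1 - 1 / p) * (1 + 2 * I) with hc
  have hct : c ≠ ⊤ := by
    refine ENNReal.mul_ne_top (ENNReal.mul_ne_top (by simpa using hm0) ?_) ?_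
    · exact ENNReal.rpow_ne_top_of_nonneg (by rw [sub_nonneg, div_le_one] <;> linarith) hmt
    · exact ENNReal.add_ne_top.2 ⟨by simp, ENNReal.mul_ne_top (by simp) hIt⟩
  refine ⟨c.toNNReal, fun f g hf hg hw => ?_⟩
  rw [ENNReal.coe_toNNReal hct]
  have hΩm := hΩ.measurableSet
  have hfi := integrableOn_of_memLp hb hp1.le hf
  have hfl : LocallyIntegrable (Ω.indicator f) :=
    ((integrable_indicator_iff hΩm).2 hfi).locallyIntegrable
  have hfm := (aestronglyMeasurable_indicator_iff hΩm).2 hf.1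
  have hgm := fun i => (aestronglyMeasurable_indicator_iff hΩm).2 (hg i).1
  -- measurable representatives of the moduli
  have hrep : ∀ u : Space → ℝ, AEStronglyMeasurable (Ω.indicator u) →
      ∃ h : Space → ℝ≥0∞, Measurable h ∧ (‖Ω.indicator u ·‖ₑ) =ᵐ[volume] h ∧
        (∫⁻ v, h v ^ p) ^ (1 / p) = eLpNorm u (ENNReal.ofReal p) (volume.restrict Ω) := by
    intro u hu
    refine ⟨hu.enorm.mk _, hu.enorm.measurable_mk, hu.enorm.ae_eq_mk, ?_⟩
    rw [← lintegral_rpow_enorm_indicator hΩm (by linarith)]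
    congr 1
    refine lintegral_congr_ae ?_
    filter_upwards [hu.enorm.ae_eq_mk] with v hv
    rw [← hv]
  obtain ⟨h₀, h₀m, h₀e, h₀n⟩ := hrep f hfm
  choose h hhm hhe hhn using fun i => hrep (g i) (hgm i)
  rw [ae_restrict_iff' hΩm]
  filter_upwards [ae_tendsto_mollify hfl] with x hx hxΩ
  rw [indicator_of_mem hxΩ] at hx
  -- It suffices to bound the mollifications at x for large n. How large may depend on x, since the
  -- bound does not depend on n.
  refine le_of_tendsto hx.enorm ?_
  obtain ⟨e, he, He⟩ := hU x hxΩ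
  have hcone : coneSet x e κ ⊆ Ω := by
    rintro _ ⟨⟨τ, v⟩, ⟨hτ, hv⟩, rfl⟩
    exact He x hxΩ (by simpa using hr) τ hτ v hv
  filter_upwards [eventually_closedBall_subset (isCompact_coneSet x e κ) hΩ hcone] with n hn
  have hme : volume (closedBall e κ) = m := Measure.addHaar_closedBall_center _ _ _
  have key := enorm_mul_volume_le
    ((contDiff_mollify n hfl).of_le (by exact_mod_cast le_top)) x e he hκ1
  rw [hme] at key
  have b0 : ∫⁻ v in closedBall e κ, ‖mollify n (Ω.indicator f) (x + (1 : ℝ) • v)‖ₑ ≤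
      m ^ (1 - 1 / p) * eLpNorm f (ENNReal.ofReal p) (volume.restrict Ω) := by
    calc _ ≤ ∫⁻ v in closedBall e κ, ∫⁻ z, ekernel n z * h₀ (x + (1 : ℝ) • v - z) :=
          lintegral_mono fun v => enorm_mollify_le n h₀e _
      _ ≤ _ := setLIntegral_mollify_le h₀m _ hp1 n x one_pos
      _ = _ := by rw [hme, h₀n]; simp
  have b1 : ∫⁻ τ in Ioc (0 : ℝ) 1, ∑ i, ∫⁻ v in closedBall e κ,
      ‖partialD i (mollify n (Ω.indicator f)) (x + τ • v)‖ₑ ≤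
      I * (m ^ (1 - 1 / p) * ∑ i, eLpNorm (g i) (ENNReal.ofReal p) (volume.restrict Ω)) := by
    rw [hI, ← lintegral_mul_const _ (by fun_prop)]
    refine setLIntegral_mono' measurableSet_Ioc fun τ hτ => ?_
    rw [Finset.mul_sum, Finset.mul_sum]
    refine Finset.sum_le_sum fun i _ => ?_
    calc _ ≤ ∫⁻ v in closedBall e κ, ∫⁻ z, ekernel n z * h i (x + τ • v - z) := by
          refine setLIntegral_mono' isClosed_closedBall.measurableSet fun v hv => ?_
          rw [partialD_mollify_of_hasWeakPartial n hΩ (hw i) hfi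
            (hn _ (mem_coneSet (Ioc_subset_Icc_self hτ) hv))]
          exact enorm_mollify_le n (hhe i) _
      _ ≤ _ := setLIntegral_mollify_le (hhm i) _ hp1 n x hτ.1
      _ = _ := by rw [hme, hhn]
  have key2 := key.trans (add_le_add b0 (mul_le_mul_right b1 2))
  calc ‖mollify n (Ω.indicator f) x‖ₑ = m⁻¹ * (‖mollify n (Ω.indicator f) x‖ₑ * m) := by
        rw [mul_comm _ m, ← mul_assoc, ENNReal.inv_mul_cancel hm0 hmt, one_mul]
    _ ≤ m⁻¹ * _ := mul_le_mul_right key2 _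
    _ ≤ m⁻¹ * (m ^ (1 - 1 / p) * ((1 + 2 * I) *
          (eLpNorm f (ENNReal.ofReal p) (volume.restrict Ω) +
            ∑ i, eLpNorm (g i) (ENNReal.ofReal p) (volume.restrict Ω)))) := by
        gcongr
        set A := eLpNorm f (ENNReal.ofReal p) (volume.restrict Ω)
        set B := ∑ i, eLpNorm (g i) (ENNReal.ofReal p) (volume.restrict Ω)
        calc _ = m ^ (1 - 1 / p) * (A + 2 * I * B) := by ring
          _ ≤ m ^ (1 - 1 / p) * ((1 + 2 * I) * A + (1 + 2 * I) * B) := by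
            gcongr
            · exact le_mul_of_one_le_left zero_le le_self_add
            · exact le_add_self
          _ = _ := by ring
    _ = _ := by rw [hc]; ring

/-! ### Lipschitz representatives -/

/-- A function with bounded weak gradient on a set with the uniform cone property has a Lipschitz
representative, defined on the whole space. -/
theorem exists_lipschitz_representative {Ω : Set Space} (hΩ : IsOpen Ω)
    {r κ : ℝ} (hr : 0 < r) (hκ : 0 < κ) (hU : UniformCone Ω r κ) :
    ∃ K : ℝ≥0, ∀ (f : Space → ℝ) (g : Fin 3 → Space → ℝ) (M : ℝ≥0), IntegrableOn f Ω →
      (∀ i, HasWeakPartial Ω i f (g i)) →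
      (∀ᵐ x ∂(volume.restrict Ω), |f x| ≤ M) →
      (∀ i, ∀ᵐ x ∂(volume.restrict Ω), |g i x| ≤ M) →
      ∃ F : Space → ℝ, LipschitzWith (K * M) F ∧ (∀ x, |F x| ≤ M) ∧
        F =ᵐ[volume.restrict Ω] f := by
  set s := min r κ with hs
  have hs0 : 0 < s := lt_min hr hκ
  -- Points at distance d < s are joined by a path of length at most (2/κ + 1) d on which the
  -- gradient is at most 3M. Points farther apart only need |f| ≤ M, as 2M ≤ (2M/s) d.
  refine ⟨Real.toNNReal (3 * (2 / κ + 1) + 2 / s), fun f g M hfi hw hfM hgM => ?_⟩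
  set C := 3 * (2 / κ + 1) + 2 / s with hC
  have hC0 : 0 ≤ C := by positivity
  have hΩm := hΩ.measurableSet
  have hfl : LocallyIntegrable (Ω.indicator f) :=
    ((integrable_indicator_iff hΩm).2 hfi).locallyIntegrable
  set A : Set Space := {x | x ∈ Ω ∧ |f x| ≤ M ∧
    Tendsto (fun n => mollify n (Ω.indicator f) x) atTop (𝓝 (f x))} with hA
  have hgM' : ∀ i, ∀ᵐ x, |Ω.indicator (g i) x| ≤ M := by
    intro i
    filter_upwards [(ae_restrict_iff' hΩm).1 (hgM i)] with x hx
    by_cases h : x ∈ Ω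
    · rw [indicator_of_mem h]; exact hx h
    · rw [indicator_of_notMem h]; simp
  have hball : ∀ i n x, |mollify n (Ω.indicator (g i)) x| ≤ M := by
    intro i n x
    apply abs_mollify_le
    filter_upwards [(Measure.measurePreserving_sub_left (volume : Measure Space)
      x).quasiMeasurePreserving.ae (hgM' i)] with z hz _
    exact hz
  have hLip : LipschitzOnWith (Real.toNNReal C * M) f A := by
    refine LipschitzOnWith.of_dist_le_mul fun x hx x' hx' => ?_
    rw [NNReal.coe_mul, Real.coe_toNNReal _ hC0]
    set d := dist x x' with hd
    have hd0 : 0 ≤ d := dist_nonneg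
    rcases hd0.eq_or_lt with h0 | h0
    · have : x = x' := dist_eq_zero.1 h0.symm
      rw [this, dist_self]; positivity
    by_cases hds : d < s
    · -- connect through the cones
      have hdr : d < r := hds.trans_le (min_le_left _ _)
      have hdκ : d < κ := hds.trans_le (min_le_right _ _)
      obtain ⟨e, he, He⟩ := hU x hx.1
      have hc1 : coneSet x e κ ⊆ Ω := by
        rintro _ ⟨⟨τ, v⟩, ⟨hτ, hv⟩, rfl⟩
        exact He x hx.1 (by simpa using hr) τ hτ v hv
      have hc2 : coneSet x' e κ ⊆ Ω := by
        rintro _ ⟨⟨τ, v⟩, ⟨hτ, hv⟩, rfl⟩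
        exact He x' hx'.1 (by rwa [dist_comm]) τ hτ v hv
      -- The path climbs from x to x + τe, crosses to x' + τe and descends to x'. The crossing
      -- consists of the points x + τ(e + (θ/τ)(x' - x)); as (θ/τ) d = θκ ≤ κ, it stays in the cone
      -- at x.
      set τ := d / κ with hτ
      have hτ0 : 0 < τ := by positivity
      have hτ1 : τ ≤ 1 := (div_le_one hκ).2 hdκ.le
      have hee : e ∈ closedBall e κ := mem_closedBall_self hκ.le
      have hvert : ∀ y : Space, segment ℝ y (y + τ • e) ⊆ coneSet y e κ := by
        intro y
        rw [segment_eq_image']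
        rintro _ ⟨θ, hθ, rfl⟩
        have : y + θ • (y + τ • e - y) = y + (θ * τ) • e := by rw [add_sub_cancel_left, smul_smul]
        dsimp only
        rw [this]
        exact mem_coneSet ⟨mul_nonneg hθ.1 hτ0.le, mul_le_one₀ hθ.2 hτ0.le hτ1⟩ hee
      have hhor : segment ℝ (x + τ • e) (x' + τ • e) ⊆ coneSet x e κ := by
        rw [segment_eq_image']
        rintro _ ⟨θ, hθ, rfl⟩
        have : x + τ • e + θ • (x' + τ • e - (x + τ • e)) =
            x + τ • (e + (θ / τ) • (x' - x)) := by
          rw [smul_add, smul_smul, mul_div_cancel₀ _ hτ0.ne', add_sub_add_right_eq_sub, add_assoc]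
        dsimp only
        rw [this]
        refine mem_coneSet ⟨hτ0.le, hτ1⟩ ?_
        rw [mem_closedBall, dist_eq_norm, add_sub_cancel_left, norm_smul, ← dist_eq_norm, dist_comm,
          ← hd, Real.norm_of_nonneg (div_nonneg hθ.1 hτ0.le)]
        have : θ / τ * d = θ * κ := by rw [hτ]; field_simp
        rw [this]
        exact mul_le_of_le_one_left hκ.le hθ.2
      refine le_of_tendsto (hx.2.2.dist hx'.2.2) ?_
      filter_upwards [eventually_closedBall_subset (isCompact_coneSet x e κ) hΩ hc1,
        eventually_closedBall_subset (isCompact_coneSet x' e κ) hΩ hc2] with n hn hn'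
      set F := mollify n (Ω.indicator f) with hF
      have hFd : Differentiable ℝ F := (contDiff_mollify n hfl).differentiable (by simp)
      have hseg : ∀ a b : Space, (segment ℝ a b ⊆ coneSet x e κ ∨ segment ℝ a b ⊆ coneSet x' e κ) →
          |F a - F b| ≤ 3 * M * dist a b := by
        intro a b hab
        have hbd : ∀ y ∈ segment ℝ a b, ‖fderiv ℝ F y‖ ≤ 3 * M := by
          intro y hy
          refine norm_fderiv_le_of_partialD fun i => ?_
          have : closedBall y (1 / ((n : ℝ) + 1)) ⊆ Ω := by
            rcases hab with hab | hab
            · exact hn y (hab hy)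
            · exact hn' y (hab hy)
          rw [hF, partialD_mollify_of_hasWeakPartial n hΩ (hw i) hfi this]
          exact hball i n y
        have := (convex_segment a b).norm_image_sub_le_of_norm_fderiv_le (𝕜 := ℝ)
          (fun y _ => hFd y) hbd (right_mem_segment ℝ a b) (left_mem_segment ℝ a b)
        rwa [Real.norm_eq_abs, ← dist_eq_norm] at this
      have s1 := hseg _ _ (Or.inl (hvert x))
      have s2 := hseg _ _ (Or.inl hhor)
      have s3 := hseg _ _ (Or.inr (hvert x'))
      have hde : ∀ y : Space, dist y (y + τ • e) ≤ τ := by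
        intro y
        rw [dist_self_add_right, norm_smul, Real.norm_of_nonneg hτ0.le]
        exact mul_le_of_le_one_right hτ0.le he
      rw [dist_add_right, ← hd] at s2
      have hM0 : (0 : ℝ) ≤ 3 * M := by positivity
      have t1 := s1.trans (mul_le_mul_of_nonneg_left (hde x) hM0)
      have t3 := s3.trans (mul_le_mul_of_nonneg_left (hde x') hM0)
      have htri : dist (F x) (F x') ≤ 3 * M * τ + 3 * M * d + 3 * M * τ := by
        rw [Real.dist_eq]
        rw [abs_le] at t1 s2 t3 ⊢
        constructor <;> linarith
      refine htri.trans ?_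
      have : C * M * d = 3 * M * τ + 3 * M * d + 3 * M * τ + 2 / s * M * d := by
        rw [hC, hτ]; ring
      rw [this]
      have : 0 ≤ 2 / s * M * d := by positivity
      linarith
    · have h1 : dist (f x) (f x') ≤ 2 * M := by
        rw [Real.dist_eq]
        have a1 := abs_le.1 hx.2.1
        have a2 := abs_le.1 hx'.2.1
        rw [abs_le]; constructor <;> linarith
      have h2 : 2 * (M : ℝ) ≤ 2 / s * M * d := by
        have : 1 ≤ d / s := (one_le_div hs0).2 (not_lt.1 hds)
        calc 2 * (M : ℝ) = 2 * M * 1 := by ring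
          _ ≤ 2 * M * (d / s) := by gcongr
          _ = _ := by ring
      have h3 : C * M * d = 2 / s * M * d + 3 * (2 / κ + 1) * M * d := by rw [hC]; ring
      have h4 : 0 ≤ 3 * (2 / κ + 1) * M * d := by positivity
      linarith
  obtain ⟨G, hG, hGe⟩ := hLip.extend_real
  -- Clamping keeps the Lipschitz constant and enforces |F| ≤ M also off Ω, where the extension is
  -- arbitrary.
  refine ⟨fun x => max (-M) (min (G x) M), ?_, ?_, ?_⟩
  · exact (hG.min_const M).const_max (-M)
  · intro x
    rw [abs_le]
    exact ⟨le_max_left _ _, max_le (by linarith [M.2]) (min_le_right _ _)⟩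
  · have hae : ∀ᵐ x ∂(volume.restrict Ω), x ∈ A := by
      filter_upwards [hfM, ae_restrict_of_ae (ae_tendsto_mollify hfl), ae_restrict_mem hΩm]
        with x h1 h2 h3
      rw [indicator_of_mem h3] at h2
      exact ⟨h3, h1, h2⟩
    filter_upwards [hae] with x hx
    rw [← hGe hx]
    have := abs_le.1 hx.2.1
    rw [min_eq_left this.2, max_eq_right this.1]

lemma lipschitzWith_mul {X : Type*} [PseudoMetricSpace X] {f g : X → ℝ} {K K' A B : ℝ≥0}
    (hf : LipschitzWith K f) (hg : LipschitzWith K' g) (hA : ∀ x, |f x| ≤ A) (hB : ∀ x, |g x| ≤ B) :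
    LipschitzWith (A * K' + B * K) (fun x => f x * g x) := by
  refine LipschitzWith.of_dist_le_mul fun x y => ?_
  have h1 := hf.dist_le_mul x y
  have h2 := hg.dist_le_mul x y
  rw [Real.dist_eq] at h1 h2 ⊢
  have h3 : f x * g x - f y * g y = f x * (g x - g y) + g y * (f x - f y) := by ring
  rw [h3]
  push_cast
  calc _ ≤ |f x| * |g x - g y| + |g y| * |f x - f y| := by
        rw [← abs_mul, ← abs_mul]; exact abs_add_le _ _
    _ ≤ A * (K' * dist x y) + B * (K * dist x y) := by
        gcongr
        · exact hA x
        · exact hB y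
    _ = _ := by ring

/-! ### Geometry of the nearest boundary point -/

/-- Along v the difference quotients of ρ are negative or zero: ρ ≥ 0 at z, and ρ < 0 at z + sv for
small s > 0. -/
lemma gradient_inner_nonpos {Ω₀ V : Set Plane} {z v : Plane} {ρ : Plane → ℝ}
    (h : IsLocalDefining Ω₀ z V ρ) (hz : z ∉ Ω₀)
    (hv : ∀ᶠ s : ℝ in 𝓝[>] 0, z + s • v ∈ Ω₀) : inner ℝ (gradient ρ z) v ≤ 0 := by
  have hd : HasGradientAt ρ (gradient ρ z) z :=
    ((h.smooth.contDiffAt (h.isOpen.mem_nhds h.mem)).differentiableAt (by simp)).hasGradientAt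
  have hl : HasDerivAt (fun s : ℝ => z + s • v) v 0 := by
    simpa using ((hasDerivAt_id (0 : ℝ)).smul_const v).const_add z
  have hd' : HasFDerivAt ρ (InnerProductSpace.toDual ℝ Plane (gradient ρ z)) (z + (0 : ℝ) • v) := by
    simpa using hd.hasFDerivAt
  have h1 : HasDerivAt (fun s : ℝ => ρ (z + s • v)) (inner ℝ (gradient ρ z) v) 0 := by
    simpa using! hd'.comp_hasDerivAt (0 : ℝ) hl
  have h2 := h1.tendsto_slope_zero_right
  refine le_of_tendsto h2 ?_
  have hV : ∀ᶠ s : ℝ in 𝓝[>] 0, z + s • v ∈ V := by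
    apply nhdsWithin_le_nhds
    have hc : ContinuousAt (fun s : ℝ => z + s • v) 0 := hl.continuousAt
    exact hc.preimage_mem_nhds (by simpa using h.isOpen.mem_nhds h.mem)
  filter_upwards [hv, hV, self_mem_nhdsWithin] with s hs hsV hs0
  have h3 := (h.lt_iff _ hsV).1 hs
  have h4 : 0 ≤ ρ z := not_lt.1 fun h' => hz ((h.lt_iff _ h.mem).2 h')
  have h5 : 0 < s := hs0
  simp only [zero_add, zero_smul, add_zero, smul_eq_mul]
  exact mul_nonpos_of_nonneg_of_nonpos (by positivity) (by linarith)

/-- At a nearest point `z` of the complement, the outer normal is the direction from `y` to `z`. -/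
lemma isOuterUnitNormal_of_ball_subset {Ω₀ V : Set Plane} {y z : Plane} {ρ : Plane → ℝ}
    (h : IsLocalDefining Ω₀ z V ρ) (hz : z ∉ Ω₀) (hyz : y ≠ z) (hb : ball y (dist y z) ⊆ Ω₀) :
    IsOuterUnitNormal Ω₀ z (-(‖y - z‖⁻¹ • (y - z))) := by
  set G := gradient ρ z with hG
  set a := y - z with ha
  have ha0 : 0 < ‖a‖ := norm_pos_iff.2 (sub_ne_zero.2 hyz)
  -- A direction with positive component along a enters the ball about y, which lies in Ω₀.
  have hinw : ∀ v : Plane, 0 < inner ℝ v a → inner ℝ G v ≤ 0 := by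
    intro v hv
    apply gradient_inner_nonpos h hz
    have hv0 : 0 < ‖v‖ ^ 2 := by
      have : v ≠ 0 := by rintro rfl; simp at hv
      positivity
    have hlt : ∀ᶠ s : ℝ in 𝓝[>] 0, s < 2 * inner ℝ v a / ‖v‖ ^ 2 :=
      nhdsWithin_le_nhds (gt_mem_nhds (by positivity))
    filter_upwards [hlt, self_mem_nhdsWithin] with s hs hs0
    have hs0' : 0 < s := hs0
    apply hb
    rw [mem_ball, dist_eq_norm, dist_eq_norm]
    have h1 : z + s • v - y = s • v - a := by rw [ha]; abel
    rw [h1, ← ha]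
    apply lt_of_pow_lt_pow_left₀ 2 (norm_nonneg _)
    rw [norm_sub_sq_real, norm_smul, mul_pow, inner_smul_left]
    rw [lt_div_iff₀ hv0] at hs
    simp only [Real.norm_eq_abs, sq_abs, conj_trivial]
    nlinarith
  set α := inner ℝ G a / ‖a‖ ^ 2 with hα
  set w := G - α • a with hw
  have hwa : inner ℝ w a = 0 := by
    rw [hw, inner_sub_left, inner_smul_left, real_inner_self_eq_norm_sq, hα]
    simp only [conj_trivial]
    field_simp; ring
  have hGw : inner ℝ G w = ‖w‖ ^ 2 := by
    have : G = w + α • a := by rw [hw]; abel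
    conv_lhs => rw [this]
    rw [inner_add_left, inner_smul_left, real_inner_comm, real_inner_self_eq_norm_sq,
      real_inner_comm, hwa]; simp
  have hw0 : w = 0 := by
    -- The part w of G orthogonal to a is the limit of the entering directions w + ηa, which forces
    -- ‖w‖² = ⟨G, w⟩ ≤ 0. So G is a multiple of a.
    have key : ∀ η : ℝ, 0 < η → ‖w‖ ^ 2 + η * inner ℝ G a ≤ 0 := by
      intro η hη
      have := hinw (w + η • a) (by
        rw [inner_add_left, hwa, inner_smul_left, real_inner_self_eq_norm_sq]
        simp only [conj_trivial]; positivity)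
      rwa [inner_add_right, hGw, inner_smul_right] at this
    have hlim : Tendsto (fun η : ℝ => ‖w‖ ^ 2 + η * inner ℝ G a) (𝓝[>] 0) (𝓝 (‖w‖ ^ 2)) := by
      have : Continuous fun η : ℝ => ‖w‖ ^ 2 + η * inner ℝ G a := by fun_prop
      have h2 := (this.tendsto 0).mono_left (nhdsWithin_le_nhds (s := Ioi 0))
      simpa using h2
    have h3 : ‖w‖ ^ 2 ≤ 0 := le_of_tendsto hlim
      (by filter_upwards [self_mem_nhdsWithin] with η hη using key η hη)
    have h4 : ‖w‖ = 0 := by nlinarith [norm_nonneg w]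
    exact norm_eq_zero.1 h4
  have hGa : G = α • a := by rw [← sub_eq_zero, ← hw, hw0]
  have hα0 : α < 0 := by
    have h1 := hinw a (by rw [real_inner_self_eq_norm_sq]; positivity)
    have h2 : α ≤ 0 := div_nonpos_of_nonpos_of_nonneg h1 (by positivity)
    refine lt_of_le_of_ne h2 fun h3 => h.gradient_ne ?_
    rw [← hG, hGa, h3, zero_smul]
  refine ⟨V, ρ, h, ?_⟩
  rw [← hG, hGa, norm_smul, Real.norm_of_nonpos hα0.le, smul_smul, ← neg_smul]
  congr 1
  field_simp
  rw [div_self hα0.ne]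

lemma exists_nearest {Ω₀ : Set Plane} (hΩ : IsOpen Ω₀) (hb : Bornology.IsBounded Ω₀) {y : Plane}
    (hy : y ∈ Ω₀) : ∃ z ∈ frontier Ω₀, z ∉ Ω₀ ∧ infDist y Ω₀ᶜ = dist y z ∧
      ball y (dist y z) ⊆ Ω₀ := by
  have hne : (Ω₀ᶜ).Nonempty := by
    rw [nonempty_compl]
    rintro rfl
    exact NoncompactSpace.noncompact_univ (X := Plane)
      (by simpa using hb.isCompact_closure)
  obtain ⟨z, hz, hd⟩ := hΩ.isClosed_compl.exists_infDist_eq_dist hne y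
  have hball : ball y (dist y z) ⊆ Ω₀ := by
    intro w hw
    by_contra hc
    have := infDist_le_dist_of_mem (x := y) (show w ∈ Ω₀ᶜ from hc)
    rw [mem_ball, dist_comm] at hw
    linarith
  have hyz : y ≠ z := fun h => hz (h ▸ hy)
  refine ⟨z, ?_, hz, hd, hball⟩
  rw [frontier, hΩ.interior_eq]
  refine ⟨closure_mono hball ?_, hz⟩
  rw [closure_ball _ (dist_pos.2 hyz).ne', mem_closedBall, dist_comm]

/-! ### The transporting field -/

/-- A bounded Lipschitz field on the channel, tangent to the wall, with first component bounded
from below, whose weak divergence in the channel is the bounded function `c`. -/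
structure IsTransportField (Ω₀ : Set Plane) (l : ℝ) (b : Fin 3 → Space → ℝ) (c : Space → ℝ)
    (L c₀ : ℝ≥0) : Prop where
  -- These bounds are imposed on the whole space, so that characteristics can be followed outside
  -- the channel; only the divergence identity and the tangency refer to the channel.
  lip : ∀ k, LipschitzWith L (b k)
  abs_le : ∀ k x, |b k x| ≤ 2
  half_le : ∀ x, 1 / 2 ≤ b 0 x
  measurable_div : Measurable c
  abs_div_le : ∀ x, |c x| ≤ c₀
  integral_eq : ∀ ζ : Space → ℝ, ContDiff ℝ ∞ ζ → HasCompactSupport ζ →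
    tsupport ζ ⊆ channel Ω₀ l →
    ∫ x in channel Ω₀ l, ∑ k, b k x * partialD k ζ x = - ∫ x in channel Ω₀ l, c x * ζ x
  tangent : ∀ t ∈ Icc 0 l, ∀ y ∈ frontier Ω₀, ∀ ν, IsOuterUnitNormal Ω₀ y ν →
    b 1 (t, y) * ν 0 + b 2 (t, y) * ν 1 = 0

/-- The field as a vector in space. -/
def fieldVec (b : Fin 3 → Space → ℝ) (x : Space) : Space := (b 0 x, !₂[b 1 x, b 2 x])

lemma fderiv_fieldVec (b : Fin 3 → Space → ℝ) (f : Space → ℝ) (x : Space) :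
    fderiv ℝ f x (fieldVec b x) = ∑ k, b k x * partialD k f x := by
  rw [fderiv_apply_eq, Fin.sum_univ_three]; simp [fieldVec]

/-- s ↦ f(x + sv) - Cs² has a maximum at 0. An upper bound is all that is needed, so a function of
the wall distance can be treated by comparison with the distance to a single wall point. -/
lemma fderiv_eq_zero_of_le_sq {f : Space → ℝ} {x v : Space} (hf : DifferentiableAt ℝ f x) (C : ℝ)
    (h : ∀ s : ℝ, f (x + s • v) ≤ f x + C * s ^ 2) : fderiv ℝ f x v = 0 := by
  have hl : HasDerivAt (fun s : ℝ => x + s • v) v 0 := by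
    simpa using ((hasDerivAt_id (0 : ℝ)).smul_const v).const_add x
  have hf' : HasFDerivAt f (fderiv ℝ f x) (x + (0 : ℝ) • v) := by simpa using hf.hasFDerivAt
  have h1 : HasDerivAt (fun s : ℝ => f (x + s • v)) (fderiv ℝ f x v) 0 :=
    hf'.comp_hasDerivAt (0 : ℝ) hl
  have h2 : HasDerivAt (fun s : ℝ => C * s ^ 2) 0 0 := by
    simpa using ((hasDerivAt_id (0 : ℝ)).pow 2).const_mul C
  have h3 : IsLocalMax (fun s : ℝ => f (x + s • v) - C * s ^ 2) 0 := by
    refine Eventually.of_forall fun s => ?_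
    have := h s
    simp only [zero_smul, add_zero]
    linarith
  simpa using h3.hasDerivAt_eq_zero (h1.sub h2)

lemma norm_pair_le (a b : ℝ) : ‖(!₂[a, b] : Plane)‖ ≤ |a| + |b| := by
  rw [EuclideanSpace.norm_eq, Fin.sum_univ_two]
  apply Real.sqrt_le_iff.2 ⟨by positivity, ?_⟩
  simp only [Real.norm_eq_abs]
  simp
  nlinarith [abs_nonneg a, abs_nonneg b, sq_abs a, sq_abs b]

/-! ### The wall cutoff and its derivative along the field -/

/-- Cutoff near the wall, as a function of the distance to the complement. -/
def wallCutoff (Ω₀ : Set Plane) (m : ℕ) (x : Space) : ℝ :=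
  -- Zero up to distance 1/(m+1), one from distance 2/(m+1) on, with slope m + 1 in between.
  max 0 (min 1 ((m + 1) * infDist x.2 Ω₀ᶜ - 1))

lemma wallCutoff_nonneg (Ω₀ : Set Plane) (m : ℕ) (x : Space) : 0 ≤ wallCutoff Ω₀ m x :=
  le_max_left _ _

lemma wallCutoff_le_one (Ω₀ : Set Plane) (m : ℕ) (x : Space) : wallCutoff Ω₀ m x ≤ 1 :=
  max_le zero_le_one (min_le_left _ _)

lemma abs_wallCutoff_le (Ω₀ : Set Plane) (m : ℕ) (x : Space) :
    |wallCutoff Ω₀ m x| ≤ (1 : ℝ≥0) := by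
  rw [abs_of_nonneg (wallCutoff_nonneg _ _ _)]; exact wallCutoff_le_one _ _ _

lemma lipschitzWith_wallCutoff (Ω₀ : Set Plane) (m : ℕ) :
    LipschitzWith (m + 1) (wallCutoff Ω₀ m) := by
  have h1 : LipschitzWith (m + 1) fun x : Space => (m + 1 : ℝ) * infDist x.2 Ω₀ᶜ - 1 := by
    refine LipschitzWith.of_dist_le_mul fun x y => ?_
    have h2 := (lipschitz_infDist_pt (Ω₀ᶜ)).dist_le_mul x.2 y.2
    rw [dist_sub_right, Real.dist_eq, ← mul_sub, abs_mul, abs_of_nonneg (by positivity)]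
    rw [NNReal.coe_one, one_mul, Real.dist_eq] at h2
    push_cast
    gcongr
    exact h2.trans (le_max_right _ _)
  exact (h1.const_min 1).const_max 0

lemma wallCutoff_eq_one {Ω₀ : Set Plane} {m : ℕ} {x : Space}
    (h : 2 / ((m : ℝ) + 1) ≤ infDist x.2 Ω₀ᶜ) : wallCutoff Ω₀ m x = 1 := by
  rw [div_le_iff₀ (by positivity)] at h
  rw [wallCutoff, min_eq_left (by linarith), max_eq_right zero_le_one]

lemma wallCutoff_le_add {Ω₀ : Set Plane} {m : ℕ} {x x' : Space} {η : ℝ} (hη : 0 ≤ η)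
    (h : infDist x'.2 Ω₀ᶜ ≤ infDist x.2 Ω₀ᶜ + η) :
    wallCutoff Ω₀ m x' ≤ wallCutoff Ω₀ m x + (m + 1) * η := by
  have hm : (0 : ℝ) < m + 1 := by positivity
  have h1 : ((m : ℝ) + 1) * infDist x'.2 Ω₀ᶜ ≤ (m + 1) * infDist x.2 Ω₀ᶜ + (m + 1) * η := by
    rw [← mul_add]; gcongr
  have h2 : 0 ≤ ((m : ℝ) + 1) * η := by positivity
  simp only [wallCutoff]
  rcases le_total 1 (((m : ℝ) + 1) * infDist x.2 Ω₀ᶜ - 1) with h3 | h3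
  · rw [min_eq_left h3]
    have : max 0 (min 1 (((m : ℝ) + 1) * infDist x'.2 Ω₀ᶜ - 1)) ≤ 1 :=
      max_le zero_le_one (min_le_left _ _)
    have : (1 : ℝ) ≤ max 0 1 := le_max_right _ _
    linarith
  · rw [min_eq_right h3]
    refine max_le (by have := le_max_left (0 : ℝ) ((m + 1) * infDist x.2 Ω₀ᶜ - 1); linarith) ?_
    have := le_max_right (0 : ℝ) ((m + 1) * infDist x.2 Ω₀ᶜ - 1)
    exact (min_le_right _ _).trans (by linarith)

lemma fderiv_wallCutoff_eq_zero {Ω₀ : Set Plane} {m : ℕ} {x : Space}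
    (hd : DifferentiableAt ℝ (wallCutoff Ω₀ m) x) (h : 2 / ((m : ℝ) + 1) ≤ infDist x.2 Ω₀ᶜ)
    (v : Space) : fderiv ℝ (wallCutoff Ω₀ m) x v = 0 := by
  refine fderiv_eq_zero_of_le_sq hd 0 fun s => ?_
  rw [wallCutoff_eq_one h]
  simpa using wallCutoff_le_one _ _ _

/-- The derivative of the cutoff along a tangential field stays bounded. -/
lemma abs_fderiv_wallCutoff_le {Ω₀ : Set Plane} (hΩ₀ : IsSmoothBounded Ω₀) {l : ℝ}
    {b : Fin 3 → Space → ℝ} {c : Space → ℝ} {L c₀ : ℝ≥0} (hb : IsTransportField Ω₀ l b c L c₀)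
    {m : ℕ} {x : Space} (hx : x ∈ channel Ω₀ l) (hd : DifferentiableAt ℝ (wallCutoff Ω₀ m) x) :
    |∑ k, b k x * partialD k (wallCutoff Ω₀ m) x| ≤ 4 * L := by
  rw [← fderiv_fieldVec]
  rcases le_or_gt (2 / ((m : ℝ) + 1)) (infDist x.2 Ω₀ᶜ) with h | h
  · rw [fderiv_wallCutoff_eq_zero hd h]; simp
  obtain ⟨z, hzf, hz, hdz, hball⟩ := exists_nearest hΩ₀.isOpen hΩ₀.bounded hx.2
  have hyz : x.2 ≠ z := fun h' => hz (h' ▸ hx.2)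
  obtain ⟨V, ρ, hV⟩ := hΩ₀.smooth_boundary z hzf
  have hν := isOuterUnitNormal_of_ball_subset hV hz hyz hball
  have htan := hb.tangent x.1 ⟨hx.1.1.le, hx.1.2.le⟩ z hzf _ hν
  set r := dist x.2 z with hr
  have hr0 : 0 < r := dist_pos.2 hyz
  have hrn : ‖x.2 - z‖ = r := (dist_eq_norm _ _).symm
  set u : Plane := !₂[b 1 (x.1, z), b 2 (x.1, z)] with hu
  have hort : inner ℝ (x.2 - z) u = 0 := by
    have h1 : r ≠ 0 := hr0.ne'
    simp only [PiLp.neg_apply, PiLp.smul_apply, smul_eq_mul, hrn] at htan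
    rw [PiLp.inner_apply, Fin.sum_univ_two]
    simp only [hu, RCLike.inner_apply, conj_trivial]
    simp only [PiLp.sub_apply, Matrix.cons_val_zero, Matrix.cons_val_one] at htan ⊢
    field_simp at htan
    linarith
  -- The axial part leaves the cutoff unchanged. The cross-sectional velocity u at the nearest wall
  -- point is orthogonal to x.2 - z and changes the distance to second order only. The remainder is
  -- at most 2Lr with r < 2/(m+1), which compensates the slope m + 1.
  have hsplit : fieldVec b x = b 0 x • ((1 : ℝ), (0 : Plane)) + ((0 : ℝ), u) +
      ((0 : ℝ), !₂[b 1 x, b 2 x] - u) := by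
    ext i
    · simp [fieldVec]
    · simp [fieldVec]
  have e1 : fderiv ℝ (wallCutoff Ω₀ m) x ((1 : ℝ), (0 : Plane)) = 0 := by
    refine fderiv_eq_zero_of_le_sq hd 0 fun s => ?_
    simp [wallCutoff]
  have e2 : fderiv ℝ (wallCutoff Ω₀ m) x ((0 : ℝ), u) = 0 := by
    -- By Pythagoras the distance to z after the step su is √(r² + s²‖u‖²) ≤ r + s²‖u‖²/(2r); the
    -- cutoff multiplies the increment by at most m + 1.
    refine fderiv_eq_zero_of_le_sq hd ((m + 1) * (‖u‖ ^ 2 / (2 * r))) fun s => ?_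
    rw [mul_assoc]
    apply wallCutoff_le_add (by positivity)
    simp only [Prod.snd_add, Prod.smul_snd]
    refine (infDist_le_dist_of_mem (show z ∈ Ω₀ᶜ from hz)).trans ?_
    rw [hdz, dist_eq_norm, add_sub_right_comm]
    apply le_of_sq_le_sq _ (by positivity)
    rw [norm_add_sq_real, inner_smul_right, hort, norm_smul, hrn, Real.norm_eq_abs, mul_pow, sq_abs]
    have : (r + ‖u‖ ^ 2 / (2 * r) * s ^ 2) ^ 2 =
      r ^ 2 + s ^ 2 * ‖u‖ ^ 2 + (‖u‖ ^ 2 / (2 * r) * s ^ 2) ^ 2 := by field_simp; ring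
    rw [this]
    nlinarith [sq_nonneg (‖u‖ ^ 2 / (2 * r) * s ^ 2)]
  have e3 : |fderiv ℝ (wallCutoff Ω₀ m) x ((0 : ℝ), !₂[b 1 x, b 2 x] - u)| ≤ 4 * L := by
    have h1 : ‖fderiv ℝ (wallCutoff Ω₀ m) x‖ ≤ (m + 1 : ℝ) := by
      simpa using norm_fderiv_le_of_lipschitz ℝ (lipschitzWith_wallCutoff Ω₀ m)
    have hdist : dist x (x.1, z) = r := by
      rw [Prod.dist_eq]; simp [hr]
    have h2 : ∀ k, |b k x - b k (x.1, z)| ≤ L * r := by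
      intro k
      have := (hb.lip k).dist_le_mul x (x.1, z)
      rwa [hdist, Real.dist_eq] at this
    have h3 : !₂[b 1 x, b 2 x] - u = !₂[b 1 x - b 1 (x.1, z), b 2 x - b 2 (x.1, z)] := by
      ext i; fin_cases i <;> simp [hu]
    have h4 : ‖(((0 : ℝ), !₂[b 1 x, b 2 x] - u) : Space)‖ ≤ 2 * L * r := by
      rw [Prod.norm_def, norm_zero, max_eq_right (norm_nonneg _), h3]
      refine (norm_pair_le _ _).trans ?_
      linarith [h2 1, h2 2]
    calc _ ≤ ‖fderiv ℝ (wallCutoff Ω₀ m) x‖ * ‖(((0 : ℝ), !₂[b 1 x, b 2 x] - u) : Space)‖ :=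
          ContinuousLinearMap.le_opNorm _ _
      _ ≤ (m + 1) * (2 * L * r) := by gcongr
      _ ≤ (m + 1) * (2 * L * (2 / (m + 1))) := by
          rw [hdz] at h; gcongr
      _ = 4 * L := by field_simp; ring
  rw [hsplit, map_add, map_add, map_smul, e1, e2]
  simpa using e3

/-! ### The transport operator and its integral over the channel -/

variable {Ω₀ : Set Plane} {l : ℝ} {b : Fin 3 → Space → ℝ} {c : Space → ℝ} {L c₀ : ℝ≥0}

lemma isFiniteMeasure_channel (hΩ₀ : IsSmoothBounded Ω₀) (l : ℝ) :
    IsFiniteMeasure (volume.restrict (channel Ω₀ l)) :=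
  ⟨by simpa using (isBounded_channel hΩ₀ l).measure_lt_top⟩

lemma isFiniteMeasure_section (hΩ₀ : IsSmoothBounded Ω₀) :
    IsFiniteMeasure ((volume : Measure Plane).restrict Ω₀) :=
  ⟨by simpa using hΩ₀.bounded.measure_lt_top⟩

/-- The transport operator in divergence form. -/
def transportOp (b : Fin 3 → Space → ℝ) (c : Space → ℝ) (ψ : Space → ℝ) (x : Space) : ℝ :=
  ∑ k, b k x * partialD k ψ x + c x * ψ x

lemma IsTransportField.measurable (hb : IsTransportField Ω₀ l b c L c₀) (k : Fin 3) :
    Measurable (b k) := (hb.lip k).continuous.measurable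

lemma IsTransportField.measurable_transportOp (hb : IsTransportField Ω₀ l b c L c₀)
    {ψ : Space → ℝ} (hψ : Measurable ψ) : Measurable (transportOp b c ψ) := by
  unfold transportOp
  refine Measurable.add (Finset.measurable_sum _ fun k _ => ?_) (hb.measurable_div.mul hψ)
  exact (hb.measurable k).mul (measurable_partialD k ψ)

lemma IsTransportField.abs_transportOp_le (hb : IsTransportField Ω₀ l b c L c₀)
    {ψ : Space → ℝ} {x : Space} {A B : ℝ} (hA : ∀ k, |partialD k ψ x| ≤ A) (hB : |ψ x| ≤ B) :
    |transportOp b c ψ x| ≤ 6 * A + c₀ * B := by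
  have h1 : ∀ k, |b k x * partialD k ψ x| ≤ 2 * A := fun k => by
    rw [abs_mul]
    exact mul_le_mul (hb.abs_le k x) (hA k) (abs_nonneg _) zero_le_two
  have h2 : |c x * ψ x| ≤ c₀ * B := by
    rw [abs_mul]
    exact mul_le_mul (hb.abs_div_le x) hB (abs_nonneg _) c₀.2
  calc _ ≤ |∑ k, b k x * partialD k ψ x| + |c x * ψ x| := abs_add_le _ _
    _ ≤ ∑ k, |b k x * partialD k ψ x| + |c x * ψ x| := by
        gcongr; exact Finset.abs_sum_le_sum_abs _ _
    _ ≤ ∑ _k : Fin 3, 2 * A + c₀ * B := by gcongr with k; exact h1 k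
    _ = _ := by simp; ring

lemma exists_bound_of_hasCompactSupport {ψ : Space → ℝ} (hψ : Continuous ψ)
    (hc : HasCompactSupport ψ) : ∃ B : ℝ≥0, ∀ x, |ψ x| ≤ B := by
  obtain ⟨B, hB⟩ := hc.exists_bound_of_continuous hψ
  exact ⟨B.toNNReal, fun x => (hB x).trans (Real.le_coe_toNNReal B)⟩

lemma tsupport_mollify_subset (ζ : Space → ℝ) (n : ℕ) :
    tsupport (mollify n ζ) ⊆ cthickening (1 / ((n : ℝ) + 1)) (tsupport ζ) := by
  apply closure_minimal _ isClosed_cthickening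
  intro x hx
  by_contra hc
  apply hx
  apply mollify_eq_zero
  intro y hy
  by_contra hy0
  apply hc
  exact mem_cthickening_of_dist_le x y _ _ (subset_tsupport ζ hy0) (by rwa [dist_comm])

/-- The weak divergence identity holds for Lipschitz test functions. -/
lemma IsTransportField.integral_transportOp_eq_zero (hΩ₀ : IsSmoothBounded Ω₀)
    (hb : IsTransportField Ω₀ l b c L c₀) {ζ : Space → ℝ} {K : ℝ≥0} (hζ : LipschitzWith K ζ)
    (hc : HasCompactSupport ζ) (hs : tsupport ζ ⊆ channel Ω₀ l) :
    ∫ x in channel Ω₀ l, transportOp b c ζ x = 0 := by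
  have := isFiniteMeasure_channel hΩ₀ l
  obtain ⟨B, hB⟩ := exists_bound_of_hasCompactSupport hζ.continuous hc
  obtain ⟨δ, hδ, hδs⟩ := hc.isCompact.exists_cthickening_subset_open (isOpen_channel hΩ₀ l) hs
  have hB' : ∀ n x, |mollify n ζ x| ≤ B := fun n x =>
    abs_mollify_le n x (Eventually.of_forall fun z _ => hB _)
  have hlim : Tendsto (fun n => ∫ x in channel Ω₀ l, transportOp b c (mollify n ζ) x) atTop
      (𝓝 (∫ x in channel Ω₀ l, transportOp b c ζ x)) := by
    refine tendsto_integral_of_dominated_convergence (fun _ => 6 * K + c₀ * B)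
      (fun n => (hb.measurable_transportOp (contDiff_mollify n
        hζ.continuous.locallyIntegrable).continuous.measurable).aestronglyMeasurable)
      (integrable_const _) (fun n => Eventually.of_forall fun x => ?_) ?_
    · exact hb.abs_transportOp_le (fun k => abs_partialD_mollify_le n hζ k x) (hB' n x)
    · have hk : ∀ᵐ x, ∀ k, Tendsto (fun n => partialD k (mollify n ζ) x) atTop
          (𝓝 (partialD k ζ x)) := ae_all_iff.2 fun k => ae_tendsto_partialD_mollify hζ k
      filter_upwards [ae_restrict_of_ae hk] with x hx
      exact (tendsto_finsetSum _ fun k _ => (hx k).const_mul _).add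
        ((tendsto_mollify_of_lipschitz hζ x).const_mul _)
  refine tendsto_nhds_unique hlim (tendsto_const_nhds.congr' ?_)
  filter_upwards [(tendsto_one_div_add_atTop_nhds_zero_nat (𝕜 := ℝ)).eventually_lt_const hδ]
    with n hn
  have hsm := contDiff_mollify n hζ.continuous.locallyIntegrable
  have hsub := (tsupport_mollify_subset ζ n).trans (cthickening_mono hn.le _)
  have hcs : HasCompactSupport (mollify n ζ) :=
    hc.isCompact.cthickening.of_isClosed_subset (isClosed_tsupport _) hsub
  have key := hb.integral_eq (mollify n ζ) hsm hcs (hsub.trans hδs)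
  have i1 : Integrable (fun x => c x * mollify n ζ x) (volume.restrict (channel Ω₀ l)) :=
    Integrable.of_bound (hb.measurable_div.mul hsm.continuous.measurable).aestronglyMeasurable
      (c₀ * B) (Eventually.of_forall fun x => by
        rw [norm_mul]
        exact mul_le_mul (hb.abs_div_le x) (hB' n x) (abs_nonneg _) c₀.2)
  have i2 : Integrable (transportOp b c (mollify n ζ)) (volume.restrict (channel Ω₀ l)) :=
    Integrable.of_bound (hb.measurable_transportOp hsm.continuous.measurable).aestronglyMeasurable
      (6 * K + c₀ * B) (Eventually.of_forall fun x =>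
        hb.abs_transportOp_le (fun k => abs_partialD_mollify_le n hζ k x) (hB' n x))
  have i3 : (fun x => ∑ k, b k x * partialD k (mollify n ζ) x) =
      fun x => transportOp b c (mollify n ζ) x - c x * mollify n ζ x := by
    ext x; simp [transportOp]
  rw [i3, integral_sub i2 i1] at key
  linarith

/-- By tangency, test functions need not vanish near the wall. -/
lemma IsTransportField.integral_transportOp_eq_zero' (hΩ₀ : IsSmoothBounded Ω₀)
    (hb : IsTransportField Ω₀ l b c L c₀) {ψ : Space → ℝ} {K : ℝ≥0} (hψ : LipschitzWith K ψ)
    (hd : Differentiable ℝ ψ) (hc : HasCompactSupport ψ) {s t : ℝ} (hs : 0 < s) (ht : t < l)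
    (h0 : ∀ x : Space, x.1 ∉ Icc s t → ψ x = 0) :
    ∫ x in channel Ω₀ l, transportOp b c ψ x = 0 := by
  have := isFiniteMeasure_channel hΩ₀ l
  obtain ⟨B, hB⟩ := exists_bound_of_hasCompactSupport hψ.continuous hc
  set ζ : ℕ → Space → ℝ := fun m x => wallCutoff Ω₀ m x * ψ x with hζ
  have hζL : ∀ m : ℕ, LipschitzWith (1 * K + B * (m + 1)) (ζ m) := fun m =>
    lipschitzWith_mul (lipschitzWith_wallCutoff Ω₀ m) hψ (abs_wallCutoff_le Ω₀ m) hB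
  have hζs : ∀ m, tsupport (ζ m) ⊆ channel Ω₀ l := by
    intro m
    have hcl : IsClosed {x : Space | x.1 ∈ Icc s t ∧ 1 / ((m : ℝ) + 1) ≤ infDist x.2 Ω₀ᶜ} := by
      apply (isClosed_Icc.preimage continuous_fst).inter
      exact isClosed_le continuous_const ((continuous_infDist_pt _).comp continuous_snd)
    refine (closure_minimal ?_ hcl).trans ?_
    · intro x hx
      have hx1 : wallCutoff Ω₀ m x ≠ 0 := left_ne_zero_of_mul hx
      have hx2 : ψ x ≠ 0 := right_ne_zero_of_mul hx
      refine ⟨by_contra fun h => hx2 (h0 x h), by_contra fun h => hx1 ?_⟩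
      rw [not_le, lt_div_iff₀ (by positivity)] at h
      rw [wallCutoff, max_eq_left]
      exact (min_le_right _ _).trans (by linarith)
    · rintro x ⟨h1, h2⟩
      refine ⟨⟨hs.trans_le h1.1, h1.2.trans_lt ht⟩, by_contra fun h => ?_⟩
      rw [infDist_zero_of_mem (show x.2 ∈ Ω₀ᶜ from h)] at h2
      have : 0 < 1 / ((m : ℝ) + 1) := by positivity
      linarith
  have hζc : ∀ m, HasCompactSupport (ζ m) := fun m => hc.mul_left
  have hdiff : ∀ᵐ x : Space, ∀ m, DifferentiableAt ℝ (wallCutoff Ω₀ m) x :=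
    ae_all_iff.2 fun m => (lipschitzWith_wallCutoff Ω₀ m).ae_differentiableAt
  have hform : ∀ m x, DifferentiableAt ℝ (wallCutoff Ω₀ m) x →
      transportOp b c (ζ m) x = wallCutoff Ω₀ m x * transportOp b c ψ x +
        ψ x * ∑ k, b k x * partialD k (wallCutoff Ω₀ m) x := by
    intro m x hx
    have h1 : ∀ k, partialD k (ζ m) x = wallCutoff Ω₀ m x * partialD k ψ x +
        ψ x * partialD k (wallCutoff Ω₀ m) x := by
      intro k
      simp only [partialD, hζ]
      rw [fderiv_fun_mul hx (hd x)]
      simp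
    have h2 : ζ m x = wallCutoff Ω₀ m x * ψ x := rfl
    simp only [transportOp, h1, h2, Fin.sum_univ_three]
    ring
  have hzero : ∀ m, ∫ x in channel Ω₀ l, transportOp b c (ζ m) x = 0 := fun m =>
    hb.integral_transportOp_eq_zero hΩ₀ (hζL m) (hζc m) (hζs m)
  have hlim : Tendsto (fun m => ∫ x in channel Ω₀ l, transportOp b c (ζ m) x) atTop
      (𝓝 (∫ x in channel Ω₀ l, transportOp b c ψ x)) := by
    -- Tangency supplies the dominating constant: `B * (4 * L)` bounds ψ b·∇(cutoff) for all m,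
    -- although the gradient of the cutoff may be as large as m + 1. At a fixed point of the channel
    -- this term is zero as soon as 2/(m+1) is below the distance to the wall.
    refine tendsto_integral_of_dominated_convergence (fun _ => (6 * K + c₀ * B) + B * (4 * L))
      (fun m => (hb.measurable_transportOp (hζL m).continuous.measurable).aestronglyMeasurable)
      (integrable_const _) (fun m => ?_) ?_
    · filter_upwards [ae_restrict_of_ae hdiff, ae_restrict_mem (isOpen_channel hΩ₀ l).measurableSet]
        with x hx hxΩ
      rw [hform m x (hx m)]
      refine (norm_add_le _ _).trans ?_
      rw [norm_mul, norm_mul]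
      have e1 : |wallCutoff Ω₀ m x| ≤ 1 := abs_wallCutoff_le Ω₀ m x
      have e2 := hb.abs_transportOp_le (ψ := ψ) (x := x) (fun k => abs_partialD_le hψ k x) (hB x)
      have e3 := abs_fderiv_wallCutoff_le hΩ₀ hb hxΩ (hx m)
      simp only [Real.norm_eq_abs]
      have e4 : |wallCutoff Ω₀ m x| * |transportOp b c ψ x| ≤ 6 * K + c₀ * B := by
        calc _ ≤ 1 * |transportOp b c ψ x| := by gcongr
          _ ≤ _ := by rw [one_mul]; exact e2
      have e5 := mul_le_mul (hB x) e3 (abs_nonneg _) B.2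
      exact add_le_add e4 e5
    · filter_upwards [ae_restrict_of_ae hdiff, ae_restrict_mem (isOpen_channel hΩ₀ l).measurableSet]
        with x hx hxΩ
      refine tendsto_const_nhds.congr' ?_
      have hpos : 0 < infDist x.2 Ω₀ᶜ := by
        obtain ⟨z, -, hz, hdz, -⟩ := exists_nearest hΩ₀.isOpen hΩ₀.bounded hxΩ.2
        rw [hdz]
        exact dist_pos.2 fun h' => hz (h' ▸ hxΩ.2)
      have h2 := (tendsto_one_div_add_atTop_nhds_zero_nat (𝕜 := ℝ)).const_mul 2
      rw [mul_zero] at h2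
      filter_upwards [h2.eventually_lt_const hpos] with m hm
      rw [mul_one_div] at hm
      rw [hform m x (hx m), wallCutoff_eq_one hm.le, ← fderiv_fieldVec,
        fderiv_wallCutoff_eq_zero (hx m) hm.le]
      ring
  exact (tendsto_nhds_unique hlim (by simp only [hzero]; exact tendsto_const_nhds))

/-! ### The identity on slices -/

/-- A Lipschitz `E` is absolutely continuous. Integration by parts against θ identifies its
derivative with `D` almost everywhere in (0, l), and the fundamental theorem of calculus then
reaches the end points 0 and l. -/
lemma sub_eq_integral_of_weak_deriv {E D : ℝ → ℝ} {K : ℝ≥0} (hE : LipschitzWith K E)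
    (hD : IntegrableOn D (Ioo 0 l))
    (H : ∀ θ : ℝ → ℝ, ContDiff ℝ ∞ θ → HasCompactSupport θ → tsupport θ ⊆ Ioo 0 l →
      ∫ s in Ioo 0 l, deriv θ s * E s = - ∫ s in Ioo 0 l, θ s * D s)
    {s t : ℝ} (hs : 0 ≤ s) (hst : s ≤ t) (ht : t ≤ l) :
    E t - E s = ∫ τ in Ioo s t, D τ := by
  have hl : 0 ≤ l := hs.trans (hst.trans ht)
  have hac : ∀ a b, AbsolutelyContinuousOnInterval E a b := fun a b =>
    (hE.lipschitzOnWith (s := uIcc a b)).absolutelyContinuousOnInterval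
  have hE'i : IntegrableOn (deriv E) (Ioo 0 l) :=
    ((intervalIntegrable_iff_integrableOn_Ioc_of_le hl).1
      (hac 0 l).intervalIntegrable_deriv).mono_set Ioo_subset_Ioc_self
  have hae : ∀ᵐ τ, τ ∈ Ioo 0 l → deriv E τ - D τ = 0 := by
    refine isOpen_Ioo.ae_eq_zero_of_integral_contDiff_smul_eq_zero
      (hE'i.sub hD).locallyIntegrableOn fun θ hθ hθc hθs => ?_
    have h1 := H θ hθ hθc hθs
    have hθac : AbsolutelyContinuousOnInterval θ 0 l :=
      ((hθ.of_le (by exact_mod_cast le_top)).contDiffOn (s := uIcc 0 l)).absolutelyContinuousOnInterval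
    have h2 := hθac.integral_mul_deriv_eq_deriv_mul (hac 0 l)
    have z0 : θ 0 = 0 := image_eq_zero_of_notMem_tsupport fun h => lt_irrefl _ (hθs h).1
    have zl : θ l = 0 := image_eq_zero_of_notMem_tsupport fun h => lt_irrefl _ (hθs h).2
    rw [z0, zl, intervalIntegral.integral_of_le hl, intervalIntegral.integral_of_le hl,
      integral_Ioc_eq_integral_Ioo, integral_Ioc_eq_integral_Ioo, h1] at h2
    obtain ⟨B, hB⟩ := hθc.exists_bound_of_continuous hθ.continuous
    have i1 : IntegrableOn (fun τ => θ τ * deriv E τ) (Ioo 0 l) :=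
      hE'i.bdd_mul hθ.continuous.aestronglyMeasurable (Eventually.of_forall hB)
    have i2 : IntegrableOn (fun τ => θ τ * D τ) (Ioo 0 l) :=
      hD.bdd_mul hθ.continuous.aestronglyMeasurable (Eventually.of_forall hB)
    have h3 : ∫ τ, θ τ • (deriv E τ - D τ) =
        ∫ τ in Ioo 0 l, (θ τ * deriv E τ - θ τ * D τ) := by
      rw [← setIntegral_eq_integral_of_forall_compl_eq_zero (s := Ioo 0 l)]
      · congr 1; ext τ; rw [smul_eq_mul, mul_sub]
      · intro τ hτ
        rw [image_eq_zero_of_notMem_tsupport fun h => hτ (hθs h), zero_smul]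
    rw [h3, integral_sub i1 i2, h2]
    ring
  rw [← (hac s t).integral_deriv_eq_sub, intervalIntegral.integral_of_le hst,
    integral_Ioc_eq_integral_Ioo]
  refine setIntegral_congr_ae measurableSet_Ioo ?_
  filter_upwards [hae] with τ hτ hτst
  exact sub_eq_zero.1 (hτ ⟨hs.trans_lt hτst.1, hτst.2.trans_le ht⟩)

lemma volume_restrict_channel (Ω₀ : Set Plane) (l : ℝ) :
    (volume.restrict (channel Ω₀ l) : Measure Space) =
      (volume.restrict (Ioo 0 l)).prod (volume.restrict Ω₀) := by
  rw [Measure.prod_restrict]; rfl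

lemma setIntegral_channel (hΩ₀ : IsSmoothBounded Ω₀) (f : Space → ℝ)
    (hf : IntegrableOn f (channel Ω₀ l)) :
    ∫ x in channel Ω₀ l, f x = ∫ s in Ioo 0 l, ∫ y in Ω₀, f (s, y) := by
  rw [volume_restrict_channel]
  rw [IntegrableOn, volume_restrict_channel] at hf
  have := isFiniteMeasure_section hΩ₀
  exact integral_prod f hf

lemma integrableOn_of_abs_le (hΩ₀ : IsSmoothBounded Ω₀) {f : Space → ℝ} (hf : Measurable f) {C : ℝ}
    (hC : ∀ x ∈ channel Ω₀ l, |f x| ≤ C) : IntegrableOn f (channel Ω₀ l) := by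
  have := isFiniteMeasure_channel hΩ₀ l
  refine Integrable.of_bound hf.aestronglyMeasurable C ?_
  filter_upwards [ae_restrict_mem (isOpen_channel hΩ₀ l).measurableSet] with x hx using hC x hx

lemma integrable_slice_of_continuous (hΩ₀ : IsSmoothBounded Ω₀) {f : Space → ℝ} (hf : Continuous f)
    (s : ℝ) : Integrable (fun y => f (s, y)) (volume.restrict Ω₀) := by
  have hc : Continuous fun y : Plane => f (s, y) := hf.comp (by fun_prop)
  exact (hc.continuousOn.integrableOn_compact hΩ₀.bounded.isCompact_closure).mono_set
    subset_closure

/-- For the test function θ(x₁)ψ(x), `integral_transportOp_eq_zero'` says that the flux of ψb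
through the cross-section has the integral of Gψ over it as weak derivative in x₁. The flux is
Lipschitz in x₁, so the identity holds for every pair of sections, the inflow and outflow parts
included. -/
lemma IsTransportField.slice_identity_of_hasCompactSupport (hΩ₀ : IsSmoothBounded Ω₀)
    (hb : IsTransportField Ω₀ l b c L c₀) {ψ : Space → ℝ} (hψ : ContDiff ℝ 1 ψ)
    (hc : HasCompactSupport ψ) {s t : ℝ} (hs : 0 ≤ s) (hst : s ≤ t) (ht : t ≤ l) :
    (∫ y in Ω₀, b 0 (t, y) * ψ (t, y)) - ∫ y in Ω₀, b 0 (s, y) * ψ (s, y) =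
      ∫ τ in Ioo s t, ∫ y in Ω₀, transportOp b c ψ (τ, y) := by
  have := isFiniteMeasure_channel hΩ₀ l
  have := isFiniteMeasure_section hΩ₀
  obtain ⟨K, hK⟩ := hψ.lipschitzWith_of_hasCompactSupport hc one_ne_zero
  obtain ⟨B, hB⟩ := exists_bound_of_hasCompactSupport hψ.continuous hc
  set G := transportOp b c ψ with hG
  have hGm : Measurable G := hb.measurable_transportOp hψ.continuous.measurable
  have hGb : ∀ x, |G x| ≤ 6 * K + c₀ * B := fun x =>
    hb.abs_transportOp_le (fun k => abs_partialD_le hK k x) (hB x)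
  have hGi : IntegrableOn G (channel Ω₀ l) := integrableOn_of_abs_le hΩ₀ hGm fun x _ => hGb x
  have hP : LipschitzWith (2 * K + B * L) fun x => b 0 x * ψ x :=
    lipschitzWith_mul (hb.lip 0) hK (hb.abs_le 0) hB
  have hPi := fun s => integrable_slice_of_continuous hΩ₀ hP.continuous s
  have hE : LipschitzWith (Real.toNNReal ((volume.restrict Ω₀).real univ * (2 * K + B * L)))
      fun s => ∫ y in Ω₀, b 0 (s, y) * ψ (s, y) := by
    refine LipschitzWith.of_dist_le_mul fun s t => ?_
    rw [Real.coe_toNNReal _ (by positivity), dist_eq_norm, ← integral_sub (hPi s) (hPi t)]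
    refine (norm_integral_le_of_norm_le_const (C := (2 * K + B * L) * dist s t)
      (Eventually.of_forall fun y => ?_)).trans_eq (by ring)
    have := hP.dist_le_mul (s, y) (t, y)
    rw [dist_eq_norm, Prod.dist_eq, dist_self, max_eq_left dist_nonneg] at this
    exact_mod_cast this
  refine sub_eq_integral_of_weak_deriv hE
    (D := fun τ => ∫ y in Ω₀, G (τ, y)) ?_ ?_ hs hst ht
  · rw [IntegrableOn, volume_restrict_channel] at hGi
    exact hGi.integral_prod_left
  · intro θ hθ hθc hθs
    obtain ⟨A, hA⟩ := hθc.exists_bound_of_continuous hθ.continuous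
    have hθ' := hθ.continuous_deriv (by simp)
    obtain ⟨A', hA'⟩ := hθc.deriv.exists_bound_of_continuous hθ'
    have hθψ : ContDiff ℝ 1 fun x : Space => θ x.1 * ψ x :=
      ((hθ.of_le (by exact_mod_cast le_top)).comp contDiff_fst).mul hψ
    have hθψc : HasCompactSupport fun x : Space => θ x.1 * ψ x := hc.mul_left
    obtain ⟨K', hK'⟩ := hθψ.lipschitzWith_of_hasCompactSupport hθψc one_ne_zero
    obtain ⟨a, a', ha, ha', haa⟩ : ∃ a a' : ℝ, 0 < a ∧ a' < l ∧ tsupport θ ⊆ Icc a a' := by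
      rcases (tsupport θ).eq_empty_or_nonempty with h | h
      · exact ⟨1, l - 1, one_pos, by linarith, by simp [h]⟩
      · exact ⟨sInf (tsupport θ), sSup (tsupport θ), (hθs (hθc.isCompact.sInf_mem h)).1,
          (hθs (hθc.isCompact.sSup_mem h)).2, fun x hx =>
          ⟨csInf_le hθc.isCompact.bddBelow hx, le_csSup hθc.isCompact.bddAbove hx⟩⟩
    have key := hb.integral_transportOp_eq_zero' hΩ₀ hK' (hθψ.differentiable (by simp)) hθψc
      ha ha' (fun x hx => by
        rw [image_eq_zero_of_notMem_tsupport fun h => hx (haa h), zero_mul])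
    have hform : ∀ x : Space, transportOp b c (fun x : Space => θ x.1 * ψ x) x =
        deriv θ x.1 * (b 0 x * ψ x) + θ x.1 * G x := by
      intro x
      have hdθ : HasFDerivAt (fun x : Space => θ x.1)
          (deriv θ x.1 • ContinuousLinearMap.fst ℝ ℝ Plane) x :=
        ((hθ.differentiable (by simp)) x.1).hasDerivAt.comp_hasFDerivAt x hasFDerivAt_fst
      have hd := hdθ.fun_mul ((hψ.differentiable (by simp)) x).hasFDerivAt
      have h1 : ∀ k, partialD k (fun x : Space => θ x.1 * ψ x) x = θ x.1 * partialD k ψ x +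
          ψ x * (deriv θ x.1 * (dir k).1) := by
        intro k
        rw [partialD, hd.fderiv]; simp [partialD]
      simp only [hG, transportOp, h1, Fin.sum_univ_three]
      simp [dir]
      ring
    have i1 : IntegrableOn (fun x : Space => deriv θ x.1 * (b 0 x * ψ x)) (channel Ω₀ l) := by
      refine integrableOn_of_abs_le hΩ₀ ((hθ'.measurable.comp measurable_fst).mul
        hP.continuous.measurable) (C := A' * (2 * B)) fun x _ => ?_
      rw [abs_mul, abs_mul]
      exact mul_le_mul (hA' _) (mul_le_mul (hb.abs_le 0 x) (hB x) (abs_nonneg _) zero_le_two)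
        (by positivity) ((norm_nonneg _).trans (hA' 0))
    have i2 : IntegrableOn (fun x : Space => θ x.1 * G x) (channel Ω₀ l) := by
      refine integrableOn_of_abs_le hΩ₀ ((hθ.continuous.measurable.comp measurable_fst).mul hGm)
        (C := A * (6 * K + c₀ * B)) fun x _ => ?_
      rw [abs_mul]
      exact mul_le_mul (hA _) (hGb x) (abs_nonneg _) ((norm_nonneg _).trans (hA 0))
    simp_rw [hform] at key
    rw [integral_add i1 i2, setIntegral_channel hΩ₀ _ i1, setIntegral_channel hΩ₀ _ i2] at key
    simp_rw [integral_const_mul] at key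
    linarith

lemma exists_hasCompactSupport_eq (hΩ₀ : IsSmoothBounded Ω₀) (l : ℝ) {ψ : Space → ℝ}
    (hψ : ContDiff ℝ 1 ψ) : ∃ ψ' : Space → ℝ, ContDiff ℝ 1 ψ' ∧ HasCompactSupport ψ' ∧
      ∀ s ∈ Icc 0 l, ∀ y ∈ Ω₀, ψ' =ᶠ[𝓝 (s, y)] ψ := by
  obtain ⟨R, hR⟩ := ((isBounded_Icc 0 l).prod hΩ₀.bounded).subset_ball (0 : Space)
  set f : ContDiffBump (0 : Space) := ⟨|R| + 1, |R| + 2, by positivity, by linarith⟩ with hf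
  refine ⟨fun x => f x * ψ x, f.contDiff.mul hψ, f.hasCompactSupport.mul_right, ?_⟩
  intro s hs y hy
  have h1 : ((s, y) : Space) ∈ ball (0 : Space) (|R| + 1) :=
    ball_subset_ball (by linarith [le_abs_self R]) (hR ⟨hs, hy⟩)
  filter_upwards [f.eventuallyEq_one_of_mem_ball h1] with x hx
  rw [hx]; simp

/-- The divergence theorem between two cross-sections of the channel. -/
theorem IsTransportField.slice_identity (hΩ₀ : IsSmoothBounded Ω₀)
    (hb : IsTransportField Ω₀ l b c L c₀) {ψ : Space → ℝ} (hψ : ContDiff ℝ 1 ψ)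
    {s t : ℝ} (hs : 0 ≤ s) (hst : s ≤ t) (ht : t ≤ l) :
    (∫ y in Ω₀, b 0 (t, y) * ψ (t, y)) - ∫ y in Ω₀, b 0 (s, y) * ψ (s, y) =
      ∫ τ in Ioo s t, ∫ y in Ω₀, transportOp b c ψ (τ, y) := by
  obtain ⟨ψ', h1, h2, h3⟩ := exists_hasCompactSupport_eq hΩ₀ l hψ
  have key := hb.slice_identity_of_hasCompactSupport hΩ₀ h1 h2 hs hst ht
  have hm := hΩ₀.isOpen.measurableSet
  have e1 : ∀ τ ∈ Icc 0 l, ∫ y in Ω₀, b 0 (τ, y) * ψ' (τ, y) = ∫ y in Ω₀, b 0 (τ, y) * ψ (τ, y) :=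
    fun τ hτ => setIntegral_congr_fun hm fun y hy => by
      simp only [(h3 τ hτ y hy).eq_of_nhds]
  rw [e1 t ⟨hs.trans hst, ht⟩, e1 s ⟨hs, hst.trans ht⟩] at key
  rw [key]
  refine setIntegral_congr_fun measurableSet_Ioo fun τ hτ => setIntegral_congr_fun hm fun y hy => ?_
  have h4 := h3 τ ⟨hs.trans hτ.1.le, hτ.2.le.trans ht⟩ y hy
  simp only [transportOp, partialD, h4.eq_of_nhds, h4.fderiv_eq]

/-! ### Norms on cross-sections and the space L¹(L²) -/

lemma integral_mul_eq_inner {α : Type*} [MeasurableSpace α] {μ : Measure α} {f g : α → ℝ}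
    (hf : MemLp f 2 μ) (hg : MemLp g 2 μ) :
    ∫ x, f x * g x ∂μ = inner ℝ (hf.toLp f) (hg.toLp g) := by
  rw [L2.inner_def]
  refine integral_congr_ae ?_
  filter_upwards [hf.coeFn_toLp, hg.coeFn_toLp] with x h1 h2
  rw [h1, h2, real_inner_eq_re_inner]
  simp [mul_comm]

lemma abs_integral_mul_le {α : Type*} [MeasurableSpace α] {μ : Measure α} {f g : α → ℝ}
    (hf : MemLp f 2 μ) (hg : MemLp g 2 μ) :
    |∫ x, f x * g x ∂μ| ≤ (eLpNorm f 2 μ).toReal * (eLpNorm g 2 μ).toReal := by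
  rw [integral_mul_eq_inner hf hg, ← Lp.norm_toLp f hf, ← Lp.norm_toLp g hg]
  exact abs_real_inner_le_norm _ _

lemma integral_sq_eq {α : Type*} [MeasurableSpace α] {μ : Measure α} {f : α → ℝ}
    (hf : MemLp f 2 μ) : ∫ x, f x ^ 2 ∂μ = (eLpNorm f 2 μ).toReal ^ 2 := by
  simp_rw [sq]
  rw [integral_mul_eq_inner hf hf, real_inner_self_eq_norm_mul_norm, Lp.norm_toLp]

lemma eLpNorm_two_sq {α : Type*} [MeasurableSpace α] {μ : Measure α} (f : α → ℝ) :
    eLpNorm f 2 μ ^ 2 = ∫⁻ x, ‖f x‖ₑ ^ 2 ∂μ := by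
  rw [eLpNorm_eq_lintegral_rpow_enorm_toReal two_ne_zero ENNReal.ofNat_ne_top,
    ← ENNReal.rpow_natCast, ← ENNReal.rpow_mul]
  simp

/-- The `L²` norm of a function on the cross-section at `x₁ = s`. -/
def sliceNorm (Ω₀ : Set Plane) (f : Space → ℝ) (s : ℝ) : ℝ≥0∞ :=
  eLpNorm (fun y : Plane => f (s, y)) 2 (volume.restrict Ω₀)

lemma sliceNorm_sq (f : Space → ℝ) (s : ℝ) :
    sliceNorm Ω₀ f s ^ 2 = ∫⁻ y in Ω₀, ‖f (s, y)‖ₑ ^ 2 := eLpNorm_two_sq _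

lemma sliceNorm_eq_rpow (f : Space → ℝ) (s : ℝ) :
    sliceNorm Ω₀ f s = (∫⁻ y in Ω₀, ‖f (s, y)‖ₑ ^ 2) ^ (1 / 2 : ℝ) := by
  rw [← sliceNorm_sq, ← ENNReal.rpow_natCast, ← ENNReal.rpow_mul]
  simp

lemma aemeasurable_sliceNorm (hΩ₀ : IsSmoothBounded Ω₀) {f : Space → ℝ}
    (hf : AEStronglyMeasurable f (volume.restrict (channel Ω₀ l))) :
    AEMeasurable (sliceNorm Ω₀ f) (volume.restrict (Ioo 0 l)) := by
  have := isFiniteMeasure_section hΩ₀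
  rw [volume_restrict_channel] at hf
  simp_rw [funext (sliceNorm_eq_rpow (Ω₀ := Ω₀) f)]
  exact (hf.enorm.pow_const 2).lintegral_prod_right'.pow_const _

lemma measurable_sliceNorm (hΩ₀ : IsSmoothBounded Ω₀) {f : Space → ℝ} (hf : Measurable f) :
    Measurable (sliceNorm Ω₀ f) := by
  have := isFiniteMeasure_section hΩ₀
  simp_rw [funext (sliceNorm_eq_rpow (Ω₀ := Ω₀) f)]
  exact (hf.enorm.pow_const 2).lintegral_prod_right'.pow_const _

lemma lintegral_sliceNorm_sq (hΩ₀ : IsSmoothBounded Ω₀) {f : Space → ℝ}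
    (hf : AEStronglyMeasurable f (volume.restrict (channel Ω₀ l))) :
    ∫⁻ s in Ioo 0 l, sliceNorm Ω₀ f s ^ 2 = eLpNorm f 2 (volume.restrict (channel Ω₀ l)) ^ 2 := by
  have := isFiniteMeasure_section hΩ₀
  rw [eLpNorm_two_sq]
  rw [volume_restrict_channel] at hf ⊢
  rw [lintegral_prod _ (hf.enorm.pow_const 2)]
  simp_rw [sliceNorm_sq]

lemma ae_aestronglyMeasurable_slice (hΩ₀ : IsSmoothBounded Ω₀) {f : Space → ℝ}
    (hf : AEStronglyMeasurable f (volume.restrict (channel Ω₀ l))) :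
    ∀ᵐ s ∂(volume.restrict (Ioo 0 l)),
      AEStronglyMeasurable (fun y => f (s, y)) (volume.restrict Ω₀) := by
  have := isFiniteMeasure_section hΩ₀
  rw [volume_restrict_channel] at hf
  exact hf.prodMk_left

lemma sliceNorm_congr (hΩ₀ : IsSmoothBounded Ω₀) {f g : Space → ℝ}
    (h : f =ᵐ[volume.restrict (channel Ω₀ l)] g) :
    sliceNorm Ω₀ f =ᵐ[volume.restrict (Ioo 0 l)] sliceNorm Ω₀ g := by
  have := isFiniteMeasure_section hΩ₀
  rw [volume_restrict_channel] at h
  filter_upwards [Measure.ae_ae_of_ae_prod h] with s hs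
  exact eLpNorm_congr_ae hs

lemma ae_sliceNorm_lt_top (hΩ₀ : IsSmoothBounded Ω₀) {f : Space → ℝ}
    (hf : MemLp f 2 (volume.restrict (channel Ω₀ l))) :
    ∀ᵐ s ∂(volume.restrict (Ioo 0 l)), sliceNorm Ω₀ f s < ⊤ := by
  have h1 : ∫⁻ s in Ioo 0 l, sliceNorm Ω₀ f s ^ 2 ≠ ⊤ := by
    rw [lintegral_sliceNorm_sq hΩ₀ hf.1]
    exact ENNReal.pow_ne_top hf.2.ne
  filter_upwards [ae_lt_top' ((aemeasurable_sliceNorm hΩ₀ hf.1).pow_const 2) h1] with s hs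
  exact lt_top_iff_ne_top.2 fun h => by simp [h] at hs

/-- The norm of `L¹((0, l), L²(Ω₀))`. -/
def mixedNorm (Ω₀ : Set Plane) (l : ℝ) (f : Space → ℝ) : ℝ≥0∞ :=
  ∫⁻ s in Ioo 0 l, sliceNorm Ω₀ f s

lemma mixedNorm_le (hΩ₀ : IsSmoothBounded Ω₀) {f : Space → ℝ}
    (hf : AEStronglyMeasurable f (volume.restrict (channel Ω₀ l))) :
    mixedNorm Ω₀ l f ≤
      ENNReal.ofReal l ^ (1 / 2 : ℝ) * eLpNorm f 2 (volume.restrict (channel Ω₀ l)) := by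
  have h := ENNReal.lintegral_mul_le_Lp_mul_Lq (volume.restrict (Ioo 0 l))
    Real.HolderConjugate.two_two (aemeasurable_sliceNorm hΩ₀ hf)
    (aemeasurable_const (b := (1 : ℝ≥0∞)))
  simp only [Pi.mul_apply, mul_one, ENNReal.one_rpow, lintegral_const, Measure.restrict_apply_univ,
    one_mul, Real.volume_Ioo, sub_zero] at h
  rw [mixedNorm, mul_comm]
  refine h.trans_eq ?_
  congr 1
  have h2 := lintegral_sliceNorm_sq hΩ₀ hf
  have h3 : ∫⁻ s in Ioo 0 l, sliceNorm Ω₀ f s ^ (2 : ℝ) =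
      ∫⁻ s in Ioo 0 l, sliceNorm Ω₀ f s ^ 2 := by
    simp_rw [← ENNReal.rpow_natCast]; rfl
  rw [h3, h2, ← ENNReal.rpow_natCast, ← ENNReal.rpow_mul]
  simp

lemma mixedNorm_add_le (hΩ₀ : IsSmoothBounded Ω₀) {f g : Space → ℝ}
    (hf : AEStronglyMeasurable f (volume.restrict (channel Ω₀ l)))
    (hg : AEStronglyMeasurable g (volume.restrict (channel Ω₀ l))) :
    mixedNorm Ω₀ l (f + g) ≤ mixedNorm Ω₀ l f + mixedNorm Ω₀ l g := by
  rw [mixedNorm, mixedNorm, mixedNorm, ← lintegral_add_left' (aemeasurable_sliceNorm hΩ₀ hf)]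
  refine lintegral_mono_ae ?_
  filter_upwards [ae_aestronglyMeasurable_slice hΩ₀ hf, ae_aestronglyMeasurable_slice hΩ₀ hg]
    with s h1 h2
  exact eLpNorm_add_le h1 h2 one_le_two

lemma mixedNorm_const_smul (a : ℝ) (f : Space → ℝ) :
    mixedNorm Ω₀ l (a • f) = ‖a‖ₑ * mixedNorm Ω₀ l f := by
  rw [mixedNorm, mixedNorm, ← lintegral_const_mul' _ _ (by simp)]
  refine lintegral_congr fun s => ?_
  exact eLpNorm_const_smul a (fun y => f (s, y)) 2 _

lemma mixedNorm_congr (hΩ₀ : IsSmoothBounded Ω₀) {f g : Space → ℝ}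
    (h : f =ᵐ[volume.restrict (channel Ω₀ l)] g) : mixedNorm Ω₀ l f = mixedNorm Ω₀ l g :=
  lintegral_congr_ae (sliceNorm_congr hΩ₀ h)

lemma mixedNorm_lt_top (hΩ₀ : IsSmoothBounded Ω₀) {f : Space → ℝ}
    (hf : MemLp f 2 (volume.restrict (channel Ω₀ l))) : mixedNorm Ω₀ l f < ⊤ :=
  (mixedNorm_le hΩ₀ hf.1).trans_lt
    (ENNReal.mul_lt_top (ENNReal.rpow_lt_top_of_nonneg (by norm_num) (by simp)) hf.2)

lemma eLpNorm_le_of_sliceNorm_le (hΩ₀ : IsSmoothBounded Ω₀) {f : Space → ℝ}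
    (hf : AEStronglyMeasurable f (volume.restrict (channel Ω₀ l))) {Y : ℝ≥0∞}
    (hY : ∀ᵐ s ∂(volume.restrict (Ioo 0 l)), sliceNorm Ω₀ f s ≤ Y) :
    eLpNorm f 2 (volume.restrict (channel Ω₀ l)) ≤ ENNReal.ofReal l ^ (1 / 2 : ℝ) * Y := by
  have h1 : eLpNorm f 2 (volume.restrict (channel Ω₀ l)) ^ 2 ≤ ENNReal.ofReal l * Y ^ 2 := by
    rw [← lintegral_sliceNorm_sq hΩ₀ hf]
    calc _ ≤ ∫⁻ _ in Ioo 0 l, Y ^ 2 := by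
          apply lintegral_mono_ae
          filter_upwards [hY] with s hs
          gcongr
      _ = _ := by rw [setLIntegral_const, Real.volume_Ioo, sub_zero, mul_comm]
  rw [← ENNReal.pow_le_pow_left_iff two_ne_zero]
  refine h1.trans_eq ?_
  rw [mul_pow, ← ENNReal.rpow_natCast (ENNReal.ofReal l ^ (1 / 2 : ℝ)), ← ENNReal.rpow_mul]
  simp

/-! ### Bounds for test functions -/

lemma exists_bound_channel (hΩ₀ : IsSmoothBounded Ω₀) (l : ℝ) {f : Space → ℝ} (hf : Continuous f) :
    ∃ B : ℝ≥0, ∀ s ∈ Icc 0 l, ∀ y ∈ Ω₀, |f (s, y)| ≤ B := by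
  obtain ⟨B, hB⟩ := (isCompact_Icc.prod hΩ₀.bounded.isCompact_closure :
    IsCompact (Icc 0 l ×ˢ closure Ω₀)).exists_bound_of_continuousOn hf.continuousOn
  exact ⟨B.toNNReal, fun s hs y hy =>
    (hB (s, y) ⟨hs, subset_closure hy⟩).trans (Real.le_coe_toNNReal B)⟩

lemma memLp_slice (hΩ₀ : IsSmoothBounded Ω₀) {f : Space → ℝ} (hf : Measurable f) {B s : ℝ}
    (hB : ∀ y ∈ Ω₀, |f (s, y)| ≤ B) : MemLp (fun y => f (s, y)) 2 (volume.restrict Ω₀) := by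
  have := isFiniteMeasure_section hΩ₀
  refine MemLp.of_bound (hf.comp (by fun_prop)).aestronglyMeasurable B ?_
  filter_upwards [ae_restrict_mem hΩ₀.isOpen.measurableSet] with y hy using hB y hy

lemma IsTransportField.exists_bound_transportOp (hΩ₀ : IsSmoothBounded Ω₀)
    (hb : IsTransportField Ω₀ l b c L c₀) {φ : Space → ℝ} (hφ : ContDiff ℝ 1 φ) :
    ∃ B : ℝ≥0, ∀ s ∈ Icc 0 l, ∀ y ∈ Ω₀, |transportOp b c φ (s, y)| ≤ B := by
  obtain ⟨A, hA⟩ := exists_bound_channel hΩ₀ l hφ.continuous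
  have hk : ∀ k, Continuous (partialD k φ) := fun k =>
    (hφ.continuous_fderiv (by simp)).clm_apply continuous_const
  choose B hB using fun k => exists_bound_channel hΩ₀ l (hk k)
  refine ⟨6 * (∑ k, B k) + c₀ * A, fun s hs y hy => ?_⟩
  push_cast
  refine hb.abs_transportOp_le (fun k => (hB k s hs y hy).trans ?_) (hA s hs y hy)
  exact Finset.single_le_sum (f := fun k => (B k : ℝ)) (fun i _ => (B i).2) (Finset.mem_univ k)

lemma IsTransportField.memLp_transportOp (hΩ₀ : IsSmoothBounded Ω₀)
    (hb : IsTransportField Ω₀ l b c L c₀) {φ : Space → ℝ} (hφ : ContDiff ℝ 1 φ) :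
    MemLp (transportOp b c φ) 2 (volume.restrict (channel Ω₀ l)) := by
  have := isFiniteMeasure_channel hΩ₀ l
  obtain ⟨B, hB⟩ := hb.exists_bound_transportOp hΩ₀ hφ
  refine MemLp.of_bound (hb.measurable_transportOp hφ.continuous.measurable).aestronglyMeasurable
    B ?_
  filter_upwards [ae_restrict_mem (isOpen_channel hΩ₀ l).measurableSet] with x hx
  exact hB x.1 ⟨hx.1.1.le, hx.1.2.le⟩ x.2 hx.2

lemma memLp_of_continuous (hΩ₀ : IsSmoothBounded Ω₀) {φ : Space → ℝ} (hφ : Continuous φ) :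
    MemLp φ 2 (volume.restrict (channel Ω₀ l)) := by
  have := isFiniteMeasure_channel hΩ₀ l
  obtain ⟨B, hB⟩ := exists_bound_channel hΩ₀ l hφ
  refine MemLp.of_bound hφ.aestronglyMeasurable B ?_
  filter_upwards [ae_restrict_mem (isOpen_channel hΩ₀ l).measurableSet] with x hx
  exact hB x.1 ⟨hx.1.1.le, hx.1.2.le⟩ x.2 hx.2

/-! ### The energy estimate -/

/-- The energy estimate for test functions vanishing on the outflow part. -/
theorem IsTransportField.sliceNorm_le (hΩ₀ : IsSmoothBounded Ω₀)
    (hb : IsTransportField Ω₀ l b c L c₀) (hc₀ : c₀ * l ≤ 1 / 4) {φ : Space → ℝ}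
    (hφ : ContDiff ℝ 1 φ) (hφl : ∀ y ∈ Ω₀, φ (l, y) = 0) {t : ℝ} (ht : t ∈ Icc 0 l) :
    sliceNorm Ω₀ φ t ≤ 8 * mixedNorm Ω₀ l (transportOp b c φ) := by
  have := isFiniteMeasure_section hΩ₀
  have hm := hΩ₀.isOpen.measurableSet
  have hl : 0 ≤ l := ht.1.trans ht.2
  set G := transportOp b c φ with hG
  have hGm : Measurable G := hb.measurable_transportOp hφ.continuous.measurable
  obtain ⟨A, hA⟩ := exists_bound_channel hΩ₀ l hφ.continuous
  obtain ⟨B, hB⟩ := hb.exists_bound_transportOp hΩ₀ hφ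
  have hφL : ∀ s ∈ Icc 0 l, MemLp (fun y => φ (s, y)) 2 (volume.restrict Ω₀) := fun s hs =>
    memLp_slice hΩ₀ hφ.continuous.measurable (hA s hs)
  have hGL : ∀ s ∈ Icc 0 l, MemLp (fun y => G (s, y)) 2 (volume.restrict Ω₀) := fun s hs =>
    memLp_slice hΩ₀ hGm (hB s hs)
  set y : ℝ → ℝ := fun s => (sliceNorm Ω₀ φ s).toReal with hy
  set n : ℝ → ℝ := fun s => (sliceNorm Ω₀ G s).toReal with hn
  have hGt := mixedNorm_lt_top hΩ₀ (hb.memLp_transportOp hΩ₀ hφ)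
  have hnm : AEMeasurable (sliceNorm Ω₀ G) (volume.restrict (Ioo 0 l)) :=
    (measurable_sliceNorm hΩ₀ hGm).aemeasurable
  have hni : IntegrableOn n (Ioo 0 l) := integrable_toReal_of_lintegral_ne_top hnm hGt.ne
  set N := (mixedNorm Ω₀ l G).toReal with hN
  have hNn : ∫ s in Ioo 0 l, n s = N := by
    rw [hN, hn, integral_toReal hnm (ae_sliceNorm_lt_top hΩ₀ (hb.memLp_transportOp hΩ₀ hφ))]; rfl
  have hy2 : ∀ s ∈ Icc 0 l, ∫ z in Ω₀, φ (s, z) ^ 2 = y s ^ 2 := fun s hs =>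
    integral_sq_eq (hφL s hs)
  -- the supremum of the slice norms
  have hbd : BddAbove (y '' Icc 0 l) := by
    set C := (volume.restrict Ω₀).real univ with hC
    refine ⟨1 + A ^ 2 * C, ?_⟩
    rintro _ ⟨s, hs, rfl⟩
    have h1 : y s ^ 2 ≤ A ^ 2 * C := by
      rw [← hy2 s hs]
      refine (Real.le_norm_self _).trans ((norm_setIntegral_le_of_norm_le_const
        hΩ₀.bounded.measure_lt_top (C := (A : ℝ) ^ 2) (fun z hz => ?_)).trans_eq ?_)
      · rw [norm_pow]
        exact pow_le_pow_left₀ (norm_nonneg _) (hA s hs z hz) 2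
      · simp [hC]
    nlinarith [sq_nonneg (y s - 1)]
  -- The argument closes on the supremum, without Gronwall's inequality, because c₀ l ≤ 1/4.
  set Y := sSup (y '' Icc 0 l) with hY
  have hyY : ∀ s ∈ Icc 0 l, y s ≤ Y := fun s hs => le_csSup hbd ⟨s, hs, rfl⟩
  have hy0 : ∀ s, 0 ≤ y s := fun s => ENNReal.toReal_nonneg
  have hn0 : ∀ s, 0 ≤ n s := fun s => ENNReal.toReal_nonneg
  have hY0 : 0 ≤ Y := (hy0 t).trans (hyY t ht)
  have hN0 : 0 ≤ N := ENNReal.toReal_nonneg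
  -- b·∇(φ²) = 2φ(Gφ - cφ), so the term cφ² of G(φ²) changes its sign.
  have hop : ∀ x, transportOp b c (fun x => φ x ^ 2) x = 2 * (φ x * G x) - c x * φ x ^ 2 := by
    intro x
    have h1 : ∀ k, partialD k (fun x => φ x ^ 2) x = 2 * φ x * partialD k φ x := by
      intro k
      have h2 : (fun x => φ x ^ 2) = fun x => φ x * φ x := by ext x; ring
      have hd := (hφ.differentiable (by simp)) x
      rw [partialD, h2, fderiv_fun_mul hd hd]
      simp [partialD]; ring
    simp only [hG, transportOp, h1, Fin.sum_univ_three]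
    ring
  -- Between s and l the slice identity equates the integral of b⁰φ² at s with minus that of 2φGφ -
  -- cφ². With b⁰ ≥ 1/2 this gives y(s)²/2 ≤ 2YN + c₀ l Y².
  have hineq : ∀ s ∈ Icc 0 l, y s ^ 2 ≤ 4 * Y * N + Y ^ 2 / 2 := by
    intro s hs
    have key := hb.slice_identity hΩ₀ (hφ.pow 2) hs.1 hs.2 le_rfl
    have e0 : ∫ z in Ω₀, b 0 (l, z) * φ (l, z) ^ 2 = 0 := by
      rw [setIntegral_congr_fun hm (g := fun _ => 0) fun z hz => by simp [hφl z hz]]; simp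
    rw [e0, zero_sub] at key
    have e1 : y s ^ 2 / 2 ≤ ∫ z in Ω₀, b 0 (s, z) * φ (s, z) ^ 2 := by
      rw [← hy2 s hs, ← integral_div]
      refine integral_mono ((integrable_slice_of_continuous hΩ₀ (hφ.continuous.pow 2) s).div_const 2)
        (integrable_slice_of_continuous hΩ₀ (((hb.lip 0).continuous).mul (hφ.continuous.pow 2)) s)
        fun z => ?_
      have := hb.half_le (s, z)
      have h2 := sq_nonneg (φ (s, z))
      simp only
      nlinarith
    have e2 : |∫ τ in Ioo s l, ∫ z in Ω₀, transportOp b c (fun x => φ x ^ 2) (τ, z)| ≤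
        ∫ τ in Ioo s l, (2 * (Y * n τ) + c₀ * Y ^ 2) := by
      have hnis : IntegrableOn n (Ioo s l) := hni.mono_set (Ioo_subset_Ioo_left hs.1)
      rw [← Real.norm_eq_abs]
      refine norm_integral_le_of_norm_le (g := fun τ => 2 * (Y * n τ) + c₀ * Y ^ 2)
        (((hnis.const_mul Y).const_mul 2).add (integrable_const _)) ?_
      filter_upwards [ae_restrict_mem measurableSet_Ioo] with τ hτ
      have hτ' : τ ∈ Icc 0 l := ⟨hs.1.trans hτ.1.le, hτ.2.le⟩
      simp_rw [hop]
      have i1 : Integrable (fun z => φ (τ, z) * G (τ, z)) (volume.restrict Ω₀) :=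
        (hφL τ hτ').integrable_mul (hGL τ hτ')
      have i3 : Integrable (fun z => φ (τ, z) ^ 2) (volume.restrict Ω₀) := (hφL τ hτ').integrable_sq
      have i2 : Integrable (fun z => c (τ, z) * φ (τ, z) ^ 2) (volume.restrict Ω₀) :=
        i3.bdd_mul (hb.measurable_div.comp (by fun_prop)).aestronglyMeasurable
          (Eventually.of_forall fun z => hb.abs_div_le _)
      rw [integral_sub (i1.const_mul 2) i2, integral_const_mul]
      have f1 : |∫ z in Ω₀, φ (τ, z) * G (τ, z)| ≤ Y * n τ :=
        (abs_integral_mul_le (hφL τ hτ') (hGL τ hτ')).trans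
          (mul_le_mul_of_nonneg_right (hyY τ hτ') (hn0 τ))
      have f2 : |∫ z in Ω₀, c (τ, z) * φ (τ, z) ^ 2| ≤ c₀ * Y ^ 2 := by
        rw [← Real.norm_eq_abs]
        refine (norm_integral_le_of_norm_le (i3.const_mul (c₀ : ℝ))
          (Eventually.of_forall fun z => ?_)).trans ?_
        · rw [norm_mul, Real.norm_of_nonneg (sq_nonneg (φ (τ, z)))]
          exact mul_le_mul_of_nonneg_right (hb.abs_div_le _) (sq_nonneg _)
        · rw [integral_const_mul, hy2 τ hτ']
          gcongr
          exact hyY τ hτ'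
      refine (norm_sub_le _ _).trans ?_
      rw [norm_mul, Real.norm_eq_abs, Real.norm_eq_abs, Real.norm_eq_abs, abs_two]
      linarith
    have e3 : ∫ τ in Ioo s l, (2 * (Y * n τ) + c₀ * Y ^ 2) ≤ 2 * (Y * N) + Y ^ 2 / 4 := by
      have hsub : Ioo s l ⊆ Ioo 0 l := Ioo_subset_Ioo_left hs.1
      calc _ ≤ ∫ τ in Ioo 0 l, (2 * (Y * n τ) + c₀ * Y ^ 2) := by
            refine setIntegral_mono_set (((hni.const_mul Y).const_mul 2).add (integrable_const _))
              (Eventually.of_forall fun τ => ?_) hsub.eventuallyLE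
            have := hn0 τ
            simp only [Pi.zero_apply]; positivity
        _ = 2 * (Y * N) + c₀ * l * Y ^ 2 := by
            rw [integral_add ((hni.const_mul Y).const_mul 2) (integrable_const _),
              integral_const_mul, integral_const_mul, hNn]
            simp [hl]; ring
        _ ≤ _ := by nlinarith [sq_nonneg Y]
    have e4 := neg_le_of_abs_le (e2.trans e3)
    linarith
  have hYN : Y ≤ 8 * N := by
    have h1 : Y ^ 2 ≤ 4 * Y * N + Y ^ 2 / 2 := by
      have h2 : Y ≤ Real.sqrt (4 * Y * N + Y ^ 2 / 2) := by
        refine csSup_le ⟨_, t, ht, rfl⟩ ?_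
        rintro _ ⟨s, hs, rfl⟩
        exact Real.le_sqrt_of_sq_le (hineq s hs)
      exact (Real.le_sqrt hY0 (by positivity)).1 h2
    by_contra hcon
    push Not at hcon
    nlinarith
  have hfin : sliceNorm Ω₀ φ t ≠ ⊤ := (hφL t ht).2.ne
  rw [← ENNReal.toReal_le_toReal hfin (ENNReal.mul_ne_top (by simp) hGt.ne), ENNReal.toReal_mul]
  exact (hyY t ht).trans hYN

/-! ### Existence by duality -/

/-- The test functions: of class `C¹`, vanishing on the outflow part. -/
def testSpace (Ω₀ : Set Plane) (l : ℝ) : Submodule ℝ (Space → ℝ) where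
  carrier := {φ | ContDiff ℝ 1 φ ∧ ∀ y ∈ Ω₀, φ (l, y) = 0}
  add_mem' := fun h1 h2 => ⟨h1.1.add h2.1, fun y hy => by simp [h1.2 y hy, h2.2 y hy]⟩
  zero_mem' := ⟨contDiff_const, fun _ _ => rfl⟩
  smul_mem' := fun a _ h => ⟨contDiff_const.smul h.1, fun y hy => by simp [h.2 y hy]⟩

lemma transportOp_add {φ ψ : Space → ℝ} (hφ : ContDiff ℝ 1 φ) (hψ : ContDiff ℝ 1 ψ) :
    transportOp b c (φ + ψ) = transportOp b c φ + transportOp b c ψ := by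
  ext x
  have h1 : ∀ k, partialD k (φ + ψ) x = partialD k φ x + partialD k ψ x := by
    intro k
    rw [partialD, fderiv_add ((hφ.differentiable (by simp)) x) ((hψ.differentiable (by simp)) x)]
    rfl
  simp only [transportOp, h1, Fin.sum_univ_three, Pi.add_apply]
  ring

lemma transportOp_smul (a : ℝ) {φ : Space → ℝ} (hφ : ContDiff ℝ 1 φ) :
    transportOp b c (a • φ) = a • transportOp b c φ := by
  ext x
  have h1 : ∀ k, partialD k (a • φ) x = a * partialD k φ x := by
    intro k
    rw [partialD, fderiv_const_smul ((hφ.differentiable (by simp)) x)]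
    rfl
  simp only [transportOp, h1, Fin.sum_univ_three, Pi.smul_apply, smul_eq_mul]
  ring

/-- The transport operator as a map from test functions to `L²`. -/
def transportMap (hΩ₀ : IsSmoothBounded Ω₀) (hb : IsTransportField Ω₀ l b c L c₀) :
    testSpace Ω₀ l →ₗ[ℝ] Lp ℝ 2 (volume.restrict (channel Ω₀ l) : Measure Space) where
  toFun φ := (hb.memLp_transportOp hΩ₀ φ.2.1).toLp _
  map_add' φ ψ := by
    rw [← MemLp.toLp_add]
    congr 1
    exact transportOp_add φ.2.1 ψ.2.1
  map_smul' a φ := by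
    rw [RingHom.id_apply, ← MemLp.toLp_const_smul]
    congr 1
    exact transportOp_smul a φ.2.1

lemma memLp_inflow (hΩ₀ : IsSmoothBounded Ω₀) (hl : 0 ≤ l) {φ : Space → ℝ} (hφ : Continuous φ) :
    MemLp (fun y => φ (0, y)) 2 (volume.restrict Ω₀) := by
  obtain ⟨A, hA⟩ := exists_bound_channel hΩ₀ l hφ
  exact memLp_slice hΩ₀ hφ.measurable (hA 0 ⟨le_rfl, hl⟩)

lemma IsTransportField.memLp_inflow_data
    (hb : IsTransportField Ω₀ l b c L c₀) {w : Plane → ℝ} (hw : MemLp w 2 (volume.restrict Ω₀)) :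
    MemLp (fun y => b 0 (0, y) * w y) 2 (volume.restrict Ω₀) :=
  hw.of_le_mul (c := 2)
    (((hb.measurable 0).comp (by fun_prop)).aestronglyMeasurable.mul hw.1)
    (Eventually.of_forall fun y => by
      rw [norm_mul]
      exact mul_le_mul_of_nonneg_right (hb.abs_le 0 _) (norm_nonneg _))

lemma IsTransportField.eLpNorm_inflow_data_le
    (hb : IsTransportField Ω₀ l b c L c₀) (w : Plane → ℝ) :
    eLpNorm (fun y => b 0 (0, y) * w y) 2 (volume.restrict Ω₀) ≤
      2 * eLpNorm w 2 (volume.restrict Ω₀) := by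
  refine (eLpNorm_le_mul_eLpNorm_of_ae_le_mul (c := 2) (g := w)
    (Eventually.of_forall fun y => ?_) 2).trans_eq
    (by simp)
  rw [norm_mul]
  exact mul_le_mul_of_nonneg_right (hb.abs_le 0 _) (norm_nonneg _)

/-- The functional given by the data. -/
def dataFunctional (hΩ₀ : IsSmoothBounded Ω₀) (hl : 0 ≤ l) (hb : IsTransportField Ω₀ l b c L c₀)
    {h : Space → ℝ} {w : Plane → ℝ} (hh : MemLp h 2 (volume.restrict (channel Ω₀ l)))
    (hw : MemLp w 2 (volume.restrict Ω₀)) : testSpace Ω₀ l →ₗ[ℝ] ℝ where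
  toFun φ := (∫ x in channel Ω₀ l, φ.1 x * h x) + ∫ y in Ω₀, φ.1 (0, y) * (b 0 (0, y) * w y)
  map_add' φ ψ := by
    have i1 := fun φ : testSpace Ω₀ l =>
      (memLp_of_continuous (l := l) hΩ₀ φ.2.1.continuous).integrable_mul hh
    have i2 := fun φ : testSpace Ω₀ l =>
      (memLp_inflow hΩ₀ hl φ.2.1.continuous).integrable_mul (hb.memLp_inflow_data hw)
    have e1 := integral_add (i1 φ) (i1 ψ)
    have e2 := integral_add (i2 φ) (i2 ψ)
    simp only [Pi.mul_apply, ← add_mul] at e1 e2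
    simp only [Submodule.coe_add, Pi.add_apply]
    rw [e1, e2]; ring
  map_smul' a φ := by
    simp only [Submodule.coe_smul, Pi.smul_apply, smul_eq_mul, mul_assoc, integral_const_mul,
      RingHom.id_apply]
    ring

/-- The constant of the a priori estimate. -/
def estimateConst (l : ℝ) : ℝ≥0 := 8 * NNReal.sqrt l.toNNReal + 16

lemma ofReal_rpow_half (l : ℝ) :
    ENNReal.ofReal l ^ (1 / 2 : ℝ) = (NNReal.sqrt l.toNNReal : ℝ≥0∞) := by
  rw [NNReal.sqrt_eq_rpow, ENNReal.coe_rpow_of_nonneg _ (by norm_num)]; rfl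

lemma abs_dataFunctional_le (hΩ₀ : IsSmoothBounded Ω₀) (hl : 0 ≤ l)
    (hb : IsTransportField Ω₀ l b c L c₀) (hc₀ : c₀ * l ≤ 1 / 4)
    {h : Space → ℝ} {w : Plane → ℝ} (hh : MemLp h 2 (volume.restrict (channel Ω₀ l)))
    (hw : MemLp w 2 (volume.restrict Ω₀)) (φ : testSpace Ω₀ l) :
    |dataFunctional hΩ₀ hl hb hh hw φ| ≤ (estimateConst l * (eLpNorm w 2 (volume.restrict Ω₀) +
      eLpNorm h 2 (volume.restrict (channel Ω₀ l)))).toReal *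
      (mixedNorm Ω₀ l (transportOp b c φ)).toReal := by
  set N := mixedNorm Ω₀ l (transportOp b c φ) with hN
  have hNt : N ≠ ⊤ := (mixedNorm_lt_top hΩ₀ (hb.memLp_transportOp hΩ₀ φ.2.1)).ne
  have hE := fun t ht => hb.sliceNorm_le hΩ₀ hc₀ φ.2.1 φ.2.2 (t := t) ht
  have hφ2 := memLp_of_continuous (l := l) hΩ₀ φ.2.1.continuous
  have e1 : eLpNorm φ.1 2 (volume.restrict (channel Ω₀ l)) ≤ NNReal.sqrt l.toNNReal * (8 * N) := by
    rw [← ofReal_rpow_half]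
    apply eLpNorm_le_of_sliceNorm_le hΩ₀ hφ2.1
    filter_upwards [ae_restrict_mem measurableSet_Ioo] with s hs using hE s ⟨hs.1.le, hs.2.le⟩
  have e2 : eLpNorm (fun y => φ.1 (0, y)) 2 (volume.restrict Ω₀) ≤ 8 * N := hE 0 ⟨le_rfl, hl⟩
  have a1 := abs_integral_mul_le hφ2 hh
  have a2 := abs_integral_mul_le (memLp_inflow hΩ₀ hl φ.2.1.continuous) (hb.memLp_inflow_data hw)
  have e3 := hb.eLpNorm_inflow_data_le w
  set A := eLpNorm w 2 (volume.restrict Ω₀) with hA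
  set H := eLpNorm h 2 (volume.restrict (channel Ω₀ l)) with hH
  have hAt : A ≠ ⊤ := hw.2.ne
  have hHt : H ≠ ⊤ := hh.2.ne
  have e1' := ENNReal.toReal_mono (by finiteness) e1
  have e2' := ENNReal.toReal_mono (by finiteness) e2
  have e3' := ENNReal.toReal_mono (by finiteness) e3
  simp only [ENNReal.toReal_mul, ENNReal.coe_toReal, ENNReal.toReal_ofNat] at e1' e2' e3'
  rw [ENNReal.toReal_mul, ENNReal.toReal_add hAt hHt, ENNReal.coe_toReal, estimateConst]
  push_cast
  have hN0 : 0 ≤ N.toReal := ENNReal.toReal_nonneg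
  have hA0 : 0 ≤ A.toReal := ENNReal.toReal_nonneg
  have hH0 : 0 ≤ H.toReal := ENNReal.toReal_nonneg
  have hs0 : 0 ≤ Real.sqrt (l.toNNReal : ℝ) := Real.sqrt_nonneg _
  -- The volume term gives 8√l, since ‖φ‖ ≤ √l · 8N; the inflow term gives 16, a factor 8 from the
  -- energy estimate at 0 and a factor 2 from |b⁰| ≤ 2.
  have b1 := a1.trans (mul_le_mul_of_nonneg_right e1' hH0)
  have b2 := a2.trans (mul_le_mul e2' e3' ENNReal.toReal_nonneg (by positivity))
  refine (abs_add_le _ _).trans ((add_le_add b1 b2).trans ?_)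
  rw [Real.coe_sqrt]
  have p1 := mul_nonneg (mul_nonneg hs0 hA0) hN0
  have p2 := mul_nonneg hH0 hN0
  nlinarith

/-- A function whose pairing with `L²` is controlled by the mixed norm is bounded in
`L_∞((0, l), L²(Ω₀))`. -/
lemma ae_sliceNorm_le_of_integral_le (hΩ₀ : IsSmoothBounded Ω₀) {w : Space → ℝ} (hwm : Measurable w)
    (hw : MemLp w 2 (volume.restrict (channel Ω₀ l))) {M : ℝ} (hM : 0 ≤ M)
    (H : ∀ g : Space → ℝ, MemLp g 2 (volume.restrict (channel Ω₀ l)) →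
      ∫ x in channel Ω₀ l, w x * g x ≤ M * (mixedNorm Ω₀ l g).toReal) :
    ∀ᵐ s ∂(volume.restrict (Ioo 0 l)), sliceNorm Ω₀ w s ≤ ENNReal.ofReal M := by
  set A : Set ℝ := {s | ENNReal.ofReal M < sliceNorm Ω₀ w s} with hA
  have hnm := measurable_sliceNorm hΩ₀ hwm
  have hAm : MeasurableSet A := measurableSet_lt measurable_const hnm
  -- Testing with w cut down to the slices in A gives ∫_A n² ≤ M ∫_A n for the slice norm n. As n >
  -- M on A, the set A ∩ (0, l) is null.
  set g : Space → ℝ := (A ×ˢ univ).indicator w with hg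
  have hgm : MemLp g 2 (volume.restrict (channel Ω₀ l)) := hw.indicator (hAm.prod .univ)
  have hgs : sliceNorm Ω₀ g = A.indicator (sliceNorm Ω₀ w) := by
    ext s
    by_cases hs : s ∈ A
    · rw [indicator_of_mem hs]
      simp [sliceNorm, hg, hs]
    · rw [indicator_of_notMem hs]
      simp [sliceNorm, hg, hs]
  have h1 : ∫ x in channel Ω₀ l, w x * g x = ∫ x in channel Ω₀ l, g x ^ 2 := by
    congr 1; ext x
    by_cases hx : x ∈ A ×ˢ (univ : Set Plane)
    · simp only [hg, indicator_of_mem hx]; ring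
    · simp only [hg, indicator_of_notMem hx]; ring
  have h2 : ENNReal.ofReal (∫ x in channel Ω₀ l, g x ^ 2) =
      ∫⁻ s in Ioo 0 l, sliceNorm Ω₀ g s ^ 2 := by
    rw [integral_sq_eq hgm, lintegral_sliceNorm_sq hΩ₀ hgm.1,
      ENNReal.ofReal_pow ENNReal.toReal_nonneg, ENNReal.ofReal_toReal hgm.2.ne]
  have hgt := mixedNorm_lt_top hΩ₀ hgm
  have h3 : ∫⁻ s in Ioo 0 l, sliceNorm Ω₀ g s ^ 2 ≤
      ∫⁻ s in Ioo 0 l, ENNReal.ofReal M * sliceNorm Ω₀ g s := by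
    rw [← h2, ← h1, lintegral_const_mul' _ _ ENNReal.ofReal_ne_top]
    refine (ENNReal.ofReal_le_ofReal (H g hgm)).trans_eq ?_
    rw [ENNReal.ofReal_mul hM, ENNReal.ofReal_toReal hgt.ne]; rfl
  have h4 : ∀ s, ENNReal.ofReal M * sliceNorm Ω₀ g s ≤ sliceNorm Ω₀ g s ^ 2 := by
    intro s
    rw [hgs, sq]
    by_cases hs : s ∈ A
    · rw [indicator_of_mem hs]
      exact mul_le_mul_left (le_of_lt hs) _
    · rw [indicator_of_notMem hs]; simp
  have h5 := ae_eq_of_ae_le_of_lintegral_le (Eventually.of_forall h4)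
    (by rw [lintegral_const_mul' _ _ ENNReal.ofReal_ne_top]
        exact ENNReal.mul_ne_top ENNReal.ofReal_ne_top hgt.ne)
    ((measurable_sliceNorm hΩ₀ (hwm.indicator (hAm.prod .univ))).pow_const 2).aemeasurable h3
  filter_upwards [h5, ae_sliceNorm_lt_top hΩ₀ hw] with s hs hst
  by_contra hcon
  have hsA : s ∈ A := not_le.1 hcon
  rw [hgs, indicator_of_mem hsA, sq] at hs
  have hpos : sliceNorm Ω₀ w s ≠ 0 := (zero_le.trans_lt (show ENNReal.ofReal M < _ from hsA)).ne'
  rw [ENNReal.mul_left_inj hpos hst.ne] at hs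
  exact (ne_of_lt (show ENNReal.ofReal M < _ from hsA)) hs

/-- A functional on the domain of a linear map into a Hilbert space that is controlled by a
sublinear functional of the image is represented by a vector with the same control. -/
lemma exists_inner_eq_of_le_sublinear {V E : Type*} [AddCommGroup V] [Module ℝ V]
    [NormedAddCommGroup E] [InnerProductSpace ℝ E] [CompleteSpace E] (T : V →ₗ[ℝ] E) (F : V →ₗ[ℝ] ℝ)
    (N : E → ℝ) (N_hom : ∀ a : ℝ, 0 < a → ∀ g, N (a • g) = a * N g)
    (N_add : ∀ f g, N (f + g) ≤ N f + N g) (C : ℝ) (hNC : ∀ g, N g ≤ C * ‖g‖)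
    (hFN : ∀ φ, |F φ| ≤ N (T φ)) :
    ∃ W : E, (∀ φ, inner ℝ W (T φ) = F φ) ∧ ∀ g, inner ℝ W g ≤ N g := by
  -- The control of F by the image under T lets F descend to the range of T.
  have hker : LinearMap.ker T ≤ LinearMap.ker F := by
    intro φ hφ
    have h1 := (hFN φ).trans (hNC _)
    rw [LinearMap.mem_ker.1 hφ, norm_zero, mul_zero] at h1
    exact LinearMap.mem_ker.2 (abs_nonpos_iff.1 h1)
  let P : E →ₗ.[ℝ] ℝ :=
    ⟨LinearMap.range T, ((LinearMap.ker T).liftQ F hker) ∘ₗ T.quotKerEquivRange.symm.toLinearMap⟩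
  have hP : ∀ φ, P ⟨T φ, LinearMap.mem_range_self T φ⟩ = F φ := by
    intro φ
    change ((LinearMap.ker T).liftQ F hker) (T.quotKerEquivRange.symm _) = F φ
    have : T.quotKerEquivRange.symm ⟨T φ, LinearMap.mem_range_self T φ⟩ =
        (LinearMap.ker T).mkQ φ := by
      rw [LinearEquiv.symm_apply_eq]
      ext1; rfl
    rw [this]; simp
  -- Extending under `N` rather than under the norm retains the finer control on all of E; the bound
  -- by C‖g‖ serves only to make the extension continuous.
  obtain ⟨Λ, hΛ1, hΛ2⟩ := exists_extension_of_le_sublinear P N N_hom N_add (by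
    rintro ⟨_, φ, rfl⟩
    rw [hP]
    exact (le_abs_self _).trans (hFN φ))
  let Λc := Λ.mkContinuous C (fun g => by
    rw [Real.norm_eq_abs, _root_.abs_le]
    constructor
    · have := (hΛ2 (-g)).trans (hNC (-g))
      rw [map_neg, norm_neg] at this
      linarith
    · exact (hΛ2 g).trans (hNC g))
  refine ⟨(InnerProductSpace.toDual ℝ E).symm Λc, fun φ => ?_, fun g => ?_⟩
  · rw [InnerProductSpace.toDual_symm_apply]
    exact (hΛ1 ⟨T φ, LinearMap.mem_range_self T φ⟩).trans (hP φ)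
  · rw [InnerProductSpace.toDual_symm_apply]
    exact hΛ2 g

/-- Existence of a weak solution with the a priori bound, by duality. -/
theorem IsTransportField.exists_weak_solution (hΩ₀ : IsSmoothBounded Ω₀) (hl : 0 ≤ l)
    (hb : IsTransportField Ω₀ l b c L c₀) (hc₀ : c₀ * l ≤ 1 / 4)
    {h : Space → ℝ} {w_in : Plane → ℝ} (hh : MemLp h 2 (volume.restrict (channel Ω₀ l)))
    (hw : MemLp w_in 2 (volume.restrict Ω₀)) :
    ∃ w : Space → ℝ, MemLp w 2 (volume.restrict (channel Ω₀ l)) ∧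
      (∀ φ : Space → ℝ, ContDiff ℝ 1 φ → (∀ y ∈ Ω₀, φ (l, y) = 0) →
        - ∫ x in channel Ω₀ l, w x * transportOp b c φ x =
          (∫ x in channel Ω₀ l, φ x * h x) + ∫ y in Ω₀, φ (0, y) * (b 0 (0, y) * w_in y)) ∧
      normLinfL2 Ω₀ l w ≤ estimateConst l * (eLpNorm w_in 2 (volume.restrict Ω₀) +
        eLpNorm h 2 (volume.restrict (channel Ω₀ l))) := by
  set D := estimateConst l * (eLpNorm w_in 2 (volume.restrict Ω₀) +
        eLpNorm h 2 (volume.restrict (channel Ω₀ l))) with hD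
  have hDt : D ≠ ⊤ :=
    ENNReal.mul_ne_top ENNReal.coe_ne_top (ENNReal.add_ne_top.2 ⟨hw.2.ne, hh.2.ne⟩)
  set T := transportMap hΩ₀ hb with hT
  set F := dataFunctional hΩ₀ hl hb hh hw with hF
  set N : Lp ℝ 2 (volume.restrict (channel Ω₀ l) : Measure Space) → ℝ :=
    fun g => D.toReal * (mixedNorm Ω₀ l g).toReal with hN
  have hNT : ∀ φ, N (T φ) = D.toReal * (mixedNorm Ω₀ l (transportOp b c φ)).toReal := by
    intro φ
    have h1 : T φ = (hb.memLp_transportOp hΩ₀ φ.2.1).toLp (transportOp b c φ) := rfl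
    simp only [hN]
    rw [h1, mixedNorm_congr hΩ₀ (hb.memLp_transportOp hΩ₀ φ.2.1).coeFn_toLp]
  have hFN : ∀ φ, |F φ| ≤ N (T φ) := fun φ => by
    rw [hNT]; exact abs_dataFunctional_le hΩ₀ hl hb hc₀ hh hw φ
  have hNle : ∀ g, N g ≤ D.toReal * NNReal.sqrt l.toNNReal * ‖g‖ := by
    intro g
    have h1 := mixedNorm_le hΩ₀ (Lp.aestronglyMeasurable g)
    rw [ofReal_rpow_half] at h1
    have h2 := ENNReal.toReal_mono (ENNReal.mul_ne_top ENNReal.coe_ne_top (Lp.eLpNorm_ne_top g)) h1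
    rw [ENNReal.toReal_mul, ← Lp.norm_def, ENNReal.coe_toReal] at h2
    simp only [hN]
    rw [mul_assoc]
    exact mul_le_mul_of_nonneg_left h2 ENNReal.toReal_nonneg
  have hNhom : ∀ a : ℝ, 0 < a → ∀ g, N (a • g) = a * N g := by
    intro a ha g
    simp only [hN]
    rw [mixedNorm_congr hΩ₀ (Lp.coeFn_smul a g), mixedNorm_const_smul, ENNReal.toReal_mul]
    simp [abs_of_pos ha]; ring
  have hNadd : ∀ f g, N (f + g) ≤ N f + N g := by
    intro f g
    simp only [hN]
    rw [mixedNorm_congr hΩ₀ (Lp.coeFn_add f g), ← mul_add]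
    have hf := mixedNorm_lt_top hΩ₀ (Lp.memLp f)
    have hg := mixedNorm_lt_top hΩ₀ (Lp.memLp g)
    rw [← ENNReal.toReal_add hf.ne hg.ne]
    refine mul_le_mul_of_nonneg_left (ENNReal.toReal_mono (ENNReal.add_ne_top.2 ⟨hf.ne, hg.ne⟩) ?_)
      ENNReal.toReal_nonneg
    exact mixedNorm_add_le hΩ₀ (Lp.aestronglyMeasurable f) (Lp.aestronglyMeasurable g)
  obtain ⟨W, hW1, hW2⟩ := exists_inner_eq_of_le_sublinear T F N hNhom hNadd _ hNle hFN
  have hWm := Lp.memLp W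
  have hpair : ∀ {g : Space → ℝ} (hg : MemLp g 2 (volume.restrict (channel Ω₀ l))),
      ∫ x in channel Ω₀ l, W x * g x = inner ℝ W (hg.toLp g) := by
    intro g hg
    rw [integral_mul_eq_inner hWm hg, Lp.toLp_coeFn]
  -- The sign is that of the weak formulation, -∫ w Gφ = data(φ).
  refine ⟨-W, hWm.neg, ?_, ?_⟩
  · intro φ h1 h2
    have h3 := hpair (hb.memLp_transportOp hΩ₀ h1)
    have h4 := hW1 ⟨φ, h1, h2⟩
    have h5 : T ⟨φ, h1, h2⟩ = (hb.memLp_transportOp hΩ₀ h1).toLp (transportOp b c φ) := rfl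
    rw [h5, ← h3] at h4
    simp only [Pi.neg_apply, neg_mul, integral_neg, neg_neg]
    exact h4
  · have key := ae_sliceNorm_le_of_integral_le hΩ₀ (Lp.stronglyMeasurable W).measurable hWm
      (ENNReal.toReal_nonneg (a := D)) (fun g hg => by
        rw [hpair hg]
        refine (hW2 _).trans_eq ?_
        simp only [hN]
        rw [mixedNorm_congr hΩ₀ hg.coeFn_toLp])
    refine essSup_le_of_ae_le _ ?_
    filter_upwards [key] with s hs
    rw [ENNReal.ofReal_toReal hDt] at hs
    refine le_trans (le_of_eq ?_) hs
    exact eLpNorm_neg (fun y => W (s, y)) 2 _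

/-! ### The flow of a bounded Lipschitz field -/

/-- Picard–Lindelöf works on the whole interval because the displacement is at most MT. Time is
clamped to [0, T] to obtain curves continuous on all of ℝ. -/
lemma exists_flow {E : Type*} [NormedAddCommGroup E] [NormedSpace ℝ E] [CompleteSpace E]
    {B : E → E} {K M : ℝ≥0} (hK : LipschitzWith K B) (hM : ∀ x, ‖B x‖ ≤ M) {T : ℝ} (hT : 0 ≤ T) :
    ∃ X : E → ℝ → E, (∀ x, Continuous (X x)) ∧ (∀ x, X x 0 = x) ∧
      ∀ x, ∀ s ∈ Icc 0 T, HasDerivWithinAt (X x) (B (X x s)) (Icc 0 T) s := by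
  have key : ∀ x : E, ∃ α : ℝ → E, Continuous α ∧ α 0 = x ∧
      ∀ s ∈ Icc 0 T, HasDerivWithinAt α (B (α s)) (Icc 0 T) s := by
    intro x
    have hPL : IsPicardLindelof (fun _ => B) (tmin := 0) (tmax := T) ⟨0, le_rfl, hT⟩ x
        (M * T.toNNReal) 0 M K := by
      refine IsPicardLindelof.of_time_independent (fun y _ => hM y) hK.lipschitzOnWith ?_
      simp [hT]
    obtain ⟨α, h0, hα⟩ := hPL.exists_eq_forall_mem_Icc_hasDerivWithinAt₀
    have hcl : ∀ s, max 0 (min T s) ∈ Icc 0 T :=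
      fun s => ⟨le_max_left _ _, max_le hT (min_le_left _ _)⟩
    have heq : ∀ s ∈ Icc 0 T, α (max 0 (min T s)) = α s := fun s hs => by
      rw [min_eq_right hs.2, max_eq_right hs.1]
    have hαc : ContinuousOn α (Icc 0 T) := fun s hs => (hα s hs).continuousWithinAt
    refine ⟨fun s => α (max 0 (min T s)), hαc.comp_continuous (by fun_prop) hcl, ?_, ?_⟩
    · exact (heq 0 ⟨le_rfl, hT⟩).trans h0
    · intro s hs
      have := (hα s hs).congr heq (heq s hs)
      rwa [← heq s hs] at this
  choose X h1 h2 h3 using key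
  exact ⟨X, h1, h2, h3⟩

lemma hasDerivWithinAt_Ici_of_Icc {E : Type*} [NormedAddCommGroup E] [NormedSpace ℝ E]
    {α : ℝ → E} {v : E} {s T : ℝ} (hs : s ∈ Ico 0 T) (h : HasDerivWithinAt α v (Icc 0 T) s) :
    HasDerivWithinAt α v (Ici s) s :=
  h.mono_of_mem_nhdsWithin (Icc_mem_nhdsGE_of_mem hs)

lemma IsTransportField.lipschitzWith_fieldVec (hb : IsTransportField Ω₀ l b c L c₀) :
    LipschitzWith (2 * L) (fieldVec b) := by
  refine LipschitzWith.of_dist_le_mul fun x y => ?_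
  have h := fun k => (hb.lip k).dist_le_mul x y
  simp only [Real.dist_eq] at h
  have hd : 0 ≤ (L : ℝ) * dist x y := mul_nonneg L.2 dist_nonneg
  rw [Prod.dist_eq]
  push_cast
  refine max_le ?_ ?_
  · rw [Real.dist_eq]
    exact (h 0).trans (by linarith)
  · have h3 : (fieldVec b x).2 - (fieldVec b y).2 = !₂[b 1 x - b 1 y, b 2 x - b 2 y] := by
      ext i; fin_cases i <;> simp [fieldVec]
    rw [dist_eq_norm, h3]
    refine (norm_pair_le _ _).trans ?_
    linarith [h 1, h 2]

lemma IsTransportField.norm_fieldVec_le (hb : IsTransportField Ω₀ l b c L c₀) (x : Space) :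
    ‖fieldVec b x‖ ≤ (4 : ℝ≥0) := by
  push_cast
  refine max_le ((hb.abs_le 0 x).trans (by norm_num)) ((norm_pair_le _ _).trans ?_)
  linarith [hb.abs_le 1 x, hb.abs_le 2 x]

/-- For smooth `g` with compact support in the channel, integration along characteristics gives a
Lipschitz solution of `b · ∇φ = g` that vanishes near the outflow part. -/
lemma IsTransportField.exists_lipschitz_solution (hb : IsTransportField Ω₀ l b c L c₀)
    (hl : 0 < l) {g : Space → ℝ} (hg : ContDiff ℝ ∞ g) (hgc : HasCompactSupport g)
    (hgs : tsupport g ⊆ channel Ω₀ l) :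
    ∃ (φ : Space → ℝ) (K : ℝ≥0), LipschitzWith K φ ∧ (∃ l' < l, ∀ x : Space, l' ≤ x.1 → φ x = 0) ∧
      ∀ x ∈ channel Ω₀ l, DifferentiableAt ℝ φ x → ∑ k, b k x * partialD k φ x = g x := by
  -- The first coordinate grows at rate at least 1/2, so a trajectory that starts with x₁ > 0 is
  -- beyond x₁ = l at time 2l. The flow is taken up to T + 1 to leave room for time shifts h ≤ 1.
  set T := 2 * l with hT
  have hT0 : 0 < T := by positivity
  obtain ⟨X, hXc, hX0, hXd⟩ := exists_flow hb.lipschitzWith_fieldVec hb.norm_fieldVec_le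
    (T := T + 1) (by positivity)
  obtain ⟨Lg, hLg⟩ := (show ContDiff ℝ 1 g from
    hg.of_le (by exact_mod_cast le_top)).lipschitzWith_of_hasCompactSupport hgc one_ne_zero
  obtain ⟨l', hl', hgl⟩ : ∃ l' < l, ∀ x : Space, l' ≤ x.1 → g x = 0 := by
    rcases (tsupport g).eq_empty_or_nonempty with h | h
    · exact ⟨l - 1, by linarith, fun x _ => image_eq_zero_of_notMem_tsupport (by simp [h])⟩
    · obtain ⟨z, hz, hzm⟩ := hgc.isCompact.exists_isMaxOn h (continuous_fst (X := ℝ)).continuousOn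
      refine ⟨(z.1 + l) / 2, by linarith [(hgs hz).1.2], fun x hx => ?_⟩
      refine image_eq_zero_of_notMem_tsupport fun h' => ?_
      have h1 : x.1 ≤ z.1 := hzm h'
      linarith [(hgs hz).1.2]
  have hXr : ∀ x, ∀ s ∈ Ico 0 (T + 1), HasDerivWithinAt (X x) (fieldVec b (X x s)) (Ici s) s :=
    fun x s hs => hasDerivWithinAt_Ici_of_Icc hs (hXd x s (Ico_subset_Icc_self hs))
  have hmono : ∀ x, ∀ s ∈ Icc 0 (T + 1), x.1 + s / 2 ≤ (X x s).1 := by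
    intro x s hs
    have hd : ∀ r ∈ Ioo 0 (T + 1), HasDerivAt (fun r => (X x r).1) (b 0 (X x r)) r := by
      intro r hr
      have h1 := ((hXd x r (Ioo_subset_Icc_self hr)).hasDerivAt (Icc_mem_nhds hr.1 hr.2))
      exact (hasFDerivAt_fst (𝕜 := ℝ) (p := X x r)).comp_hasDerivAt r h1
    have := (convex_Icc 0 (T + 1)).mul_sub_le_image_sub_of_le_deriv (f := fun r => (X x r).1)
      (C := 1 / 2) ((continuous_fst.comp (hXc x)).continuousOn)
      (fun r hr => by
        rw [interior_Icc] at hr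
        exact (hd r hr).differentiableAt.differentiableWithinAt)
      (fun r hr => by
        rw [interior_Icc] at hr
        rw [(hd r hr).deriv]; exact hb.half_le _) 0 ⟨le_rfl, by positivity⟩ s hs hs.1
    simp only [hX0] at this
    linarith
  have hdist : ∀ x x', ∀ s ∈ Icc 0 T,
      dist (X x s) (X x' s) ≤ dist x x' * Real.exp (2 * L * T) := by
    intro x x' s hs
    have h := dist_le_of_trajectories_ODE (v := fun _ => fieldVec b) (K := 2 * L)
      (fun _ => hb.lipschitzWith_fieldVec) (hXc x).continuousOn (hXr x) (hXc x').continuousOn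
      (hXr x') (δ := dist x x') (by rw [hX0, hX0]) s ⟨hs.1, by linarith [hs.2]⟩
    refine h.trans ?_
    push_cast
    rw [sub_zero]
    gcongr
    exact hs.2
  -- The semigroup property: both curves are trajectories with the same starting point, so
  -- Gronwall's bound on their distance is zero.
  have hcoc : ∀ x, ∀ h ∈ Icc (0 : ℝ) 1, ∀ s ∈ Icc 0 T, X (X x h) s = X x (s + h) := by
    intro x h hh s hs
    have hr : ∀ r ∈ Ico 0 T, HasDerivWithinAt (fun r => X x (r + h)) (fieldVec b (X x (r + h)))
        (Ici r) r := by
      intro r hr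
      have h1 := hXr x (r + h) ⟨add_nonneg hr.1 hh.1, by linarith [hr.2, hh.2]⟩
      have h2 : HasDerivWithinAt (fun r : ℝ => r + h) 1 (Ici r) r :=
        (hasDerivWithinAt_id r _).add_const h
      have := h1.scomp r h2 (fun r' hr' => by simpa using hr')
      simpa using! this
    have h := dist_le_of_trajectories_ODE (v := fun _ => fieldVec b) (K := 2 * L) (a := 0) (b := T)
      (fun _ => hb.lipschitzWith_fieldVec) (hXc (X x h)).continuousOn
      (fun r hr' => hXr (X x h) r ⟨hr'.1, by linarith [hr'.2]⟩)
      (((hXc x).comp (by fun_prop)).continuousOn : ContinuousOn (fun r => X x (r + h)) _) hr (δ := 0)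
      (by simp [hX0]) s hs
    rw [zero_mul] at h
    exact dist_le_zero.1 h
  have hgX : ∀ x, Continuous fun s => g (X x s) := fun x => hg.continuous.comp (hXc x)
  -- Minus the integral of g over the future of the trajectory: it vanishes once the future lies
  -- beyond the support of g, and its derivative along the field is g.
  set φ : Space → ℝ := fun x => - ∫ s in (0 : ℝ)..T, g (X x s) with hφ
  refine ⟨φ, Real.toNNReal (Lg * Real.exp (2 * L * T) * T), ?_, ⟨l', hl', ?_⟩, ?_⟩
  · refine LipschitzWith.of_dist_le_mul fun x x' => ?_
    rw [Real.coe_toNNReal _ (by positivity), hφ, dist_neg_neg, dist_eq_norm,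
      ← intervalIntegral.integral_sub ((hgX x).intervalIntegrable _ _)
        ((hgX x').intervalIntegrable _ _)]
    refine (intervalIntegral.norm_integral_le_of_norm_le_const
      (C := Lg * (dist x x' * Real.exp (2 * L * T))) fun s hs => ?_).trans_eq ?_
    · rw [uIoc_of_le hT0.le] at hs
      rw [← dist_eq_norm]
      refine (hLg.dist_le_mul _ _).trans ?_
      gcongr
      exact hdist x x' s ⟨hs.1.le, hs.2⟩
    · rw [sub_zero, abs_of_pos hT0]; ring
  · intro x hx
    have : ∀ s ∈ uIcc 0 T, g (X x s) = 0 := by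
      intro s hs
      rw [uIcc_of_le hT0.le] at hs
      refine hgl _ (hx.trans ?_)
      linarith [hmono x s ⟨hs.1, by linarith [hs.2]⟩, hs.1]
    simp only [hφ]
    rw [intervalIntegral.integral_congr (g := fun _ => (0 : ℝ)) this]
    simp
  · intro x hx hd
    have hstep : ∀ h ∈ Icc (0 : ℝ) 1, φ (X x h) = φ x + ∫ s in (0 : ℝ)..h, g (X x s) := by
      intro h hh
      have e1 : ∫ s in (0 : ℝ)..T, g (X (X x h) s) = ∫ s in (0 : ℝ)..T, g (X x (s + h)) := by
        refine intervalIntegral.integral_congr fun s hs => ?_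
        rw [uIcc_of_le hT0.le] at hs
        simp only [hcoc x h hh s hs]
      have e2 : ∫ s in (0 : ℝ)..T, g (X x (s + h)) = ∫ s in h..T + h, g (X x s) := by
        rw [intervalIntegral.integral_comp_add_right (fun s => g (X x s)), zero_add]
      have e3 : ∫ s in T..T + h, g (X x s) = 0 := by
        rw [intervalIntegral.integral_congr (g := fun _ => (0 : ℝ)) fun s hs => ?_]
        · simp
        · rw [uIcc_of_le (by linarith [hh.1])] at hs
          refine hgl _ ?_
          have h1 := hmono x s ⟨by linarith [hs.1], by linarith [hs.2, hh.2]⟩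
          have h2 : 0 < x.1 := hx.1.1
          linarith [hs.1]
      have hi : ∀ p q, IntervalIntegrable (fun s => g (X x s)) volume p q :=
        fun p q => (hgX x).intervalIntegrable p q
      have e4 := intervalIntegral.integral_add_adjacent_intervals (hi 0 h) (hi h (T + h))
      have e5 := intervalIntegral.integral_add_adjacent_intervals (hi 0 T) (hi T (T + h))
      simp only [hφ]
      rw [e1, e2]
      linarith
    have hx0 : HasFDerivAt φ (fderiv ℝ φ x) (X x 0) := by rw [hX0]; exact hd.hasFDerivAt
    have hsub : Icc (0 : ℝ) 1 ⊆ Icc 0 (T + 1) := Icc_subset_Icc_right (by linarith)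
    have d1 : HasDerivWithinAt (φ ∘ X x) (fderiv ℝ φ x (fieldVec b (X x 0))) (Icc 0 1) 0 :=
      hx0.comp_hasDerivWithinAt 0 ((hXd x 0 ⟨le_rfl, by positivity⟩).mono hsub)
    have d2 : HasDerivWithinAt (fun h => φ x + ∫ s in (0 : ℝ)..h, g (X x s)) (g (X x 0))
        (Icc 0 1) 0 :=
      ((intervalIntegral.integral_hasDerivAt_right ((hgX x).intervalIntegrable _ _)
        ((hgX x).stronglyMeasurableAtFilter _ _) (hgX x).continuousAt).const_add _).hasDerivWithinAt
    have d3 := d2.congr (f₁ := φ ∘ X x) hstep (hstep 0 ⟨le_rfl, zero_le_one⟩)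
    have := (uniqueDiffOn_Icc zero_lt_one 0 ⟨le_rfl, zero_le_one⟩).eq_deriv _ d1 d3
    rwa [hX0, fderiv_fieldVec] at this

/-! ### Uniqueness -/

/-- The near-density of the range of G. With b·∇φ = g and φₙ the mollifications of φ, the hypothesis
on v turns ∫ v (b·∇φₙ) into -∫ v c φₙ, and the energy estimate with c₀ l ≤ 1/32 bounds ‖cφₙ‖ by half
of ‖b·∇φₙ‖, which tends to ‖g‖. -/
lemma IsTransportField.abs_integral_mul_le (hΩ₀ : IsSmoothBounded Ω₀) (hl : 0 < l)
    (hb : IsTransportField Ω₀ l b c L c₀) (hc₀ : c₀ * l ≤ 1 / 32) {v : Space → ℝ}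
    (hv : MemLp v 2 (volume.restrict (channel Ω₀ l)))
    (H : ∀ φ : Space → ℝ, ContDiff ℝ 1 φ → (∀ y ∈ Ω₀, φ (l, y) = 0) →
      ∫ x in channel Ω₀ l, v x * transportOp b c φ x = 0)
    {g : Space → ℝ} (hg : ContDiff ℝ ∞ g) (hgc : HasCompactSupport g)
    (hgs : tsupport g ⊆ channel Ω₀ l) :
    |∫ x in channel Ω₀ l, v x * g x| ≤ 1 / 2 * (eLpNorm v 2 (volume.restrict (channel Ω₀ l))).toReal *
      (eLpNorm g 2 (volume.restrict (channel Ω₀ l))).toReal := by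
  have := isFiniteMeasure_channel hΩ₀ l
  have hm := (isOpen_channel hΩ₀ l).measurableSet
  obtain ⟨φ, K, hφ, ⟨l', hl', hφ0⟩, hφg⟩ := hb.exists_lipschitz_solution hl hg hgc hgs
  set V := (eLpNorm v 2 (volume.restrict (channel Ω₀ l))).toReal with hV
  have hV0 : 0 ≤ V := ENNReal.toReal_nonneg
  set q : ℕ → Space → ℝ := fun n x => ∑ k, b k x * partialD k (mollify n φ) x with hq
  have hqm : ∀ n, Measurable (q n) := fun n =>
    Finset.measurable_sum _ fun k _ => (hb.measurable k).mul (measurable_partialD k _)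
  have hqb : ∀ n x, |q n x| ≤ 6 * K := by
    intro n x
    have h1 : ∀ k, |b k x * partialD k (mollify n φ) x| ≤ 2 * K := fun k => by
      rw [abs_mul]
      exact mul_le_mul (hb.abs_le k x) (abs_partialD_mollify_le n hφ k x) (abs_nonneg _) zero_le_two
    calc _ ≤ ∑ k, |b k x * partialD k (mollify n φ) x| := Finset.abs_sum_le_sum_abs _ _
      _ ≤ ∑ _k : Fin 3, 2 * (K : ℝ) := Finset.sum_le_sum fun k _ => h1 k
      _ = _ := by simp; ring
  have hqL : ∀ n, MemLp (q n) 2 (volume.restrict (channel Ω₀ l)) := fun n =>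
    MemLp.of_bound (hqm n).aestronglyMeasurable (6 * K) (Eventually.of_forall (hqb n))
  have hqlim : ∀ᵐ x ∂(volume.restrict (channel Ω₀ l)), Tendsto (fun n => q n x) atTop (𝓝 (g x)) := by
    have hk : ∀ᵐ x, ∀ k, Tendsto (fun n => partialD k (mollify n φ) x) atTop
        (𝓝 (partialD k φ x)) := ae_all_iff.2 fun k => ae_tendsto_partialD_mollify hφ k
    filter_upwards [ae_restrict_of_ae hk, ae_restrict_mem hm,
      ae_restrict_of_ae hφ.ae_differentiableAt] with x h1 h2 h3
    rw [← hφg x h2 h3]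
    exact tendsto_finsetSum _ fun k _ => (h1 k).const_mul _
  have hgL : MemLp g 2 (volume.restrict (channel Ω₀ l)) := memLp_of_continuous hΩ₀ hg.continuous
  have lim1 : Tendsto (fun n => ∫ x in channel Ω₀ l, v x * q n x) atTop
      (𝓝 (∫ x in channel Ω₀ l, v x * g x)) := by
    refine tendsto_integral_of_dominated_convergence (fun x => |v x| * (6 * K))
      (fun n => hv.1.mul (hqm n).aestronglyMeasurable)
      ((hv.integrable one_le_two).abs.mul_const _) (fun n => Eventually.of_forall fun x => ?_) ?_
    · rw [norm_mul]
      exact mul_le_mul_of_nonneg_left (hqb n x) (abs_nonneg _)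
    · filter_upwards [hqlim] with x hx using hx.const_mul _
  have lim2 : Tendsto (fun n => (eLpNorm (q n) 2 (volume.restrict (channel Ω₀ l))).toReal) atTop
      (𝓝 (eLpNorm g 2 (volume.restrict (channel Ω₀ l))).toReal) := by
    have h1 : Tendsto (fun n => ∫ x in channel Ω₀ l, q n x ^ 2) atTop
        (𝓝 (∫ x in channel Ω₀ l, g x ^ 2)) := by
      refine tendsto_integral_of_dominated_convergence (fun _ => (6 * K) ^ 2)
        (fun n => ((hqm n).pow_const 2).aestronglyMeasurable)
        (integrable_const _) (fun n => Eventually.of_forall fun x => ?_) ?_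
      · rw [norm_pow]
        exact pow_le_pow_left₀ (norm_nonneg _) (hqb n x) 2
      · filter_upwards [hqlim] with x hx using hx.pow 2
    have h2 := (Real.continuous_sqrt.tendsto _).comp h1
    simp only [Function.comp_def, integral_sq_eq hgL, integral_sq_eq (hqL _),
      Real.sqrt_sq ENNReal.toReal_nonneg] at h2
    exact h2
  refine le_of_tendsto_of_tendsto lim1.abs (lim2.const_mul (1 / 2 * V)) ?_
  -- When the kernel radius is below l - l', the mollification of φ still vanishes on the outflow
  -- part.
  filter_upwards [(tendsto_one_div_add_atTop_nhds_zero_nat (𝕜 := ℝ)).eventually_lt_const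
    (sub_pos.2 hl')] with n hn
  have hsm : ContDiff ℝ 1 (mollify n φ) :=
    (contDiff_mollify n hφ.continuous.locallyIntegrable).of_le (by exact_mod_cast le_top)
  have hz : ∀ y ∈ Ω₀, mollify n φ (l, y) = 0 := by
    intro y _
    refine mollify_eq_zero n _ fun z hzd => hφ0 z ?_
    have h1 : dist z.1 l ≤ dist z (l, y) := le_max_left _ _
    rw [Real.dist_eq] at h1
    have := neg_le_of_abs_le (h1.trans hzd)
    linarith
  have hHn := H _ hsm hz
  set P := (eLpNorm (mollify n φ) 2 (volume.restrict (channel Ω₀ l))).toReal with hP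
  set Q := (eLpNorm (q n) 2 (volume.restrict (channel Ω₀ l))).toReal with hQ
  have hP0 : 0 ≤ P := ENNReal.toReal_nonneg
  have hQ0 : 0 ≤ Q := ENNReal.toReal_nonneg
  have hφL : MemLp (mollify n φ) 2 (volume.restrict (channel Ω₀ l)) :=
    memLp_of_continuous hΩ₀ hsm.continuous
  have hcφm : AEStronglyMeasurable (fun x => c x * mollify n φ x) (volume.restrict (channel Ω₀ l)) :=
    (hb.measurable_div.mul hsm.continuous.measurable).aestronglyMeasurable
  have hcφb : ∀ x, ‖c x * mollify n φ x‖ ≤ c₀ * ‖mollify n φ x‖ := fun x => by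
    rw [norm_mul]
    exact mul_le_mul_of_nonneg_right (hb.abs_div_le x) (norm_nonneg _)
  have hcφL : MemLp (fun x => c x * mollify n φ x) 2 (volume.restrict (channel Ω₀ l)) :=
    hφL.of_le_mul hcφm (Eventually.of_forall hcφb)
  have hcφP : (eLpNorm (fun x => c x * mollify n φ x) 2 (volume.restrict (channel Ω₀ l))).toReal ≤
      c₀ * P := by
    have h1 := eLpNorm_le_mul_eLpNorm_of_ae_le_mul (g := mollify n φ)
      (μ := volume.restrict (channel Ω₀ l)) (Eventually.of_forall hcφb) 2
    have h2 := ENNReal.toReal_mono (ENNReal.mul_ne_top ENNReal.ofReal_ne_top hφL.2.ne) h1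
    rwa [ENNReal.toReal_mul, ENNReal.toReal_ofReal (NNReal.coe_nonneg c₀)] at h2
  have hsplit : transportOp b c (mollify n φ) = q n + fun x => c x * mollify n φ x := rfl
  -- The energy estimate and Cauchy–Schwarz in x₁ give P ≤ 8l(Q + c₀P) ≤ 8lQ + P/4, and the last
  -- term is absorbed.
  have hPQ : P ≤ 16 * l * Q := by
    have hop := hb.memLp_transportOp hΩ₀ hsm
    have h1 := eLpNorm_le_of_sliceNorm_le hΩ₀ hφL.1
      (Y := 8 * mixedNorm Ω₀ l (transportOp b c (mollify n φ))) (by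
      filter_upwards [ae_restrict_mem measurableSet_Ioo] with s hs
      exact hb.sliceNorm_le hΩ₀ (by linarith) hsm hz ⟨hs.1.le, hs.2.le⟩)
    have h2 := mixedNorm_le hΩ₀ hop.1
    have h3 : eLpNorm (transportOp b c (mollify n φ)) 2 (volume.restrict (channel Ω₀ l)) ≤
        eLpNorm (q n) 2 (volume.restrict (channel Ω₀ l)) +
        eLpNorm (fun x => c x * mollify n φ x) 2 (volume.restrict (channel Ω₀ l)) := by
      rw [hsplit]
      exact eLpNorm_add_le (hqL n).1 hcφL.1 one_le_two
    have h4 : eLpNorm (mollify n φ) 2 (volume.restrict (channel Ω₀ l)) ≤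
        8 * (ENNReal.ofReal l * (eLpNorm (q n) 2 (volume.restrict (channel Ω₀ l)) +
          eLpNorm (fun x => c x * mollify n φ x) 2 (volume.restrict (channel Ω₀ l)))) := by
      refine h1.trans ?_
      calc _ ≤ ENNReal.ofReal l ^ (1 / 2 : ℝ) * (8 * (ENNReal.ofReal l ^ (1 / 2 : ℝ) *
            (eLpNorm (q n) 2 (volume.restrict (channel Ω₀ l)) +
          eLpNorm (fun x => c x * mollify n φ x) 2 (volume.restrict (channel Ω₀ l))))) := by
            gcongr; exact h2.trans (by gcongr)
        _ = 8 * ((ENNReal.ofReal l ^ (1 / 2 : ℝ) * ENNReal.ofReal l ^ (1 / 2 : ℝ)) *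
            (eLpNorm (q n) 2 (volume.restrict (channel Ω₀ l)) +
          eLpNorm (fun x => c x * mollify n φ x) 2 (volume.restrict (channel Ω₀ l)))) := by ring
        _ = _ := by
          rw [← ENNReal.rpow_add_of_nonneg _ _ (by norm_num) (by norm_num)]; norm_num
    have hfin := ENNReal.add_ne_top.2 ⟨(hqL n).2.ne, hcφL.2.ne⟩
    have h5 := ENNReal.toReal_mono (by finiteness) h4
    rw [ENNReal.toReal_mul, ENNReal.toReal_mul, ENNReal.toReal_add (hqL n).2.ne hcφL.2.ne,
      ENNReal.toReal_ofReal hl.le, ENNReal.toReal_ofNat] at h5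
    have h6 : l * (c₀ * P) ≤ 1 / 32 * P := by
      have := mul_le_mul_of_nonneg_right hc₀ hP0
      linarith
    have h7 := mul_le_mul_of_nonneg_left hcφP hl.le
    linarith
  have e1 : |∫ x in channel Ω₀ l, v x * q n x| ≤ V * (c₀ * P) := by
    have i1 := hv.integrable_mul (hqL n)
    have i2 := hv.integrable_mul hcφL
    have h1 : (fun x => v x * transportOp b c (mollify n φ) x) =
        fun x => v x * q n x + v x * (c x * mollify n φ x) := by
      ext x; rw [hsplit, Pi.add_apply, mul_add]
    rw [h1] at hHn
    have h2 := integral_add i1 i2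
    simp only [Pi.mul_apply] at h2
    rw [h2] at hHn
    rw [eq_neg_of_add_eq_zero_left hHn, abs_neg]
    exact (SteadyTransport.abs_integral_mul_le hv hcφL).trans (mul_le_mul_of_nonneg_left hcφP hV0)
  refine e1.trans ?_
  have h8 : (c₀ : ℝ) * P ≤ 1 / 2 * Q := by
    have h9 := mul_le_mul_of_nonneg_left hPQ c₀.2
    have h10 := mul_le_mul_of_nonneg_right hc₀ hQ0
    nlinarith
  calc V * (c₀ * P) ≤ V * (1 / 2 * Q) := mul_le_mul_of_nonneg_left h8 hV0
    _ = _ := by ring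

/-- The classes in `L²(Ω)` of smooth functions with compact support in `Ω`. -/
def smoothCompactLp (Ω : Set Space) :
    Submodule ℝ (Lp ℝ 2 (volume.restrict Ω : Measure Space)) where
  carrier := {u | ∃ g : Space → ℝ, ContDiff ℝ ∞ g ∧ HasCompactSupport g ∧ tsupport g ⊆ Ω ∧
    u =ᵐ[volume.restrict Ω] g}
  add_mem' := by
    rintro u w ⟨g, h1, h2, h3, h4⟩ ⟨g', h1', h2', h3', h4'⟩
    exact ⟨g + g', h1.add h1', h2.add h2', (tsupport_add g g').trans (union_subset h3 h3'),
      (Lp.coeFn_add u w).trans (h4.add h4')⟩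
  zero_mem' := ⟨0, contDiff_const, HasCompactSupport.zero, by simp, Lp.coeFn_zero _ _ _⟩
  smul_mem' := by
    rintro a u ⟨g, h1, h2, h3, h4⟩
    exact ⟨fun x => a * g x, contDiff_const.mul h1, h2.mul_left,
      (tsupport_mul_subset_right (f := fun _ => a)).trans h3,
      (Lp.coeFn_smul a u).trans (h4.mono fun x hx => by simp [hx])⟩

/-- An element orthogonal to all these classes vanishes by the fundamental lemma of the calculus of
variations. -/
lemma smoothCompactLp_topologicalClosure {Ω : Set Space} (hΩ : IsOpen Ω)
    [IsFiniteMeasure (volume.restrict Ω : Measure Space)] :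
    (smoothCompactLp Ω).topologicalClosure = ⊤ := by
  rw [Submodule.topologicalClosure_eq_top_iff, Submodule.eq_bot_iff]
  intro u hu
  rw [Submodule.mem_orthogonal'] at hu
  have hum := Lp.memLp u
  have hui : IntegrableOn u Ω := hum.integrable one_le_two
  have key : ∀ᵐ x, x ∈ Ω → u x = 0 := by
    refine hΩ.ae_eq_zero_of_integral_contDiff_smul_eq_zero hui.locallyIntegrableOn
      fun g hg hgc hgs => ?_
    have hgL : MemLp g 2 (volume.restrict Ω) :=
      (hg.continuous.memLp_of_hasCompactSupport hgc).mono_measure Measure.restrict_le_self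
    have h1 := hu (hgL.toLp g) ⟨g, hg, hgc, hgs, hgL.coeFn_toLp⟩
    have h2 := integral_mul_eq_inner hum hgL
    rw [Lp.toLp_coeFn, h1] at h2
    rw [← setIntegral_eq_integral_of_forall_compl_eq_zero (s := Ω), ← h2]
    · simp_rw [smul_eq_mul, mul_comm]
    · intro x hx
      rw [image_eq_zero_of_notMem_tsupport fun h => hx (hgs h), zero_smul]
  rw [Lp.eq_zero_iff_ae_eq_zero]
  exact (ae_restrict_iff' hΩ.measurableSet).2 key

/-- Uniqueness of weak solutions in `L²`. -/
theorem IsTransportField.ae_eq_zero (hΩ₀ : IsSmoothBounded Ω₀) (hl : 0 < l)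
    (hb : IsTransportField Ω₀ l b c L c₀) (hc₀ : c₀ * l ≤ 1 / 32) {v : Space → ℝ}
    (hv : MemLp v 2 (volume.restrict (channel Ω₀ l)))
    (H : ∀ φ : Space → ℝ, ContDiff ℝ 1 φ → (∀ y ∈ Ω₀, φ (l, y) = 0) →
      ∫ x in channel Ω₀ l, v x * transportOp b c φ x = 0) :
    v =ᵐ[volume.restrict (channel Ω₀ l)] 0 := by
  have := isFiniteMeasure_channel hΩ₀ l
  set u := hv.toLp v with hu
  have hclosed : IsClosed {z : Lp ℝ 2 (volume.restrict (channel Ω₀ l) : Measure Space) |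
      |inner ℝ u z| ≤ 1 / 2 * ‖u‖ * ‖z‖} :=
    isClosed_le (by fun_prop) (by fun_prop)
  have hmem : (u : Lp ℝ 2 (volume.restrict (channel Ω₀ l) : Measure Space)) ∈
      (smoothCompactLp (channel Ω₀ l)).topologicalClosure := by
    rw [smoothCompactLp_topologicalClosure (isOpen_channel hΩ₀ l)]; trivial
  have hsub : ((smoothCompactLp (channel Ω₀ l)) : Set _) ⊆
      {z : Lp ℝ 2 (volume.restrict (channel Ω₀ l) : Measure Space) |
        |inner ℝ u z| ≤ 1 / 2 * ‖u‖ * ‖z‖} := by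
    rintro z ⟨g, hg, hgc, hgs, hz⟩
    have hgL : MemLp g 2 (volume.restrict (channel Ω₀ l)) := memLp_of_continuous hΩ₀ hg.continuous
    have hzg : z = hgL.toLp g := Lp.ext (hz.trans hgL.coeFn_toLp.symm)
    have key := hb.abs_integral_mul_le hΩ₀ hl hc₀ hv H hg hgc hgs
    rw [integral_mul_eq_inner hv hgL] at key
    rw [mem_ofPred_eq, hzg, hu, Lp.norm_toLp, Lp.norm_toLp]
    exact key
  -- By density the inequality may be applied to v itself: ‖v‖² ≤ ½ ‖v‖².
  have hfin : |inner ℝ u u| ≤ 1 / 2 * ‖u‖ * ‖u‖ := closure_minimal hsub hclosed hmem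
  rw [real_inner_self_eq_norm_mul_norm, abs_of_nonneg (by positivity)] at hfin
  have hu0 : ‖u‖ = 0 := by nlinarith [norm_nonneg u]
  have h0 := Lp.eq_zero_iff_ae_eq_zero.1 (norm_eq_zero.1 hu0)
  exact hv.coeFn_toLp.symm.trans h0

/-! ### From small Sobolev fields to transport fields -/

lemma hasWeakPartial_weakPartial {Ω : Set Space} {i : Fin 3} {f : Space → ℝ}
    (h : ∃ g, HasWeakPartial Ω i f g) : HasWeakPartial Ω i f (weakPartial Ω i f) := by
  rw [weakPartial, dif_pos h]; exact h.choose_spec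

/-- On small balls of `W²_p`, functions have small Lipschitz representatives and small weak
gradients. -/
lemma exists_regularity (hΩ₀ : IsSmoothBounded Ω₀) (hl : 0 < l) {p : ℝ} (hp : 3 < p) {M : ℝ≥0}
    (hM : 0 < M) :
    ∃ δ : ℝ, 0 < δ ∧ ∃ K : ℝ≥0, ∀ f : Space → ℝ, MemW2 (channel Ω₀ l) (ENNReal.ofReal p) f →
      normW2 (channel Ω₀ l) (ENNReal.ofReal p) f ≤ ENNReal.ofReal δ →
      (∀ i, ∀ᵐ x ∂(volume.restrict (channel Ω₀ l)), |weakPartial (channel Ω₀ l) i f x| ≤ M) ∧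
      ∃ F : Space → ℝ, LipschitzWith K F ∧ (∀ x, |F x| ≤ M) ∧
        F =ᵐ[volume.restrict (channel Ω₀ l)] f := by
  obtain ⟨r, hr, κ, hκ, hκ1, hU⟩ := exists_uniformCone_channel hΩ₀ hl
  have hΩ := isOpen_channel hΩ₀ l
  have hbd := isBounded_channel hΩ₀ l
  obtain ⟨K₁, hK₁⟩ := exists_ae_enorm_le hΩ hbd hr hκ hκ1 hU hp
  obtain ⟨K₂, hK₂⟩ := exists_lipschitz_representative hΩ hr hκ hU
  refine ⟨M / (K₁ + 1), by positivity, K₂ * M, fun f hf hn => ?_⟩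
  set P := ENNReal.ofReal p with hP
  set μ : Measure Space := volume.restrict (channel Ω₀ l) with hμ
  have hsmall : ∀ a : ℝ≥0∞, a ≤ normW2 (channel Ω₀ l) P f → K₁ * a ≤ M := by
    intro a ha
    calc K₁ * a ≤ K₁ * ENNReal.ofReal (M / (K₁ + 1)) := by gcongr; exact ha.trans hn
      _ = ENNReal.ofReal (K₁ * (M / (K₁ + 1))) := by
          rw [ENNReal.ofReal_mul (NNReal.coe_nonneg K₁), ENNReal.ofReal_coe_nnreal]
      _ ≤ ENNReal.ofReal M := by
          apply ENNReal.ofReal_le_ofReal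
          rw [mul_div_assoc', div_le_iff₀ (by positivity)]
          nlinarith [K₁.2, M.2]
      _ = M := ENNReal.ofReal_coe_nnreal
  have habs : ∀ {u : Space → ℝ} {a : ℝ≥0∞}, a ≤ normW2 (channel Ω₀ l) P f →
      (∀ᵐ x ∂μ, ‖u x‖ₑ ≤ K₁ * a) → ∀ᵐ x ∂μ, |u x| ≤ M := by
    intro u a ha hu
    filter_upwards [hu] with x hx
    have h1 := hx.trans (hsmall a ha)
    rw [Real.enorm_eq_ofReal_abs, ← ENNReal.ofReal_coe_nnreal] at h1
    exact (ENNReal.ofReal_le_ofReal_iff M.2).1 h1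
  have h0 : ∀ᵐ x ∂μ, |f x| ≤ M :=
    habs le_self_add (hK₁ f _ hf.memLp hf.memLp₁ fun i => hasWeakPartial_weakPartial (hf.hasWeak₁ i))
  -- Morrey's inequality for the first derivatives; this is where the second derivatives enter.
  have h1 : ∀ i, ∀ᵐ x ∂μ, |weakPartial (channel Ω₀ l) i f x| ≤ M := by
    intro i
    refine habs ?_ (hK₁ _ _ (hf.memLp₁ i) (hf.memLp₂ i)
      fun j => hasWeakPartial_weakPartial (hf.hasWeak₂ i j))
    refine add_le_add ?_ ?_
    · exact (Finset.single_le_sum (f := fun i => eLpNorm (weakPartial (channel Ω₀ l) i f) P μ)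
        (fun _ _ => zero_le) (Finset.mem_univ i)).trans le_add_self
    · exact Finset.single_le_sum (f := fun i => ∑ j,
        eLpNorm (weakPartial (channel Ω₀ l) j (weakPartial (channel Ω₀ l) i f)) P μ)
        (fun _ _ => zero_le) (Finset.mem_univ i)
  exact ⟨h1, hK₂ f _ M (integrableOn_of_memLp hbd (by linarith) hf.memLp)
    (fun i => hasWeakPartial_weakPartial (hf.hasWeak₁ i)) h0 h1⟩

/-- Functions continuous on the closure of an open set that agree almost everywhere in the set agree
on the closure. Hence the conditions on the wall and the inflow weight can be read off from any
continuous representative. -/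
lemma contRep_eq {Ω : Set Space} (hΩ : IsOpen Ω) {f F : Space → ℝ} (hF : Continuous F)
    (h : F =ᵐ[volume.restrict Ω] f) : EqOn (contRep Ω f) F (closure Ω) := by
  have hex : ∃ g : Space → ℝ, ContinuousOn g (closure Ω) ∧ g =ᵐ[volume.restrict Ω] f :=
    ⟨F, hF.continuousOn, h⟩
  rw [contRep, dif_pos hex]
  obtain ⟨h1, h2⟩ := hex.choose_spec
  exact (Measure.eqOn_open_of_ae_eq (h2.trans h.symm) hΩ (h1.mono subset_closure)
    hF.continuousOn).of_subset_closure h1 hF.continuousOn subset_closure le_rfl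

lemma mem_closure_channel (hl : 0 < l) {t : ℝ} (ht : t ∈ Icc 0 l) {y : Plane}
    (hy : y ∈ closure Ω₀) : ((t, y) : Space) ∈ closure (channel Ω₀ l) := by
  rw [channel, closure_prod_eq, closure_Ioo hl.ne]
  exact ⟨ht, hy⟩

lemma setIntegral_partialD_eq_zero {Ω : Set Space} {ζ : Space → ℝ} (hζ : ContDiff ℝ ∞ ζ)
    (hc : HasCompactSupport ζ) (hs : tsupport ζ ⊆ Ω) (i : Fin 3) :
    ∫ x in Ω, partialD i ζ x = 0 := by
  have hcont : Continuous (partialD i ζ) := (hζ.continuous_fderiv (by simp)).clm_apply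
    continuous_const
  have hcs : HasCompactSupport (partialD i ζ) := (hc.fderiv (𝕜 := ℝ)).comp_left
    (g := fun A : Space →L[ℝ] ℝ => A (dir i)) (by simp)
  have key := integral_mul_fderiv_eq_neg_fderiv_mul_of_integrable (𝕜 := ℝ)
    (μ := (volume : Measure Space)) (f := fun _ => 1) (g := ζ) (v := dir i)
    (by simp) (by simpa using! hcont.integrable_of_hasCompactSupport hcs)
    (by simpa using hζ.continuous.integrable_of_hasCompactSupport hc)
    (fun _ _ => differentiableAt_const _)
    (fun x _ => (hζ.differentiable (by simp)) x)
  rw [setIntegral_eq_integral_of_forall_compl_eq_zero]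
  · simpa [partialD] using key
  · intro x hx
    have hx' : fderiv ℝ ζ x = 0 := image_eq_zero_of_notMem_tsupport
      fun h => hx (hs (tsupport_fderiv_subset ℝ h))
    rw [partialD, hx']; rfl

/-- A small tangential field in `W²_p` coincides almost everywhere with a transporting field in the
classical sense. -/
lemma exists_isTransportField (hΩ₀ : IsSmoothBounded Ω₀) (hl : 0 < l) {p : ℝ} (hp : 3 < p)
    {c₀ : ℝ≥0} (hc₀ : 0 < c₀) :
    ∃ δ : ℝ, 0 < δ ∧ ∃ L : ℝ≥0, ∀ U : Fin 3 → Space → ℝ,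
      (∀ k, MemW2 (channel Ω₀ l) (ENNReal.ofReal p) (U k)) →
      ∑ k, normW2 (channel Ω₀ l) (ENNReal.ofReal p) (U k) ≤ ENNReal.ofReal δ →
      TangentOnWall Ω₀ l U →
      ∃ b c, IsTransportField Ω₀ l b c L c₀ ∧
        (∀ k, b k =ᵐ[volume.restrict (channel Ω₀ l)] tildeU U k) ∧
        c =ᵐ[volume.restrict (channel Ω₀ l)] weakDiv (channel Ω₀ l) U ∧
        ∀ y ∈ Ω₀, 1 + contRep (channel Ω₀ l) (U 0) (0, y) = b 0 (0, y) := by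
  -- The bound 1/2 keeps the first component of the field above 1/2; the bound c₀/3 is for the three
  -- terms of the divergence.
  set M : ℝ≥0 := min (1 / 2) (c₀ / 3) with hM
  have hM0 : 0 < M := lt_min (by norm_num) (by positivity)
  have hM1 : (M : ℝ) ≤ 1 / 2 := by
    have : M ≤ 1 / 2 := min_le_left _ _
    exact_mod_cast this
  have hM2 : 3 * (M : ℝ) ≤ c₀ := by
    have : M ≤ c₀ / 3 := min_le_right _ _
    have h : (M : ℝ) ≤ c₀ / 3 := by exact_mod_cast this
    linarith
  obtain ⟨δ, hδ, K, H⟩ := exists_regularity hΩ₀ hl hp hM0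
  refine ⟨δ, hδ, K, fun U hU hn ht => ?_⟩
  have hΩ := isOpen_channel hΩ₀ l
  have hΩm := hΩ.measurableSet
  have hbd := isBounded_channel hΩ₀ l
  have hnk : ∀ k, normW2 (channel Ω₀ l) (ENNReal.ofReal p) (U k) ≤ ENNReal.ofReal δ := fun k =>
    (Finset.single_le_sum (f := fun k => normW2 (channel Ω₀ l) (ENNReal.ofReal p) (U k))
      (fun _ _ => zero_le) (Finset.mem_univ k)).trans hn
  have hg := fun k => (H (U k) (hU k) (hnk k)).1
  choose F hFL hFM hFU using fun k => (H (U k) (hU k) (hnk k)).2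
  have hrep := fun k => contRep_eq hΩ (hFL k).continuous (hFU k)
  -- the weak divergence and a bounded measurable version of it
  have hdm : AEStronglyMeasurable (weakDiv (channel Ω₀ l) U) (volume.restrict (channel Ω₀ l)) := by
    have := Finset.aestronglyMeasurable_fun_sum (μ := volume.restrict (channel Ω₀ l))
      (f := fun k => weakPartial (channel Ω₀ l) k (U k)) Finset.univ
      (fun k _ => ((hU k).memLp₁ k).1)
    exact this
  have hdb : ∀ᵐ x ∂(volume.restrict (channel Ω₀ l)), |weakDiv (channel Ω₀ l) U x| ≤ c₀ := by
    filter_upwards [hg 0 0, hg 1 1, hg 2 2] with x h0 h1 h2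
    rw [weakDiv, Fin.sum_univ_three]
    exact (abs_add_three _ _ _).trans (by linarith)
  -- A measurable version, clamped so that the bound by c₀ holds at every point.
  set c : Space → ℝ := fun x => max (-c₀) (min (hdm.mk _ x) c₀) with hc
  have hce : c =ᵐ[volume.restrict (channel Ω₀ l)] weakDiv (channel Ω₀ l) U := by
    filter_upwards [hdm.ae_eq_mk, hdb] with x h1 h2
    rw [abs_le] at h2
    rw [hc]
    simp only
    rw [← h1, min_eq_left h2.2, max_eq_right h2.1]
  set b : Fin 3 → Space → ℝ := ![fun x => 1 + F 0 x, F 1, F 2] with hb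
  have hbe : ∀ k, b k =ᵐ[volume.restrict (channel Ω₀ l)] tildeU U k := by
    intro k
    fin_cases k
    · filter_upwards [hFU 0] with x hx
      simp [hb, tildeU, hx]
    · exact hFU 1
    · exact hFU 2
  have hFM' : ∀ k x, |F k x| ≤ 1 / 2 := fun k x => (hFM k x).trans hM1
  refine ⟨b, c, ⟨?_, ?_, ?_, ?_, ?_, ?_, ?_⟩, hbe, hce, ?_⟩
  · intro k
    fin_cases k
    · exact LipschitzWith.of_dist_le_mul fun x y => by
        simpa [hb] using (hFL 0).dist_le_mul x y
    · exact hFL 1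
    · exact hFL 2
  · intro k x
    fin_cases k
    · have := abs_le.1 (hFM' 0 x)
      rw [abs_le]
      simp only [hb, Fin.zero_eta, Matrix.cons_val_zero]
      constructor <;> linarith
    · exact (hFM' 1 x).trans (by norm_num)
    · exact (hFM' 2 x).trans (by norm_num)
  · intro x
    have := (abs_le.1 (hFM' 0 x)).1
    simp only [hb, Matrix.cons_val_zero]
    linarith
  · exact measurable_const.max (hdm.stronglyMeasurable_mk.measurable.min measurable_const)
  · intro x
    rw [abs_le]
    exact ⟨le_max_left _ _, max_le (by linarith [c₀.2]) (min_le_right _ _)⟩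
  · intro ζ hζ hζc hζs
    obtain ⟨B, hB⟩ := exists_bound_of_hasCompactSupport hζ.continuous hζc
    have hk := fun k => (hasWeakPartial_weakPartial ((hU k).hasWeak₁ k)).integral_eq ζ hζ hζc hζs
    have hdi : ∀ k, IntegrableOn (weakPartial (channel Ω₀ l) k (U k)) (channel Ω₀ l) := fun k =>
      integrableOn_of_memLp hbd (by linarith) ((hU k).memLp₁ k)
    have hui : ∀ k, IntegrableOn (U k) (channel Ω₀ l) := fun k =>
      integrableOn_of_memLp hbd (by linarith) (hU k).memLp
    have hpc : ∀ k, Continuous (partialD k ζ) := fun k =>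
      (hζ.continuous_fderiv (by simp)).clm_apply continuous_const
    have hpcs : ∀ k, HasCompactSupport (partialD k ζ) := fun k =>
      (hζc.fderiv (𝕜 := ℝ)).comp_left (g := fun A : Space →L[ℝ] ℝ => A (dir k)) (by simp)
    have i1 : ∀ k, IntegrableOn (fun x => U k x * partialD k ζ x) (channel Ω₀ l) := by
      intro k
      obtain ⟨A, hA⟩ := exists_bound_of_hasCompactSupport (hpc k) (hpcs k)
      exact (hui k).mul_bdd (hpc k).aestronglyMeasurable (Eventually.of_forall hA)
    have i2 : ∀ k, IntegrableOn (fun x => weakPartial (channel Ω₀ l) k (U k) x * ζ x)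
        (channel Ω₀ l) := fun k =>
      (hdi k).mul_bdd hζ.continuous.aestronglyMeasurable (Eventually.of_forall hB)
    have i0 : IntegrableOn (partialD 0 ζ) (channel Ω₀ l) :=
      ((hpc 0).integrable_of_hasCompactSupport (hpcs 0)).integrableOn
    calc ∫ x in channel Ω₀ l, ∑ k, b k x * partialD k ζ x
        = ∫ x in channel Ω₀ l, (partialD 0 ζ x + ∑ k, U k x * partialD k ζ x) := by
          refine integral_congr_ae ?_
          filter_upwards [hbe 0, hbe 1, hbe 2] with x h0 h1 h2
          simp only [Fin.sum_univ_three, h0, h1, h2]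
          simp [tildeU]; ring
      _ = ∑ k, ∫ x in channel Ω₀ l, U k x * partialD k ζ x := by
          rw [integral_add i0 (integrable_finsetSum _ fun k _ => i1 k),
            setIntegral_partialD_eq_zero hζ hζc hζs, zero_add, integral_finsetSum _ fun k _ => i1 k]
      _ = - ∫ x in channel Ω₀ l, ∑ k, weakPartial (channel Ω₀ l) k (U k) x * ζ x := by
          rw [integral_finsetSum _ fun k _ => i2 k, ← Finset.sum_neg_distrib]
          exact Finset.sum_congr rfl fun k _ => hk k
      _ = - ∫ x in channel Ω₀ l, c x * ζ x := by
          congr 1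
          refine integral_congr_ae ?_
          filter_upwards [hce] with x hx
          rw [hx, weakDiv, Finset.sum_mul]
  · intro t htl y hy ν hν
    have h1 := ht t htl y hy ν hν
    have hcl := mem_closure_channel hl htl (frontier_subset_closure hy)
    simp only [Fin.sum_univ_three, hrep _ hcl] at h1
    simpa [hb, wallNormal] using h1
  · intro y hy
    rw [hrep 0 (mem_closure_channel hl ⟨le_rfl, hl.le⟩ (subset_closure hy))]
    rfl

/-- Almost everywhere the field and its divergence may be replaced by b and c; the two integrals on
the left then merge, as b·∇φ + cφ = Gφ. -/
lemma IsTransportField.isWeakSolution_iff (hΩ₀ : IsSmoothBounded Ω₀)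
    (hb : IsTransportField Ω₀ l b c L c₀) {U : Fin 3 → Space → ℝ}
    (hbe : ∀ k, b k =ᵐ[volume.restrict (channel Ω₀ l)] tildeU U k)
    (hce : c =ᵐ[volume.restrict (channel Ω₀ l)] weakDiv (channel Ω₀ l) U)
    (hin : ∀ y ∈ Ω₀, 1 + contRep (channel Ω₀ l) (U 0) (0, y) = b 0 (0, y))
    (h : Space → ℝ) (w_in : Plane → ℝ) {w : Space → ℝ}
    (hw : MemLp w 2 (volume.restrict (channel Ω₀ l))) :
    IsWeakSolution Ω₀ l U h w_in w ↔
      ∀ φ : Space → ℝ, ContDiff ℝ 1 φ → (∀ y ∈ Ω₀, φ (l, y) = 0) →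
        - ∫ x in channel Ω₀ l, w x * transportOp b c φ x =
          (∫ x in channel Ω₀ l, φ x * h x) + ∫ y in Ω₀, φ (0, y) * (b 0 (0, y) * w_in y) := by
  refine forall_congr' fun φ => forall_congr' fun hφ => forall_congr' fun _ => ?_
  have e1 : ∫ y in Ω₀, w_in y * φ (0, y) * (1 + contRep (channel Ω₀ l) (U 0) (0, y)) =
      ∫ y in Ω₀, φ (0, y) * (b 0 (0, y) * w_in y) :=
    setIntegral_congr_fun hΩ₀.isOpen.measurableSet fun y hy => by
      simp only [hin y hy]; ring
  have e2 : ∫ x in channel Ω₀ l, w x * ∑ k, tildeU U k x * partialD k φ x =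
      ∫ x in channel Ω₀ l, w x * (transportOp b c φ x - c x * φ x) := by
    refine integral_congr_ae ?_
    filter_upwards [hbe 0, hbe 1, hbe 2] with x h0 h1 h2
    simp [transportOp, Fin.sum_univ_three, h0, h1, h2]
  have e3 : ∫ x in channel Ω₀ l, w x * φ x * weakDiv (channel Ω₀ l) U x =
      ∫ x in channel Ω₀ l, w x * (c x * φ x) := by
    refine integral_congr_ae ?_
    filter_upwards [hce] with x hx
    rw [hx]; ring
  have hcφ : MemLp (fun x => c x * φ x) 2 (volume.restrict (channel Ω₀ l)) :=
    (memLp_of_continuous hΩ₀ hφ.continuous).of_le_mul (c := c₀)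
      (hb.measurable_div.mul hφ.continuous.measurable).aestronglyMeasurable
      (Eventually.of_forall fun x => by
        rw [norm_mul]
        exact mul_le_mul_of_nonneg_right (hb.abs_div_le x) (norm_nonneg _))
  have i1 := hw.integrable_mul (hb.memLp_transportOp hΩ₀ hφ)
  have i2 := hw.integrable_mul hcφ
  have e4 : ∫ x in channel Ω₀ l, w x * (transportOp b c φ x - c x * φ x) =
      (∫ x in channel Ω₀ l, w x * transportOp b c φ x) -
        ∫ x in channel Ω₀ l, w x * (c x * φ x) := by
    simp_rw [mul_sub]
    exact integral_sub i1 i2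
  rw [e1, e2, e3, e4, neg_sub, sub_sub_cancel_left]

lemma MemLinfL2.memLp (hΩ₀ : IsSmoothBounded Ω₀) {w : Space → ℝ} (hw : MemLinfL2 Ω₀ l w) :
    MemLp w 2 (volume.restrict (channel Ω₀ l)) :=
  ⟨hw.1, (eLpNorm_le_of_sliceNorm_le hΩ₀ hw.1 (ENNReal.ae_le_essSup _)).trans_lt
    (ENNReal.mul_lt_top (ENNReal.rpow_lt_top_of_nonneg (by norm_num) (by simp)) hw.2)⟩

end SteadyTransport

end

/-! ### The theorem -/

open SteadyTransport in
theorem mainTheorem5 (Ω₀ : Set Plane) (hΩ₀ : IsSmoothBounded Ω₀) (l : ℝ) (hl : 0 < l)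
    (p : ℝ) (hp : 3 < p) :
    ∃ δ : ℝ, 0 < δ ∧ ∃ C : ℝ≥0, ∀ U : Fin 3 → Space → ℝ,
      (∀ k, MemW2 (channel Ω₀ l) (ENNReal.ofReal p) (U k)) →
      ∑ k, normW2 (channel Ω₀ l) (ENNReal.ofReal p) (U k) ≤ ENNReal.ofReal δ →
      TangentOnWall Ω₀ l U →
      ∀ (h : Space → ℝ) (w_in : Plane → ℝ),
        MemLp h 2 (volume.restrict (channel Ω₀ l)) →
        MemLp w_in 2 (volume.restrict Ω₀) →
        ∃ w : Space → ℝ,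
          MemLinfL2 Ω₀ l w ∧
          IsWeakSolution Ω₀ l U h w_in w ∧
          normLinfL2 Ω₀ l w ≤
            C * (eLpNorm w_in 2 (volume.restrict Ω₀)
              + eLpNorm h 2 (volume.restrict (channel Ω₀ l))) ∧
          ∀ w' : Space → ℝ, MemLinfL2 Ω₀ l w' → IsWeakSolution Ω₀ l U h w_in w' →
            w' =ᵐ[volume.restrict (channel Ω₀ l)] w := by
  -- Uniqueness needs c₀ l ≤ 1/32, while existence is content with 1/4. As c₀ depends on l alone, δ
  -- depends only on the channel and p.
  set c₀ : ℝ≥0 := Real.toNNReal (1 / (32 * l)) with hc₀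
  have hc₀pos : 0 < c₀ := Real.toNNReal_pos.2 (by positivity)
  have hc₀l : c₀ * l ≤ 1 / 32 := by
    rw [hc₀, Real.coe_toNNReal _ (by positivity)]
    apply le_of_eq; field_simp
  obtain ⟨δ, hδ, L, H⟩ := exists_isTransportField hΩ₀ hl hp hc₀pos
  refine ⟨δ, hδ, estimateConst l, fun U hU hn ht h w_in hh hw_in => ?_⟩
  obtain ⟨b, c, hb, hbe, hce, hin⟩ := H U hU hn ht
  obtain ⟨w, hw, hws, hwn⟩ := hb.exists_weak_solution hΩ₀ hl.le (by linarith) hh hw_in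
  refine ⟨w, ⟨hw.1, hwn.trans_lt ?_⟩, ?_, hwn, fun w' hw' hws' => ?_⟩
  · exact ENNReal.mul_lt_top ENNReal.coe_lt_top (ENNReal.add_lt_top.2 ⟨hw_in.2, hh.2⟩)
  · exact (hb.isWeakSolution_iff hΩ₀ hbe hce hin h w_in hw).2 hws
  · have hw'2 := hw'.memLp hΩ₀
    have hws'' := (hb.isWeakSolution_iff hΩ₀ hbe hce hin h w_in hw'2).1 hws'
    have key := hb.ae_eq_zero hΩ₀ hl hc₀l (hw'2.sub hw) fun φ h1 h2 => by
      have i1 := hw'2.integrable_mul (hb.memLp_transportOp hΩ₀ h1)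
      have i2 := hw.integrable_mul (hb.memLp_transportOp hΩ₀ h1)
      have e := integral_sub i1 i2
      simp only [Pi.mul_apply, ← sub_mul] at e
      simp only [Pi.sub_apply]
      rw [e]
      linarith [hws φ h1 h2, hws'' φ h1 h2]
    filter_upwards [key] with x hx
    exact sub_eq_zero.1 hx
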